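/- Let $N\ge 1$. A *colored $N$-space* is a graph whose vertices are partitioned into levels $\mathcal A_0,\dots,\mathcal A_N$ such that vertices of $\mathcal A_i$ are linked only to vertices of $\mathcal A_{i-1}\cup\mathcal A_{i+1}$; it is viewed as a first-order structure with the edge relation and one unary predicate for each level. One adds imaginary vertices $a_{-1}$ of level $-1$ and $a_{N+1}$ of level $N+1$. A vertex $a$ of level $l$ *lies beneath* a vertex $b$ of level $r>l$ (and $b$ *over* $a$) if there is a path $a=c_l,c_{l+1},\dots,c_r=b$ with $c_k\in\mathcal A_k$; by convention $a_{-1}$ lies beneath, and $a_{N+1}$ over, every other vertex. For a nonempty interval $s=(l,r)=\{l+1,\dots,r-1\}\subseteq\{0,\dots,N\}$, the space $B$ is obtained from $A$ by the *operation $\alpha_s$* if there are (possibly imaginary) $a_l,a_r$ of levels $l,r$ in $A$, with $a_l$ beneath $a_r$, such that $B$ consists of $A$ and new vertices $b_{l+1},\dots,b_{r-1}$, with $b_i$ of level $i$, and the only new edges are those of the path $a_l,b_{l+1},\dots,b_{r-1},a_r$. An embedding $A\to B$ of finite colored $N$-spaces is *strong* (resp. *$0$-strong*) if $B$ is obtained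 from the image of $A$ by finitely many operations $\alpha_s$ (resp. operations $\alpha_s$ with $s$ a singleton). Let $\mathcal K_\infty$ be the class of finite colored $N$-spaces obtained from the empty space by operations $\alpha_s$, and let $\mathcal K_0$ be the class of finite colored $N$-spaces obtained from a path $a_0-\dots-a_N$ with $a_i\in\mathcal A_i$ by operations $\alpha_s$ with $s$ a singleton. A *Fraïssé limit* of a class $\mathcal K$ with a class $\mathcal S$ of embeddings is the union of a chain $A_0\subseteq A_1\subseteq\cdots$ of members of $\mathcal K$, with all inclusions in $\mathcal S$, such that for every $i$ and every $f:A_i\to B$ in $\mathcal S$ with $B\in\mathcal K$ there are $j\ge i$ and $g:B\to A_j$ in $\mathcal S$ such that $g\circ f$ is the inclusion. Let $M_0$ be the Fraïssé limit of $\mathcal K_0$ with $0$-strong embeddings, and $M_\infty$ the Fraïssé limit of $\mathcal K_\infty$ with strong embeddings. Let $PS_N$ be the first-order theory whose models are the colored $N$-spaces $M$ with the following two properties. Here $\mathcal A_t$ is the induced subgraph on the vertices with level in $t$, and a vertex lies between $a$ and $b$ if it lies over $a$ and beneath $b$. 1. (Simple connectedness.) Let $-1\le l<r\le N+1$, let $t\subseteq[l,r]$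 be an interval, let $a$ of level $l$ lie beneath $b$ of level $r$ (possibly imaginary), and let $x,y\in\mathcal A_t$ lie between $a$ and $b$. If $x$ and $y$ are joined by a path of length $k$ in $\mathcal A_t$ that passes neither through $a$ nor through $b$, then they are joined by a path in $\mathcal A_t$ of length at most $k$ all of whose vertices lie between $a$ and $b$. 2. For every finite $A\subseteq M$, every nonempty interval $s=(l,r)\subseteq\{0,\dots,N\}$, all $a_l,a_r$ of levels $l,r$ in $A$ or imaginary, with $a_l$ beneath $a_r$, and every $k$, there is a path $a_l,b_{l+1},\dots,b_{r-1},a_r$, with $b_i$ of level $i$, such that every $b_i$ has distance greater than $k$ in $\mathcal A_s$ to every element of $A\cap\mathcal A_s$. Then both Fraïssé limits exist; $M_0$ is the prime model of $PS_N$ (it is a model of $PS_N$ that embeds elementarily into every model of $PS_N$); and $M_\infty$ is an $\omega$-saturated model of $PS_N$. -/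

import Mathlib

universe u v

namespace FreePseudospace

open FirstOrder FirstOrder.Language

/-! ### Colored spaces -/

/-- A colored `N`-space on the vertex set `V`: a graph together with a partition of the vertices
into levels `0, …, N`, such that edges only join vertices of consecutive levels. -/
class ColoredSpace (N : outParam ℕ) (V : Type u) where
  /-- The level (color) of a vertex. -/
  level : V → Fin (N + 1)
  /-- The underlying graph. -/
  graph : SimpleGraph V
  adj_level : ∀ {x y : V}, graph.Adj x y →
    (level x : ℕ) + 1 = level y ∨ (level y : ℕ) + 1 = level x

open ColoredSpace

section Spaces

variable {N : ℕ} {V : Type u} [ColoredSpace N V]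

/-- A set of vertices, with the induced graph and levels. -/
instance inducedSpace (C : Set V) : ColoredSpace N C where
  level x := level (x : V)
  graph := (graph : SimpleGraph V).induce C
  adj_level h := adj_level (V := V) h

/-- One ascending step of a path inside the subspace `C`. -/
def UpStep (C : Set V) (x y : V) : Prop :=
  x ∈ C ∧ y ∈ C ∧ (graph : SimpleGraph V).Adj x y ∧ (level x : ℕ) + 1 = level y

/-- In the subspace `C`, the vertex `x` lies beneath `y`: there is a path
`x = c_l, c_{l+1}, …, c_r = y` in `C` with `l < r` and `c_k` of level `k`. -/
def Beneath (C : Set V) : V → V → Prop :=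
  Relation.TransGen (UpStep C)

/-- Possible lower end points are the vertices and the imaginary vertex `⊥` of level `-1`; possible
upper end points are the vertices and the imaginary vertex `⊤` of level `N + 1`.
`EndsBeneath C a b` says that `a` and `b` belong to `C` (if real) and that `a` lies beneath `b`
in `C`. The imaginary vertices lie beneath, respectively over, everything. -/
def EndsBeneath (C : Set V) : WithBot V → WithTop V → Prop
  | ⊥, ⊤ => True
  | ⊥, (b : V) => b ∈ C
  | (a : V), ⊤ => a ∈ C
  | (a : V), (b : V) => Beneath C a b

/-- The lower end point `a` has level `i - 1`. -/
def LowerLevel (i : Fin (N + 1)) : WithBot V → Prop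
  | ⊥ => (i : ℕ) = 0
  | (a : V) => (level a : ℕ) + 1 = i

/-- The upper end point `b` has level `j + 1`. -/
def UpperLevel (j : Fin (N + 1)) : WithTop V → Prop
  | ⊤ => (j : ℕ) = N
  | (b : V) => (level b : ℕ) = j + 1

/-- The subspace `D` is obtained from the subspace `C` by the operation `α_s` for the nonempty
interval `s = [i, j]`, that is, `s = (i - 1, j + 1)`: there are vertices `a` of level `i - 1`
beneath `c` of level `j + 1` in `C` (possibly imaginary) and new vertices `b_i, …, b_j`, with
`b_m` of level `m`, such that `D = C ∪ {b_i, …, b_j}` and the only edges of `D` that are not edges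
of `C` are those of the path `a, b_i, …, b_j, c`.
(The values of `b` outside of `[i, j]` are irrelevant.) -/
def AlphaStep (i j : Fin (N + 1)) (C D : Set V) : Prop :=
  i ≤ j ∧ ∃ (a : WithBot V) (c : WithTop V) (b : Fin (N + 1) → V),
    LowerLevel i a ∧ UpperLevel j c ∧ EndsBeneath C a c ∧
    (∀ m ∈ Set.Icc i j, level (b m) = m ∧ b m ∉ C) ∧
    D = C ∪ b '' Set.Icc i j ∧
    ∀ m ∈ Set.Icc i j, ∀ x ∈ D, (graph : SimpleGraph V).Adj (b m) x ↔
      (∃ m' ∈ Set.Icc i j, x = b m' ∧ ((m : ℕ) + 1 = m' ∨ (m' : ℕ) + 1 = m)) ∨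
      (m = i ∧ a = (x : WithBot V)) ∨ (m = j ∧ c = (x : WithTop V))

/-- `D` is obtained from its subspace `C` by a finite sequence of operations `α_{[i, j]}`
with `P i j`. (Every operation adds a vertex, so for finite `D` all sequences are finite.) -/
def StrongSub (P : Fin (N + 1) → Fin (N + 1) → Prop) (C D : Set V) : Prop :=
  Relation.ReflTransGen (fun C' D' : Set V => ∃ i j, P i j ∧ AlphaStep i j C' D') C D

/-- The set `F` is a flag: a path `a_0, …, a_N` with `a_i` of level `i`. -/
def IsFlag (F : Set V) : Prop :=
  ∃ a : Fin (N + 1) → V, F = Set.range a ∧ (∀ i, level (a i) = i) ∧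
    ∀ i : Fin N, (graph : SimpleGraph V).Adj (a i.castSucc) (a i.succ)

end Spaces

/-- `f : V → W` is a strong embedding with respect to the operations `α_{[i, j]}` with `P i j`:
an isomorphism of `V` with a strong subspace of `W`. -/
structure IsStrongEmbedding {N : ℕ} (P : Fin (N + 1) → Fin (N + 1) → Prop) {V W : Type u}
    [ColoredSpace N V] [ColoredSpace N W] (f : V → W) : Prop where
  injective : Function.Injective f
  level_eq : ∀ x, level (f x) = level x
  adj_iff : ∀ x y, (graph : SimpleGraph W).Adj (f x) (f y) ↔ (graph : SimpleGraph V).Adj x y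
  strong : StrongSub P (Set.range f) Set.univ

/-! ### Fraïssé limits -/

/-- `M` is a Fraïssé limit (of length `ω`) of the class `K` of colored `N`-spaces with the class
`S` of embeddings between members of `K`: it is the union of an increasing chain `A 0, A 1, …` of
`S`-substructures in `K` that is rich, that is, for every `f : A i → B` in `S` there are `j ≥ i`
and `g : B → A j` in `S` such that `g ∘ f` is the inclusion. -/
def IsFraisseLimit {N : ℕ} (K : ∀ (V : Type u) [ColoredSpace N V], Prop)
    (S : ∀ {V W : Type u} [ColoredSpace N V] [ColoredSpace N W], (V → W) → Prop)
    (M : Type u) [ColoredSpace N M] : Prop :=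
  ∃ A : ℕ → Set M,
    (⋃ i, A i) = Set.univ ∧
    (∀ i, K (A i)) ∧
    (∀ i j, i ≤ j → ∃ h : A i ⊆ A j, S (Set.inclusion h)) ∧
    ∀ (i : ℕ) (B : Type u) [ColoredSpace N B], K B → ∀ f : A i → B, S f →
      ∃ j, i ≤ j ∧ ∃ g : B → A j, S g ∧ ∀ x : A i, (g (f x) : M) = x

/-- All intervals are allowed. -/
def allIntervals (N : ℕ) : Fin (N + 1) → Fin (N + 1) → Prop := fun _ _ => True

/-- Only singleton intervals are allowed. -/
def singletons (N : ℕ) : Fin (N + 1) → Fin (N + 1) → Prop := fun i j => i = j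

/-- The class `K_∞` of finite colored `N`-spaces that are obtained from the empty space by the
operations `α_s`, for arbitrary nonempty intervals `s`. -/
def KInfty (N : ℕ) (V : Type u) [ColoredSpace N V] : Prop :=
  Finite V ∧ StrongSub (allIntervals N) (∅ : Set V) Set.univ

/-- The class `K_0` of finite colored `N`-spaces that are obtained from a flag
by the operations `α_s`, for singletons `s`. -/
def KZero (N : ℕ) (V : Type u) [ColoredSpace N V] : Prop :=
  Finite V ∧ ∃ F : Set V, IsFlag F ∧ StrongSub (singletons N) F Set.univ

/-- `M` is the Fraïssé limit `M_∞` of `K_∞` with strong embeddings. -/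
def IsMInfty (N : ℕ) (M : Type u) [ColoredSpace N M] : Prop :=
  IsFraisseLimit (fun V [ColoredSpace N V] => KInfty N V)
    (fun {V W} [ColoredSpace N V] [ColoredSpace N W] (f : V → W) =>
      IsStrongEmbedding (allIntervals N) f) M

/-- `M` is the Fraïssé limit `M_0` of `K_0` with `0`-strong embeddings. -/
def IsMZero (N : ℕ) (M : Type u) [ColoredSpace N M] : Prop :=
  IsFraisseLimit (fun V [ColoredSpace N V] => KZero N V)
    (fun {V W} [ColoredSpace N V] [ColoredSpace N W] (f : V → W) =>
      IsStrongEmbedding (singletons N) f) M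

/-! ### The language and the theory of the free pseudospace -/

/-- The relation symbols: one unary symbol for each level, and the binary edge relation. -/
inductive PSRel (N : ℕ) : ℕ → Type
  | level (i : Fin (N + 1)) : PSRel N 1
  | edge : PSRel N 2

/-- The language of colored `N`-spaces. -/
def psLang (N : ℕ) : FirstOrder.Language.{0, 0} := ⟨fun _ => Empty, PSRel N⟩

/-- A colored `N`-space as a first-order structure. -/
instance psStructure {N : ℕ} {V : Type u} [ColoredSpace N V] : (psLang N).Structure V where
  funMap := fun f => Empty.elim f
  RelMap := fun {_} r => match r with
    | PSRel.level i => fun x => level (x 0) = i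
    | PSRel.edge => fun x => (graph : SimpleGraph V).Adj (x 0) (x 1)

section Formulas

variable {N : ℕ} {α : Type}

/-- `x` has level `i`. -/
def levF (i : Fin (N + 1)) (x : α) : (psLang N).Formula α :=
  Relations.formula₁ (L := psLang N) (PSRel.level i : PSRel N 1) (Term.var x)

/-- `x` and `y` are linked. -/
def edgeF (N : ℕ) (x y : α) : (psLang N).Formula α :=
  Relations.formula₂ (L := psLang N) (PSRel.edge : PSRel N 2) (Term.var x) (Term.var y)

/-- `x = y`. -/
def eqF (N : ℕ) (x y : α) : (psLang N).Formula α :=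
  Term.equal (L := psLang N) (Term.var x) (Term.var y)

/-- The level of `x` belongs to the interval `[i, j]`. -/
noncomputable def inF (i j : Fin (N + 1)) (x : α) : (psLang N).Formula α :=
  Formula.iSup fun m : Set.Icc i j => levF (m : Fin (N + 1)) x

/-- `x` and `y` are linked, and the level of `y` is one more than that of `x`. -/
noncomputable def upF (N : ℕ) (x y : α) : (psLang N).Formula α :=
  edgeF N x y ⊓ Formula.iSup fun m : Fin N => levF m.castSucc x ⊓ levF m.succ y

/-- `x` lies beneath `y`: there is an ascending path of length between `1` and `N` from `x` to
`y`. -/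
noncomputable def beneathF (N : ℕ) (x y : α) : (psLang N).Formula α :=
  Formula.iSup fun d : Fin N => Formula.iExs (Fin (d + 2)) <|
    eqF N (Sum.inr 0) (Sum.inl x) ⊓ eqF N (Sum.inr (Fin.last (d + 1))) (Sum.inl y) ⊓
    Formula.iInf fun e : Fin (d + 1) => upF N (Sum.inr e.castSucc) (Sum.inr e.succ)

/-- The vertex `x` lies over the (possibly imaginary) vertex `a`. -/
noncomputable def overLoF (N : ℕ) (x : α) : WithBot α → (psLang N).Formula α
  | ⊥ => ⊤
  | (a : α) => beneathF N a x

/-- The vertex `x` lies beneath the (possibly imaginary) vertex `b`. -/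
noncomputable def beneathUpF (N : ℕ) (x : α) : WithTop α → (psLang N).Formula α
  | ⊤ => ⊤
  | (b : α) => beneathF N x b

/-- The (possibly imaginary) vertex `a` lies beneath the (possibly imaginary) vertex `b`. -/
noncomputable def endsBeneathF (N : ℕ) : WithBot α → WithTop α → (psLang N).Formula α
  | ⊥, _ => ⊤
  | (a : α), b => beneathUpF N a b

/-- The vertex `x` lies between `a` and `b`. -/
noncomputable def betweenF (N : ℕ) (a : WithBot α) (b : WithTop α) (x : α) :
    (psLang N).Formula α :=
  overLoF N x a ⊓ beneathUpF N x b

/-- `x` is different from the lower end point `a`. -/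
def neLoF (N : ℕ) (x : α) : WithBot α → (psLang N).Formula α
  | ⊥ => ⊤
  | (a : α) => (eqF N x a).not

/-- `x` is different from the upper end point `b`. -/
def neUpF (N : ℕ) (x : α) : WithTop α → (psLang N).Formula α
  | ⊤ => ⊤
  | (b : α) => (eqF N x b).not

/-- The level of the lower end point is at most `i`. -/
noncomputable def loLeF (i : Fin (N + 1)) : WithBot α → (psLang N).Formula α
  | ⊥ => ⊤
  | (a : α) => inF 0 i a

/-- The level of the upper end point is at least `j`. -/
noncomputable def upGeF (j : Fin (N + 1)) : WithTop α → (psLang N).Formula α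
  | ⊤ => ⊤
  | (b : α) => inF j (Fin.last N) b

/-- The level of the lower end point is `i - 1`. -/
noncomputable def loEqF (i : Fin (N + 1)) : WithBot α → (psLang N).Formula α
  | ⊥ => if (i : ℕ) = 0 then ⊤ else ⊥
  | (a : α) => Formula.iSup fun m : {m : Fin (N + 1) // (m : ℕ) + 1 = i} => levF m.1 a

/-- The level of the upper end point is `j + 1`. -/
noncomputable def upEqF (j : Fin (N + 1)) : WithTop α → (psLang N).Formula α
  | ⊤ => if (j : ℕ) = N then ⊤ else ⊥
  | (b : α) => Formula.iSup fun m : {m : Fin (N + 1) // (m : ℕ) = j + 1} => levF m.1 b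

/-- `x` is linked to the lower end point `a` (no condition if `a` is imaginary). -/
def edgeLoF (N : ℕ) (x : α) : WithBot α → (psLang N).Formula α
  | ⊥ => ⊤
  | (a : α) => edgeF N a x

/-- `x` is linked to the upper end point `b` (no condition if `b` is imaginary). -/
def edgeUpF (N : ℕ) (x : α) : WithTop α → (psLang N).Formula α
  | ⊤ => ⊤
  | (b : α) => edgeF N x b

/-- `p 0, …, p k` is a path. -/
noncomputable def stepsF (N k : ℕ) (p : Fin (k + 1) → α) : (psLang N).Formula α :=
  Formula.iInf fun e : Fin k => edgeF N (p e.castSucc) (p e.succ)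

/-- There is a path of length at most `k` from `x` to `y` all of whose vertices have their level in
`[i, j]` and lie between `a` and `b`. -/
noncomputable def pathLeF (i j : Fin (N + 1)) (k : ℕ) (a : WithBot α) (b : WithTop α) (x y : α) :
    (psLang N).Formula α :=
  Formula.iSup fun d : Fin (k + 1) => Formula.iExs (Fin (d + 1)) <|
    eqF N (Sum.inr 0) (Sum.inl x) ⊓ eqF N (Sum.inr (Fin.last d)) (Sum.inl y) ⊓
    stepsF N d Sum.inr ⊓
    Formula.iInf fun e : Fin (d + 1) => inF i j (Sum.inr e) ⊓
      betweenF N (a.map Sum.inl) (b.map Sum.inl) (Sum.inr e)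

/-- The universal closure of a formula in finitely many variables. -/
noncomputable def allClosure {N : ℕ} {β : Type} [Finite β] (φ : (psLang N).Formula β) :
    (psLang N).Sentence :=
  Formula.iAlls β (φ.relabel (Sum.inr : β → Empty ⊕ β))

end Formulas

/-- The axioms of colored `N`-spaces. -/
def coloredAxioms (N : ℕ) : (psLang N).Theory :=
  {allClosure (inF 0 (Fin.last N) (0 : Fin 1))} ∪
  {φ | ∃ i j : Fin (N + 1), i ≠ j ∧
    φ = allClosure (levF i (0 : Fin 1) ⊓ levF j (0 : Fin 1)).not} ∪
  {allClosure ((edgeF N (0 : Fin 2) 1).imp (edgeF N 1 0))} ∪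
  {allClosure ((edgeF N (0 : Fin 2) 1).imp (upF N 0 1 ⊔ upF N 1 0))}

/-- One instance of simple connectedness, for the interval `t = [i, j]` and paths of length `k`:
if `a` lies beneath `b`, the interval `t` is contained in `[l, r]` where `l` and `r` are the levels
of `a` and `b`, and `p 0, …, p k` is a path in the levels `t` which passes neither through `a` nor
through `b` and whose end points lie between `a` and `b`, then there is a path of length at most `k`
in the levels `t` between the same end points, with all vertices between `a` and `b`.
Each of `a` and `b` is either one of the variables `Sum.inl 0`, `Sum.inl 1` or imaginary. -/
noncomputable def simplyConnectedAxiom {N : ℕ} (i j : Fin (N + 1)) (k : ℕ)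
    (lo : WithBot (Fin 2)) (up : WithTop (Fin 2)) : (psLang N).Sentence :=
  let a : WithBot (Fin 2 ⊕ Fin (k + 1)) := lo.map Sum.inl
  let b : WithTop (Fin 2 ⊕ Fin (k + 1)) := up.map Sum.inl
  let p : Fin (k + 1) → Fin 2 ⊕ Fin (k + 1) := Sum.inr
  allClosure <|
    (endsBeneathF N a b ⊓ loLeF i a ⊓ upGeF j b ⊓
      betweenF N a b (p 0) ⊓ betweenF N a b (p (Fin.last k)) ⊓ stepsF N k p ⊓
      Formula.iInf fun e : Fin (k + 1) => inF i j (p e) ⊓ neLoF N (p e) a ⊓ neUpF N (p e) b).imp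
    (pathLeF i j k a b (p 0) (p (Fin.last k)))

/-- One instance of the extension axiom, for the interval `s = [i, j] = (l, r)`, for sets
`A = {c_0, …, c_{n-1}}` of at most `n` vertices and for the distance `k`: if `a_l` of level `l` lies
beneath `a_r` of level `r`, both in `A` or imaginary, then there is a path
`a_l, b_i, …, b_j, a_r` with `b_m` of level `m`, such that no `b_m` has `s`-distance at most `k` to
an element of `A` with level in `s`. (The quantified `b_m` with `m` outside of `s` are dummies.) -/
noncomputable def extensionAxiom {N : ℕ} (i j : Fin (N + 1)) (n k : ℕ)
    (lo : WithBot (Fin n)) (up : WithTop (Fin n)) : (psLang N).Sentence :=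
  let b : Fin (N + 1) → Fin n ⊕ Fin (N + 1) := Sum.inr
  allClosure <|
    (endsBeneathF N lo up ⊓ loEqF i lo ⊓ upEqF j up).imp <|
    Formula.iExs (Fin (N + 1)) <|
      (Formula.iInf fun m : Set.Icc i j => levF m.1 (b m)) ⊓
      (Formula.iInf fun m : {m : Fin N // i ≤ m.castSucc ∧ m.succ ≤ j} =>
        edgeF N (b m.1.castSucc) (b m.1.succ)) ⊓
      edgeLoF N (b i) (lo.map Sum.inl) ⊓ edgeUpF N (b j) (up.map Sum.inl) ⊓
      Formula.iInf fun m : Set.Icc i j => Formula.iInf fun e : Fin n =>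
        (pathLeF i j k ⊥ ⊤ (b m) (Sum.inl e)).not

/-- The theory `PS_N` of the `N`-dimensional free pseudospace. -/
def PS (N : ℕ) : (psLang N).Theory :=
  coloredAxioms N ∪
  {φ | ∃ i j k lo up, φ = simplyConnectedAxiom i j k lo up} ∪
  {φ | ∃ i j n k lo up, i ≤ j ∧ φ = extensionAxiom i j n k lo up}

/-! ### Prime and saturated models -/

/-- `M` is a prime model of `T`: a model that embeds elementarily into every model of `T`. -/
def IsPrimeModel {L : FirstOrder.Language.{0, 0}} (T : L.Theory) (M : Type u) [L.Structure M] :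
    Prop :=
  M ⊨ T ∧ ∀ (M' : Type v) [L.Structure M'] [Nonempty M'], M' ⊨ T → Nonempty (M ↪ₑ[L] M')

/-- `M` is `ω`-saturated: for every finite set `A` of parameters, every set of formulas over `A`
in one free variable that is finitely satisfiable in `M` is realised in `M`. -/
def IsOmegaSaturated (L : FirstOrder.Language.{0, 0}) (M : Type u) [L.Structure M] : Prop :=
  ∀ A : Set M, A.Finite → ∀ p : Set (L[[A]].Formula (Fin 1)),
    (∀ q : Finset (L[[A]].Formula (Fin 1)), (q : Set (L[[A]].Formula (Fin 1))) ⊆ p →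
      ∃ x : M, ∀ φ ∈ q, φ.Realize fun _ => x) →
    ∃ x : M, ∀ φ ∈ p, φ.Realize fun _ => x

end FreePseudospace

namespace FreePseudospace

open FirstOrder FirstOrder.Language ColoredSpace

/-! The sets that control everything are the nice ones (`Nice`): they arise from the empty space by
the operations, and they reflect both connectedness within intervals of levels and the relation
"beneath". An operation preserves distances within an interval of levels (`Alpha.isometric`),
because crossing the new path takes as many steps as following an old path from a to c, and it
preserves simple connectedness (`Alpha.scon`). Hence the union of a chain of strong subspaces is
simply connected, and its stages are nice.

Two facts about simply connected spaces carry the argument. Gates: if a path from a to c with levels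
s is not connected in s to a nice set A, then every element of A over the path equals c or lies over
c, and dually for a (`gate_up`, `gate_lo`). So adding the path to A is an operation, and the result
is nice (`Nice.extend`). Covering: if moreover every vertex lies on a path through all levels, then
every vertex belongs to a nice strong extension of a given nice set (`Nice.cover`).

If paths not connected to a given finite set always exist (`Sat`), every operation over a nice set
can be imitated, and a back-and-forth shows that isomorphisms of nice subspaces preserve all
formulas. A model of `PS N` only provides paths at each finite distance, but its ultrapower is
countably saturated and hence satisfies `Sat`, and nice sets remain nice in it. So isomorphisms of
nice subspaces are elementary in arbitrary models (`NiceIso.formula_iff_of_model`).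

For the limit of all operations, the chain itself provides the unconnected paths. A type over
finitely many parameters is realised in the ultrapower; the realisation is covered by a nice set
over a stage of the chain, and this set is copied back into the limit over the same stage. For the
limit of the singleton operations, replacing the vertices of a path one at a time increases the
distances by one per sweep, which gives the extension axiom. This limit is prime because there are
no links inside one level: a new vertex avoiding a finite set is already unconnected to it, so every
model imitates the singleton operations, starting from a flag.

For existence, all possible operations are carried out simultaneously in stages. Imitating one
operation at a time suffices for a Fraïssé limit because operations amalgamate freely
(`Strong.commute`). -/

/-! ### Levels, links and walks -/

section Walks

variable {N : ℕ} {V : Type u} [ColoredSpace N V]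

/-- The level of a vertex, as a natural number. -/
def lev (x : V) : ℕ := (level x : ℕ)

/-- Two vertices are linked. -/
def Lk (x y : V) : Prop := (graph : SimpleGraph V).Adj x y

theorem lev_le (x : V) : lev x ≤ N := Nat.lt_succ_iff.1 (level x).2

theorem Lk.symm {x y : V} (h : Lk x y) : Lk y x := SimpleGraph.Adj.symm h

theorem Lk.lev {x y : V} (h : Lk x y) : lev x + 1 = lev y ∨ lev y + 1 = lev x := adj_level h

/-- There is a walk of length `k` from `x` to `y` with all vertices in `S`. -/
inductive WalkIn (S : Set V) : ℕ → V → V → Prop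
  | refl {x : V} : x ∈ S → WalkIn S 0 x x
  | tail {k : ℕ} {x y z : V} : WalkIn S k x y → Lk y z → z ∈ S → WalkIn S (k + 1) x z

/-- There is a walk from `x` to `y` with all vertices in `S`. -/
def Conn (S : Set V) (x y : V) : Prop := ∃ k, WalkIn S k x y

variable {S T : Set V} {k l : ℕ} {x y z : V}

theorem WalkIn.mono (hST : S ⊆ T) (h : WalkIn S k x y) : WalkIn T k x y := by
  induction h with
  | refl h => exact .refl (hST h)
  | tail _ h1 h2 ih => exact .tail ih h1 (hST h2)

theorem WalkIn.left_mem (h : WalkIn S k x y) : x ∈ S := by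
  induction h with
  | refl h => exact h
  | tail _ _ _ ih => exact ih

theorem WalkIn.right_mem (h : WalkIn S k x y) : y ∈ S := by
  cases h with
  | refl h => exact h
  | tail _ _ h => exact h

theorem WalkIn.trans (h : WalkIn S k x y) (h' : WalkIn S l y z) : WalkIn S (k + l) x z := by
  induction h' with
  | refl _ => exact h
  | tail _ h1 h2 ih => exact .tail (ih h) h1 h2

theorem WalkIn.single (hx : x ∈ S) (h : Lk x y) (hy : y ∈ S) : WalkIn S 1 x y :=
  .tail (.refl hx) h hy

theorem WalkIn.head (hx : x ∈ S) (h : Lk x y) (h' : WalkIn S k y z) : WalkIn S (k + 1) x z := by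
  rw [add_comm]
  exact (WalkIn.single hx h h'.left_mem).trans h'

theorem WalkIn.symm (h : WalkIn S k x y) : WalkIn S k y x := by
  induction h with
  | refl h => exact .refl h
  | tail _ h1 h2 ih => exact .head h2 h1.symm ih

theorem WalkIn.exists_head (h : WalkIn S (k + 1) x z) : ∃ y, x ∈ S ∧ Lk x y ∧ WalkIn S k y z := by
  have h' := h.symm
  cases h' with
  | tail h1 h2 h3 => exact ⟨_, h3, h2.symm, h1.symm⟩

theorem WalkIn.lev_le (h : WalkIn S k x y) : lev y ≤ lev x + k ∧ lev x ≤ lev y + k := by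
  induction h with
  | refl h => omega
  | tail _ h1 _ ih => rcases h1.lev with h | h <;> omega

theorem WalkIn.eq_of_zero (h : WalkIn S 0 x y) : x = y := by
  cases h with
  | refl _ => rfl

/-- Either a walk stays in the set `P`, or it visits its complement. -/
theorem WalkIn.split (P : Set V) (h : WalkIn S k x y) :
    WalkIn (S ∩ P) k x y ∨
      ∃ z ∉ P, ∃ k₁ k₂, k₁ + k₂ = k ∧ WalkIn S k₁ x z ∧ WalkIn S k₂ z y := by
  induction h with
  | @refl x h =>
    by_cases hP : x ∈ P
    · exact .inl (.refl ⟨h, hP⟩)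
    · exact .inr ⟨x, hP, 0, 0, rfl, .refl h, .refl h⟩
  | @tail k x y w h1 h2 h3 ih =>
    rcases ih with ih | ⟨z, hz, k₁, k₂, hk, h4, h5⟩
    · by_cases hP : w ∈ P
      · exact .inl (.tail ih h2 ⟨h3, hP⟩)
      · exact .inr ⟨w, hP, k + 1, 0, rfl, .tail h1 h2 h3, .refl h3⟩
    · exact .inr ⟨z, hz, k₁, k₂ + 1, by omega, h4, .tail h5 h2 h3⟩

/-- The part of a walk after the last visit of its starting point. -/
theorem WalkIn.last_visit (h : WalkIn S k x y) (hne : x ≠ y) :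
    ∃ z l, l < k ∧ Lk x z ∧ WalkIn (S ∩ {w | w ≠ x}) l z y := by
  induction h with
  | refl h => exact absurd rfl hne
  | @tail k x y w h1 h2 h3 ih =>
    by_cases hxy : x = y
    · subst hxy
      exact ⟨w, 0, by omega, h2, .refl ⟨h3, hne.symm⟩⟩
    · obtain ⟨z, l, hl, h4, h5⟩ := ih hxy
      exact ⟨z, l + 1, by omega, h4, .tail h5 h2 ⟨h3, hne.symm⟩⟩

theorem WalkIn.conn (h : WalkIn S k x y) : Conn S x y := ⟨k, h⟩

theorem Conn.mono (hST : S ⊆ T) : Conn S x y → Conn T x y := fun ⟨k, h⟩ => ⟨k, h.mono hST⟩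

theorem Conn.trans : Conn S x y → Conn S y z → Conn S x z := fun ⟨_, h⟩ ⟨_, h'⟩ => ⟨_, h.trans h'⟩

theorem Conn.symm : Conn S x y → Conn S y x := fun ⟨k, h⟩ => ⟨k, h.symm⟩

theorem Conn.refl (h : x ∈ S) : Conn S x x := ⟨0, .refl h⟩

theorem Conn.left_mem : Conn S x y → x ∈ S := fun ⟨_, h⟩ => h.left_mem

theorem Conn.right_mem : Conn S x y → y ∈ S := fun ⟨_, h⟩ => h.right_mem

/-- The vertices with level in `[p, q]`. -/
def Lv (N : ℕ) {V : Type u} [ColoredSpace N V] (p q : ℕ) : Set V := {x | p ≤ lev x ∧ lev x ≤ q}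

theorem Lv_mono {p q p' q' : ℕ} (h : p' ≤ p) (h' : q ≤ q') : (Lv N p q : Set V) ⊆ Lv N p' q' :=
  fun _ hx => ⟨h.trans hx.1, hx.2.trans h'⟩

/-! ### The relation "beneath" -/

variable {C D : Set V}

theorem UpStep.mono (h : C ⊆ D) (hs : UpStep C x y) : UpStep D x y :=
  ⟨h hs.1, h hs.2.1, hs.2.2⟩

theorem Beneath.mono (h : C ⊆ D) (hs : Beneath C x y) : Beneath D x y :=
  Relation.TransGen.mono (r := UpStep C) (p := UpStep D) (fun _ _ => UpStep.mono h) _ _ hs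

theorem Beneath.trans (h : Beneath C x y) (h' : Beneath C y z) : Beneath C x z :=
  Relation.TransGen.trans h h'

theorem Beneath.of_lk (hx : x ∈ C) (hy : y ∈ C) (h : Lk x y) (hl : lev x + 1 = lev y) :
    Beneath C x y := .single ⟨hx, hy, h, hl⟩

theorem Beneath.left_mem (h : Beneath C x y) : x ∈ C := by
  induction h with
  | single h => exact h.1
  | tail _ _ ih => exact ih

theorem Beneath.right_mem (h : Beneath C x y) : y ∈ C := by
  cases h with
  | single h => exact h.2.1
  | tail _ h => exact h.2.1

theorem Beneath.lev_lt (h : Beneath C x y) : lev x < lev y := by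
  induction h with
  | single h => have := h.2.2.2; simp only [lev]; omega
  | tail _ h ih => have := h.2.2.2; simp only [lev] at *; omega

theorem Beneath.of_lk_univ (h : Lk x y) (hl : lev x + 1 = lev y) :
    Beneath (Set.univ : Set V) x y := .of_lk trivial trivial h hl

/-- The length is the level difference, which by `WalkIn.lev_le` no walk can undercut: ascending
paths are geodesics. -/
theorem Beneath.walk (h : Beneath C x y) :
    WalkIn {z | z ∈ C ∧ (z = x ∨ Beneath C x z) ∧ (z = y ∨ Beneath C z y)}
      (lev y - lev x) x y := by
  induction h with
  | @single y h =>
    have hb : Beneath C x y := .single h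
    have : lev y - lev x = 1 := by have := h.2.2.2; simp only [lev]; omega
    rw [this]
    exact .single ⟨h.1, .inl rfl, .inr hb⟩ h.2.2.1 ⟨h.2.1, .inr hb, .inl rfl⟩
  | @tail y z hxy h ih =>
    have hb : Beneath C y z := .single h
    have h1 := Beneath.lev_lt hxy
    have : lev z - lev x = lev y - lev x + 1 := by have := h.2.2.2; simp only [lev] at *; omega
    rw [this]
    refine .tail (ih.mono ?_) h.2.2.1 ⟨h.2.1, .inr (hxy.trans hb), .inl rfl⟩
    rintro w ⟨h1, h2, h3⟩
    refine ⟨h1, h2, .inr ?_⟩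
    rcases h3 with rfl | h3
    · exact hb
    · exact h3.trans hb

theorem Beneath.conn {p q : ℕ} (h : Beneath C x y) (hp : p ≤ lev x) (hq : lev y ≤ q) :
    Conn (C ∩ Lv N p q) x y := by
  refine ⟨_, h.walk.mono ?_⟩
  rintro z ⟨h1, h2, h3⟩
  refine ⟨h1, ?_, ?_⟩
  · rcases h2 with rfl | h2
    · exact hp
    · have := h2.lev_lt; omega
  · rcases h3 with rfl | h3
    · exact hq
    · have := h3.lev_lt; omega

theorem Beneath.conn_univ {p q : ℕ} (h : Beneath C x y) (hp : p ≤ lev x) (hq : lev y ≤ q) :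
    Conn (Lv N p q) x y := (h.conn hp hq).mono Set.inter_subset_right

/-- The vertices of `C` that lie between the (possibly imaginary) vertices `a` and `c`. -/
def Between (C : Set V) (a c : Option V) : Set V :=
  {z | z ∈ C ∧ (∀ a', a = some a' → Beneath C a' z) ∧ (∀ c', c = some c' → Beneath C z c')}

theorem Between.mono {a c : Option V} (h : C ⊆ D) : Between C a c ⊆ Between D a c :=
  fun _ hz => ⟨h hz.1, fun a' ha => (hz.2.1 a' ha).mono h, fun c' hc => (hz.2.2 c' hc).mono h⟩

theorem Between.walk_of_beneath {a c : Option V} {p q : ℕ} (hx : x ∈ Between C a c)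
    (hy : y ∈ Between C a c) (h : Beneath C x y) (hp : p ≤ lev x) (hq : lev y ≤ q) :
    WalkIn (Between C a c ∩ Lv N p q) (lev y - lev x) x y := by
  refine h.walk.mono ?_
  rintro z ⟨h1, h2, h3⟩
  refine ⟨⟨h1, fun a' ha => ?_, fun c' hc => ?_⟩, ?_, ?_⟩
  · rcases h2 with rfl | h2
    · exact hx.2.1 a' ha
    · exact (hx.2.1 a' ha).trans h2
  · rcases h3 with rfl | h3
    · exact hy.2.2 c' hc
    · exact h3.trans (hy.2.2 c' hc)
  · rcases h2 with rfl | h2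
    · exact hp
    · have := h2.lev_lt; omega
  · rcases h3 with rfl | h3
    · exact hq
    · have := h3.lev_lt; omega

/-- Simple connectedness of the subspace `C`. -/
def SCon (C : Set V) : Prop :=
  ∀ (a c : Option V) (p q k : ℕ) (x y : V), (∀ a', a = some a' → lev a' ≤ p) →
    (∀ c', c = some c' → q ≤ lev c') → x ∈ Between C a c → y ∈ Between C a c →
    WalkIn {z | z ∈ C ∧ z ∈ Lv N p q ∧ a ≠ some z ∧ c ≠ some z} k x y →
    ∃ k' ≤ k, WalkIn (Between C a c ∩ Lv N p q) k' x y

end Walks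

/-! ### Reversing the levels -/

/-- The space with the levels in reversed order. -/
def Dual (V : Type u) : Type u := V

section Dual

variable {N : ℕ} {V : Type u} [ColoredSpace N V]

/-- Reversal exchanges lower and upper end points, so that only one of each pair of symmetric
statements has to be proved. -/
instance dualSpace : ColoredSpace N (Dual V) where
  level x := Fin.rev (level (V := V) x)
  graph := (graph : SimpleGraph V)
  adj_level {x y} h := by
    have := adj_level (V := V) h
    have h1 := (level (V := V) x).2
    have h2 := (level (V := V) y).2
    simp only [Fin.val_rev]
    omega

/-- A set of vertices, as a set of vertices of the dual space. -/
def dset (C : Set V) : Set (Dual V) := C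

theorem lev_dual (x : V) : lev (V := Dual V) x = N - lev x := by
  change ((Fin.rev (level (V := V) x) : Fin (N + 1)) : ℕ) = _
  simp [lev, Fin.val_rev]

theorem beneath_dual (C : Set V) (x y : V) : Beneath (dset C) x y ↔ Beneath C y x := by
  have hstep : ∀ x y : V, UpStep (dset C) x y ↔ UpStep C y x := by
    intro x y
    have h1 := lev_dual x
    have h2 := lev_dual y
    have h3 := lev_le (V := V) x
    have h4 := lev_le (V := V) y
    refine ⟨fun h => ?_, fun h => ?_⟩
    · obtain ⟨hx, hy, hl, hlev⟩ := h
      change lev (V := Dual V) x + 1 = lev (V := Dual V) y at hlev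
      refine ⟨hy, hx, Lk.symm hl, ?_⟩
      change lev y + 1 = lev x
      omega
    · obtain ⟨hy, hx, hl, hlev⟩ := h
      change lev y + 1 = lev x at hlev
      refine ⟨hx, hy, Lk.symm hl, ?_⟩
      change lev (V := Dual V) x + 1 = lev (V := Dual V) y
      omega
  have : UpStep (V := Dual V) (dset C) = Function.swap (UpStep (V := V) C) := by
    funext x y
    exact propext (hstep x y)
  change Relation.TransGen (UpStep (V := Dual V) (dset C)) x y ↔ _
  rw [this]
  exact Relation.transGen_swap

theorem walkIn_dual (S : Set V) (k : ℕ) (x y : V) : WalkIn (dset S) k x y ↔ WalkIn S k x y := by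
  constructor
  · intro h
    induction h with
    | refl h => exact .refl h
    | tail _ h1 h2 ih => exact .tail ih h1 h2
  · intro h
    induction h with
    | refl h => exact .refl (S := dset S) h
    | tail _ h1 h2 ih => exact .tail (S := dset S) ih h1 h2

theorem between_dual (C : Set V) (a c : Option V) :
    Between (dset C) c a = dset (Between C a c) := by
  ext z
  constructor
  · rintro ⟨h1, h2, h3⟩
    exact ⟨h1, fun a' h => (beneath_dual C z a').1 (h3 a' h),
      fun c' h => (beneath_dual C c' z).1 (h2 c' h)⟩
  · rintro ⟨h1, h2, h3⟩
    exact ⟨h1, fun a' h => (beneath_dual C a' z).2 (h3 a' h),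
      fun c' h => (beneath_dual C z c').2 (h2 c' h)⟩

theorem Lv_dual {p q : ℕ} (hp : p ≤ N) : Lv N (N - q) (N - p) = dset (Lv N p q : Set V) := by
  ext z
  have h1 := lev_dual (V := V) z
  have h3 := lev_le (V := V) z
  change N - q ≤ lev (V := Dual V) z ∧ lev (V := Dual V) z ≤ N - p ↔
    p ≤ lev (V := V) z ∧ lev (V := V) z ≤ q
  omega

theorem SCon.dual {C : Set V} (h : SCon C) : SCon (dset C) := by
  intro a c p q k x y ha hc hx hy hw
  have hx0 := hw.left_mem.2.1
  -- For p > N the truncated difference N - p would be 0 and the reversed interval could contain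
  -- vertices; the given walk excludes this. A bound q > N is harmless.
  have hp : p ≤ N := hx0.1.trans (lev_le _)
  have hq : N - q ≤ N := Nat.sub_le _ _
  have hmem : ∀ z : V, (z ∈ (Lv N p q : Set (Dual V)) ↔ z ∈ (Lv N (N - q) (N - p) : Set V)) := by
    intro z
    have h1 := lev_dual (V := V) z
    have h3 := lev_le (V := V) z
    change p ≤ lev (V := Dual V) z ∧ lev (V := Dual V) z ≤ q ↔
      N - q ≤ lev (V := V) z ∧ lev (V := V) z ≤ N - p
    omega
  obtain ⟨k', hk, hw'⟩ := h c a (N - q) (N - p) k x y (fun c' h => by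
      have := hc c' h
      have h1 := lev_dual (V := V) c'
      change q ≤ lev (V := Dual V) c' at this
      have h2 := lev_le (V := V) c'
      change lev (V := V) c' ≤ N - q
      omega) (fun a' h => by
      have := ha a' h
      have h1 := lev_dual (V := V) a'
      have h2 := lev_le (V := V) a'
      change lev (V := Dual V) a' ≤ p at this
      change N - p ≤ lev (V := V) a'
      omega) ((between_dual C c a).subset hx) ((between_dual C c a).subset hy) (by
      refine ((walkIn_dual _ _ _ _).1 (hw.mono (T := dset _) ?_))
      rintro z ⟨h1, h2, h3, h4⟩
      exact ⟨h1, (hmem z).1 h2, h4, h3⟩)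
  refine ⟨k', hk, ((walkIn_dual _ _ _ _).2 hw').mono ?_⟩
  rintro z ⟨h1, h2⟩
  exact ⟨(between_dual C c a).superset h1, (hmem z).2 h2⟩

end Dual

/-! ### The operations -/

section Alpha

variable {N : ℕ} {V : Type u} [ColoredSpace N V]

/-- The subspace `D` arises from `C` by adding the new path `b i, …, b j` between the (possibly
imaginary) vertices `a` and `c`. -/
structure Alpha (N : ℕ) {V : Type u} [ColoredSpace N V] (i j : ℕ) (a c : Option V) (b : ℕ → V)
    (C D : Set V) : Prop where
  le : i ≤ j
  le_top : j ≤ N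
  lo_none : a = none → i = 0
  lo_some : ∀ x, a = some x → x ∈ C ∧ lev x + 1 = i
  up_none : c = none → j = N
  up_some : ∀ x, c = some x → x ∈ C ∧ lev x = j + 1
  ends : ∀ x y, a = some x → c = some y → Beneath C x y
  lev_b : ∀ m, i ≤ m → m ≤ j → lev (b m) = m
  not_mem : ∀ m, i ≤ m → m ≤ j → b m ∉ C
  mem_iff : ∀ x, x ∈ D ↔ x ∈ C ∨ ∃ m, i ≤ m ∧ m ≤ j ∧ x = b m
  lk_iff : ∀ m, i ≤ m → m ≤ j → ∀ x ∈ D, Lk (b m) x ↔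
    (∃ m', i ≤ m' ∧ m' ≤ j ∧ x = b m' ∧ (m + 1 = m' ∨ m' + 1 = m)) ∨
    (m = i ∧ a = some x) ∨ (m = j ∧ c = some x)

variable {i j : ℕ} {a c : Option V} {b : ℕ → V} {C D : Set V}

namespace Alpha

theorem subset (h : Alpha N i j a c b C D) : C ⊆ D := fun _ hx => (h.mem_iff _).2 (.inl hx)

theorem mem_b (h : Alpha N i j a c b C D) {m : ℕ} (hi : i ≤ m) (hj : m ≤ j) : b m ∈ D :=
  (h.mem_iff _).2 (.inr ⟨m, hi, hj, rfl⟩)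

theorem lk_old (h : Alpha N i j a c b C D) {m : ℕ} (hi : i ≤ m) (hj : m ≤ j) {x : V}
    (hx : x ∈ C) : Lk (b m) x ↔ (m = i ∧ a = some x) ∨ (m = j ∧ c = some x) := by
  rw [h.lk_iff m hi hj x (h.subset hx)]
  constructor
  · rintro (⟨m', h1, h2, rfl, _⟩ | h')
    · exact absurd hx (h.not_mem m' h1 h2)
    · exact h'
  · exact .inr

theorem lk_succ (h : Alpha N i j a c b C D) {m : ℕ} (hi : i ≤ m) (hj : m + 1 ≤ j) :
    Lk (b m) (b (m + 1)) :=
  (h.lk_iff m hi (by omega) _ (h.mem_b (by omega) hj)).2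
    (.inl ⟨m + 1, by omega, hj, rfl, .inl rfl⟩)

theorem lk_lo (h : Alpha N i j a c b C D) {x : V} (hx : a = some x) : Lk x (b i) :=
  ((h.lk_old le_rfl h.le (h.lo_some x hx).1).2 (.inl ⟨rfl, hx⟩)).symm

theorem lk_up (h : Alpha N i j a c b C D) {x : V} (hx : c = some x) : Lk (b j) x :=
  (h.lk_old h.le le_rfl (h.up_some x hx).1).2 (.inr ⟨rfl, hx⟩)

theorem beneath_b (h : Alpha N i j a c b C D) {m m' : ℕ} (hi : i ≤ m) (hm : m < m')
    (hj : m' ≤ j) : Beneath D (b m) (b m') := by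
  induction m' with
  | zero => omega
  | succ n ih =>
    have h1 : Beneath D (b n) (b (n + 1)) :=
      .of_lk (h.mem_b (by omega) (by omega)) (h.mem_b (by omega) hj) (h.lk_succ (by omega) hj)
        (by rw [h.lev_b n (by omega) (by omega), h.lev_b (n + 1) (by omega) (by omega)])
    rcases Nat.lt_or_ge m n with hlt | hge
    · exact (ih hlt (by omega)).trans h1
    · have : m = n := by omega
      exact this ▸ h1

theorem beneath_up (h : Alpha N i j a c b C D) {m : ℕ} (hi : i ≤ m) (hj : m ≤ j) {x : V}
    (hx : c = some x) : Beneath D (b m) x := by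
  have h1 : Beneath D (b j) x := .of_lk (h.mem_b h.le le_rfl) (h.subset (h.up_some x hx).1)
    (h.lk_up hx) (by rw [h.lev_b j h.le le_rfl, (h.up_some x hx).2])
  rcases Nat.lt_or_ge m j with hlt | hge
  · exact (h.beneath_b hi hlt le_rfl).trans h1
  · have : m = j := by omega
    exact this ▸ h1

theorem dual (h : Alpha N i j a c b C D) :
    Alpha N (V := Dual V) (N - j) (N - i) c a (fun m => b (N - m)) (dset C) (dset D) := by
  have hle := h.le
  have htop := h.le_top
  constructor
  · omega
  · omega
  · intro hc; rw [h.up_none hc]; omega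
  · intro x hx
    obtain ⟨h1, h2⟩ := h.up_some x hx
    refine ⟨h1, ?_⟩
    have h3 := lev_dual (V := V) x
    have h4 := lev_le (V := V) x
    change lev (V := V) x = _ at h2
    change lev (V := Dual V) x + 1 = _
    omega
  · intro hc; rw [h.lo_none hc]; omega
  · intro x hx
    obtain ⟨h1, h2⟩ := h.lo_some x hx
    refine ⟨h1, ?_⟩
    have h3 := lev_dual (V := V) x
    change lev (V := V) x + 1 = _ at h2
    change lev (V := Dual V) x = _
    omega
  · intro x y hx hy
    exact (beneath_dual C x y).2 (h.ends y x hy hx)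
  · intro m h1 h2
    have h3 := lev_dual (V := V) (b (N - m))
    have h4 := h.lev_b (N - m) (by omega) (by omega)
    change lev (V := Dual V) (b (N - m)) = _
    omega
  · intro m h1 h2
    exact h.not_mem (N - m) (by omega) (by omega)
  · intro x
    refine (h.mem_iff x).trans (or_congr Iff.rfl ⟨?_, ?_⟩)
    · rintro ⟨m, h1, h2, h3⟩
      refine ⟨N - m, by omega, by omega, ?_⟩
      rw [h3]
      change b m = b (N - (N - m))
      congr 1
      omega
    · rintro ⟨m, h1, h2, h3⟩
      exact ⟨N - m, by omega, by omega, h3⟩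
  · intro m h1 h2 x hx
    refine (h.lk_iff (N - m) (by omega) (by omega) x hx).trans (or_congr ⟨?_, ?_⟩ ?_)
    · rintro ⟨m', h1, h2, h3, h4⟩
      refine ⟨N - m', by omega, by omega, ?_, by omega⟩
      rw [h3]
      change b m' = b (N - (N - m'))
      congr 1
      omega
    · rintro ⟨m', h1, h2, h3, h4⟩
      exact ⟨N - m', by omega, by omega, h3, by omega⟩
    · rw [or_comm]
      refine or_congr (and_congr ?_ Iff.rfl) (and_congr ?_ Iff.rfl) <;> omega

theorem beneath_lo (h : Alpha N i j a c b C D) {m : ℕ} (hi : i ≤ m) (hj : m ≤ j) {x : V}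
    (hx : a = some x) : Beneath D x (b m) := by
  have h1 : Beneath D x (b i) := .of_lk (h.subset (h.lo_some x hx).1) (h.mem_b le_rfl h.le)
    (h.lk_lo hx) (by rw [h.lev_b i le_rfl h.le, (h.lo_some x hx).2])
  rcases Nat.lt_or_ge i m with hlt | hge
  · exact h1.trans (h.beneath_b le_rfl hlt hj)
  · have : i = m := by omega
    exact this ▸ h1

/-- Old vertices over a given vertex of the extended space. -/
theorem beneath_old (h : Alpha N i j a c b C D) {x y : V} (hxy : Beneath D x y) (hy : y ∈ C) :
    (x ∈ C → Beneath C x y) ∧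
      ∀ m, i ≤ m → m ≤ j → x = b m → ∃ c', c = some c' ∧ (c' = y ∨ Beneath C c' y) := by
  induction hxy using Relation.TransGen.head_induction_on with
  | @single x hs =>
    obtain ⟨h1, h2, h3, h4⟩ := hs
    refine ⟨fun hx => .of_lk hx hy h3 h4, ?_⟩
    rintro m hi hj rfl
    rcases (h.lk_old hi hj hy).1 h3 with ⟨rfl, h5⟩ | ⟨rfl, h5⟩
    · have h6 := (h.lo_some y h5).2
      have h7 := h.lev_b m hi hj
      simp only [lev] at h6 h7
      omega
    · exact ⟨y, h5, .inl rfl⟩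
  | @head x z hs hzy ih =>
    obtain ⟨h1, h2, h3, h4⟩ := hs
    change lev x + 1 = lev z at h4
    rcases (h.mem_iff z).1 h2 with hz | ⟨m', hi', hj', rfl⟩
    · refine ⟨fun hx => (Beneath.of_lk hx hz h3 h4).trans (ih.1 hz), ?_⟩
      rintro m hi hj rfl
      rcases (h.lk_old hi hj hz).1 h3 with ⟨rfl, h5⟩ | ⟨rfl, h5⟩
      · have h6 := (h.lo_some z h5).2
        have h7 := h.lev_b m hi hj
        omega
      · exact ⟨z, h5, .inr (ih.1 hz)⟩
    · obtain ⟨c', hc, hcy⟩ := ih.2 m' hi' hj' rfl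
      refine ⟨fun hx => ?_, fun _ _ _ _ => ⟨c', hc, hcy⟩⟩
      -- An ascending step from an old vertex into the new path starts at a. The path leaves through
      -- c, so the detour is replaced by the relation a beneath c that holds in C.
      rcases (h.lk_old hi' hj' hx).1 (Lk.symm h3) with ⟨rfl, h5⟩ | ⟨rfl, h5⟩
      · have h8 := h.ends x c' h5 hc
        rcases hcy with rfl | hcy
        · exact h8
        · exact h8.trans hcy
      · have h6 := (h.up_some x h5).2
        have h7 := h.lev_b m' hi' hj'
        omega

theorem beneath_of_old (h : Alpha N i j a c b C D) {x y : V} (hx : x ∈ C) (hy : y ∈ C)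
    (hxy : Beneath D x y) : Beneath C x y := (h.beneath_old hxy hy).1 hx

theorem exists_up (h : Alpha N i j a c b C D) {m : ℕ} (hi : i ≤ m) (hj : m ≤ j) {y : V}
    (hy : y ∈ C) (hxy : Beneath D (b m) y) : ∃ c', c = some c' ∧ (c' = y ∨ Beneath C c' y) :=
  (h.beneath_old hxy hy).2 m hi hj rfl

theorem exists_lo (h : Alpha N i j a c b C D) {m : ℕ} (hi : i ≤ m) (hj : m ≤ j) {y : V}
    (hy : y ∈ C) (hxy : Beneath D y (b m)) : ∃ a', a = some a' ∧ (a' = y ∨ Beneath C y a') := by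
  have htop := h.le_top
  have hb : b m = b (N - (N - m)) := by congr 1; omega
  obtain ⟨a', ha, h'⟩ := (h.dual.beneath_old ((beneath_dual D (b m) y).2 hxy) hy).2 (N - m)
    (by omega) (by omega) hb
  exact ⟨a', ha, h'.imp id (beneath_dual C a' y).1⟩

/-- A walk in the extended space, starting at an old vertex, can be replaced by a walk of old
vertices up to the point where it enters the new path for the last time. -/
theorem walk_old (h : Alpha N i j a c b C D) {S S' : Set V} (hS : ∀ x ∈ S, x ∈ C → x ∈ S')
    (hf : ∀ a' c', a = some a' → c = some c' → a' ∈ S → c' ∈ S → WalkIn (S' ∩ C) (j + 2 - i) a' c')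
    {k : ℕ} {x y : V} (hx : x ∈ C) (hw : WalkIn (S ∩ D) k x y) :
    (y ∈ C → ∃ k' ≤ k, WalkIn (S' ∩ C) k' x y) ∧
    ∀ m, i ≤ m → m ≤ j → y = b m →
      (∃ a', a = some a' ∧ a' ∈ S ∧ ∃ k', k' + (m + 1 - i) ≤ k ∧ WalkIn (S' ∩ C) k' x a') ∨
      (∃ c', c = some c' ∧ c' ∈ S ∧ ∃ k', k' + (j + 1 - m) ≤ k ∧ WalkIn (S' ∩ C) k' x c') := by
  induction hw with
  | @refl x hxS =>
    refine ⟨fun _ => ⟨0, le_rfl, .refl ⟨hS x hxS.1 hx, hx⟩⟩, ?_⟩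
    rintro m hi hj rfl
    exact absurd hx (h.not_mem m hi hj)
  | @tail k x y z h1 h2 h3 ih =>
    have ih := ih hx
    have hyS := h1.right_mem
    have hle := h.le
    rcases (h.mem_iff y).1 hyS.2 with hy | ⟨m, hi, hj, rfl⟩
    · obtain ⟨k', hk', hw'⟩ := ih.1 hy
      refine ⟨fun hz => ⟨k' + 1, by omega, .tail hw' h2 ⟨hS z h3.1 hz, hz⟩⟩, ?_⟩
      rintro m hi hj rfl
      rcases (h.lk_old hi hj hy).1 (Lk.symm h2) with ⟨rfl, h5⟩ | ⟨rfl, h5⟩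
      · exact .inl ⟨y, h5, hyS.1, k', by omega, hw'⟩
      · exact .inr ⟨y, h5, hyS.1, k', by omega, hw'⟩
    · have ih := ih.2 m hi hj rfl
      refine ⟨fun hz => ?_, ?_⟩
      -- Leaving the new path through the end by which it was entered saves steps. Crossing it from
      -- one end to the other has cost j + 2 - i steps, exactly the length of the old walk given by
      -- `hf`.
      · rcases (h.lk_old hi hj hz).1 h2 with ⟨rfl, h5⟩ | ⟨rfl, h5⟩
        · rcases ih with ⟨a', ha, haS, k', hk', hw'⟩ | ⟨c', hc, hcS, k', hk', hw'⟩
          · rw [h5] at ha; cases ha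
            exact ⟨k', by omega, hw'⟩
          · exact ⟨k' + (j + 2 - m), by omega, hw'.trans (hf z c' h5 hc h3.1 hcS).symm⟩
        · rcases ih with ⟨a', ha, haS, k', hk', hw'⟩ | ⟨c', hc, hcS, k', hk', hw'⟩
          · exact ⟨k' + (m + 2 - i), by omega, hw'.trans (hf a' z ha h5 haS h3.1)⟩
          · rw [h5] at hc; cases hc
            exact ⟨k', by omega, hw'⟩
      · rintro m' hi' hj' rfl
        have hl := h2.lev
        rw [h.lev_b m hi hj, h.lev_b m' hi' hj'] at hl
        rcases ih with ⟨a', ha, haS, k', hk', hw'⟩ | ⟨c', hc, hcS, k', hk', hw'⟩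
        · exact .inl ⟨a', ha, haS, k', by omega, hw'⟩
        · exact .inr ⟨c', hc, hcS, k', by omega, hw'⟩

/-- The old path witnessing that a lies beneath c has the same length as the new one, and its inner
vertices have the same levels. This is the substitute required as `hf` in `walk_old`. -/
theorem walk_ends (h : Alpha N i j a c b C D) {a' c' : V} (ha : a = some a') (hc : c = some c') :
    WalkIn ({z | z = a' ∨ z = c' ∨ i ≤ lev z ∧ lev z ≤ j} ∩ C) (j + 2 - i) a' c' := by
  have h1 := (h.lo_some a' ha).2
  have h2 := (h.up_some c' hc).2
  have h3 := (h.ends a' c' ha hc).walk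
  have : lev c' - lev a' = j + 2 - i := by omega
  rw [this] at h3
  refine h3.mono ?_
  rintro z ⟨hz, h4, h5⟩
  refine ⟨?_, hz⟩
  rcases h4 with rfl | h4
  · exact .inl rfl
  rcases h5 with rfl | h5
  · exact .inr (.inl rfl)
  have := h4.lev_lt
  have := h5.lev_lt
  exact .inr (.inr ⟨by omega, by omega⟩)

/-- The operations preserve distances inside intervals of levels. -/
theorem isometric (h : Alpha N i j a c b C D) {p q k : ℕ} {x y : V} (hx : x ∈ C) (hy : y ∈ C)
    (hw : WalkIn (Lv N p q ∩ D) k x y) : ∃ k' ≤ k, WalkIn (Lv N p q ∩ C) k' x y := by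
  refine (h.walk_old (S' := Lv N p q) (fun x h _ => h) ?_ hx hw).1 hy
  intro a' c' ha hc haS hcS
  refine (h.walk_ends ha hc).mono (Set.inter_subset_inter_left _ ?_)
  have h1 := (h.lo_some a' ha).2
  have h2 := (h.up_some c' hc).2
  have h3 := haS.1
  have h4 := hcS.2
  rintro z (rfl | rfl | hz)
  · exact haS
  · exact hcS
  · exact ⟨by omega, by omega⟩

/-! ### Simple connectedness is preserved -/

theorem between_old (h : Alpha N i j a c b C D) {e g : Option V}
    (he : ∀ m, i ≤ m → m ≤ j → e ≠ some (b m)) (hg : ∀ m, i ≤ m → m ≤ j → g ≠ some (b m))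
    {x : V} (hx : x ∈ C) (hxB : x ∈ Between D e g) : x ∈ Between C e g := by
  refine ⟨hx, fun e' h' => ?_, fun g' h' => ?_⟩
  · have h1 := hxB.2.1 e' h'
    refine h.beneath_of_old ?_ hx h1
    rcases (h.mem_iff e').1 h1.left_mem with h2 | ⟨m, hi, hj, rfl⟩
    · exact h2
    · exact absurd h' (he m hi hj)
  · have h1 := hxB.2.2 g' h'
    refine h.beneath_of_old hx ?_ h1
    rcases (h.mem_iff g').1 h1.right_mem with h2 | ⟨m, hi, hj, rfl⟩
    · exact h2
    · exact absurd h' (hg m hi hj)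

/-- Between comparable vertices the ascending path is a geodesic, and it inherits from its two ends
the property of lying between e and g. -/
theorem _root_.FreePseudospace.walk_of_comparable {e g : Option V} {p q k : ℕ} {x y : V}
    (hx : x ∈ Between D e g) (hy : y ∈ Between D e g) {S : Set V} (hS : S ⊆ Lv N p q)
    (hw : WalkIn S k x y) (hxy : x = y ∨ Beneath D x y ∨ Beneath D y x) :
    ∃ k' ≤ k, WalkIn (Between D e g ∩ Lv N p q) k' x y := by
  have h1 := hw.lev_le
  have h2 := hS hw.left_mem
  have h3 := hS hw.right_mem
  rcases hxy with rfl | hxy | hxy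
  · exact ⟨0, Nat.zero_le _, .refl ⟨hx, h2⟩⟩
  · exact ⟨_, by omega, Between.walk_of_beneath hx hy hxy h2.1 h3.2⟩
  · exact ⟨_, by omega, (Between.walk_of_beneath hy hx hxy h3.1 h2.2).symm⟩

/-- By `walk_old` the walk can be pushed into C, where simple connectedness is known. If y is new,
this works up to the end a or c by which the new path was last entered; the remainder ascends or
descends along the new path. That end lies between e and g as well: an old e beneath a new vertex
equals a or lies beneath a, and e = a is excluded because the walk avoids e; likewise for g and c.
-/
theorem scon_mixed (h : Alpha N i j a c b C D) (hC : SCon C) {e g : Option V} {p q k : ℕ}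
    (he : ∀ m, i ≤ m → m ≤ j → e ≠ some (b m)) (hg : ∀ m, i ≤ m → m ≤ j → g ≠ some (b m))
    (hep : ∀ e', e = some e' → lev e' ≤ p) (hgq : ∀ g', g = some g' → q ≤ lev g')
    {x y : V} (hxC : x ∈ C) (hx : x ∈ Between D e g) (hy : y ∈ Between D e g)
    (hw : WalkIn {z | z ∈ D ∧ z ∈ Lv N p q ∧ e ≠ some z ∧ g ≠ some z} k x y) :
    ∃ k' ≤ k, WalkIn (Between D e g ∩ Lv N p q) k' x y := by
  set S : Set V := {z | z ∈ Lv N p q ∧ e ≠ some z ∧ g ≠ some z} with hSdef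
  have hw' : WalkIn (S ∩ D) k x y := hw.mono fun z hz => ⟨hz.2, hz.1⟩
  have hf : ∀ a' c', a = some a' → c = some c' → a' ∈ S → c' ∈ S →
      WalkIn (S ∩ C) (j + 2 - i) a' c' := by
    intro a' c' ha hc haS hcS
    refine (h.walk_ends ha hc).mono (Set.inter_subset_inter_left _ ?_)
    have h1 := (h.lo_some a' ha).2
    have h2 := (h.up_some c' hc).2
    have h3 := haS.1.1
    have h4 := hcS.1.2
    rintro z (rfl | rfl | hz)
    · exact haS
    · exact hcS
    · refine ⟨⟨by omega, by omega⟩, fun he => ?_, fun hg => ?_⟩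
      · have := hep z he; omega
      · have := hgq z hg; omega
  have key := h.walk_old (S' := S) (fun x h _ => h) hf hxC hw'
  have hold : ∀ z ∈ C, z ∈ Between D e g → ∀ l, WalkIn (S ∩ C) l x z →
      ∃ k' ≤ l, WalkIn (Between D e g ∩ Lv N p q) k' x z := by
    intro z hzC hz l hl
    obtain ⟨k', hk', hw'⟩ := hC e g p q l x z hep hgq (h.between_old he hg hxC hx)
      (h.between_old he hg hzC hz) (hl.mono fun z hz => ⟨hz.2, hz.1⟩)
    exact ⟨k', hk', hw'.mono (Set.inter_subset_inter_left _ (Between.mono h.subset))⟩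
  have hyD := hw.right_mem
  rcases (h.mem_iff y).1 hyD.1 with hyC | ⟨m, hi, hj, rfl⟩
  · obtain ⟨k₁, hk₁, hw₁⟩ := key.1 hyC
    obtain ⟨k₂, hk₂, hw₂⟩ := hold y hyC hy k₁ hw₁
    exact ⟨k₂, hk₂.trans hk₁, hw₂⟩
  · have hbm := h.lev_b m hi hj
    rcases key.2 m hi hj rfl with ⟨a', ha, haS, k₁, hk₁, hw₁⟩ | ⟨c', hc, hcS, k₁, hk₁, hw₁⟩
    · have hab : Beneath D a' (b m) := h.beneath_lo hi hj ha
      obtain ⟨ha'C, ha'l⟩ := h.lo_some a' ha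
      have ha' : a' ∈ Between D e g := by
        refine ⟨h.subset ha'C, fun e' h' => ?_, fun g' h' => hab.trans (hy.2.2 g' h')⟩
        have h1 := hy.2.1 e' h'
        have h2 : e' ∈ C := by
          rcases (h.mem_iff e').1 h1.left_mem with h2 | ⟨m', hi', hj', rfl⟩
          · exact h2
          · exact absurd h' (he m' hi' hj')
        obtain ⟨a'', ha'', h3⟩ := h.exists_lo hi hj h2 h1
        rw [ha] at ha''; cases ha''
        rcases h3 with rfl | h3
        · exact absurd h' haS.2.1
        · exact h3.mono h.subset
      obtain ⟨k₂, hk₂, hw₂⟩ := hold a' ha'C ha' k₁ hw₁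
      refine ⟨_, ?_, hw₂.trans
        (Between.walk_of_beneath ha' hy hab haS.1.1 hyD.2.1.2)⟩
      omega
    · have hab : Beneath D (b m) c' := h.beneath_up hi hj hc
      obtain ⟨hc'C, hc'l⟩ := h.up_some c' hc
      have hc' : c' ∈ Between D e g := by
        refine ⟨h.subset hc'C, fun e' h' => (hy.2.1 e' h').trans hab, fun g' h' => ?_⟩
        have h1 := hy.2.2 g' h'
        have h2 : g' ∈ C := by
          rcases (h.mem_iff g').1 h1.right_mem with h2 | ⟨m', hi', hj', rfl⟩
          · exact h2
          · exact absurd h' (hg m' hi' hj')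
        obtain ⟨c'', hc'', h3⟩ := h.exists_up hi hj h2 h1
        rw [hc] at hc''; cases hc''
        rcases h3 with rfl | h3
        · exact absurd h' hcS.2.2
        · exact h3.mono h.subset
      obtain ⟨k₂, hk₂, hw₂⟩ := hold c' hc'C hc' k₁ hw₁
      refine ⟨_, ?_, hw₂.trans
        (Between.walk_of_beneath hy hc' hab hyD.2.1.1 hcS.1.2).symm⟩
      omega

theorem comparable_b (h : Alpha N i j a c b C D) {m m' : ℕ} (hi : i ≤ m) (hj : m ≤ j)
    (hi' : i ≤ m') (hj' : m' ≤ j) :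
    b m = b m' ∨ Beneath D (b m) (b m') ∨ Beneath D (b m') (b m) := by
  rcases lt_trichotomy m m' with hlt | rfl | hlt
  · exact .inr (.inl (h.beneath_b hi hlt hj'))
  · exact .inl rfl
  · exact .inr (.inr (h.beneath_b hi' hlt hj))

/-- Every old vertex over the new vertex e equals the upper end c or lies over it. So x and y are
comparable unless both lie strictly over c. In that case a walk staying above the level of c
consists of old vertices, and simple connectedness of C applies with c as lower end; a walk that
descends to the level of c is at least as long as the route from x down to c and up to y. -/
theorem scon_lower (h : Alpha N i j a c b C D) (hC : SCon C) {g : Option V} {p q k m₀ : ℕ}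
    (hi₀ : i ≤ m₀) (hj₀ : m₀ ≤ j) {e : V} (he : e = b m₀) (hgq : ∀ g', g = some g' → q ≤ lev g')
    {x y : V} (hx : x ∈ Between D (some e) g) (hy : y ∈ Between D (some e) g)
    (hw : WalkIn {z | z ∈ D ∧ z ∈ Lv N p q ∧ some e ≠ some z ∧ g ≠ some z} k x y) :
    ∃ k' ≤ k, WalkIn (Between D (some e) g ∩ Lv N p q) k' x y := by
  subst he
  have hS : {z | z ∈ D ∧ z ∈ Lv N p q ∧ some (b m₀) ≠ some z ∧ g ≠ some z} ⊆ Lv N p q :=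
    fun z hz => hz.2.1
  have hxD := hw.left_mem
  have hyD := hw.right_mem
  have hx0 := hx.2.1 _ rfl
  have hy0 := hy.2.1 _ rfl
  have hmixed : ∀ m, i ≤ m → m ≤ j → ∀ z ∈ C, Beneath D (b m₀) z → Beneath D (b m) z := by
    intro m hi hj z hz hz0
    obtain ⟨c', hc, h1⟩ := h.exists_up hi₀ hj₀ hz hz0
    have h2 := h.beneath_up hi hj hc
    rcases h1 with rfl | h1
    · exact h2
    · exact h2.trans (h1.mono h.subset)
  rcases (h.mem_iff x).1 hxD.1 with hxC | ⟨m, hi, hj, rfl⟩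
  swap
  · rcases (h.mem_iff y).1 hyD.1 with hyC | ⟨m', hi', hj', rfl⟩
    · exact walk_of_comparable hx hy hS hw (.inr (.inl (hmixed m hi hj y hyC hy0)))
    · exact walk_of_comparable hx hy hS hw (h.comparable_b hi hj hi' hj')
  rcases (h.mem_iff y).1 hyD.1 with hyC | ⟨m', hi', hj', rfl⟩
  swap
  · exact walk_of_comparable hx hy hS hw (.inr (.inr (hmixed m' hi' hj' x hxC hx0)))
  obtain ⟨c', hc, hcx⟩ := h.exists_up hi₀ hj₀ hxC hx0
  obtain ⟨c'', hc'', hcy⟩ := h.exists_up hi₀ hj₀ hyC hy0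
  rw [hc] at hc''; cases hc''
  rcases hcx with rfl | hcx
  · exact walk_of_comparable hx hy hS hw (hcy.imp id fun h' => .inl (h'.mono h.subset))
  rcases hcy with rfl | hcy
  · exact walk_of_comparable hx hy hS hw (.inr (.inr (hcx.mono h.subset)))
  obtain ⟨hcC, hcl⟩ := h.up_some c' hc
  have hlx := hcx.lev_lt
  have hly := hcy.lev_lt
  have hc'B : c' ∈ Between D (some (b m₀)) g := by
    refine ⟨h.subset hcC, fun e' h' => ?_, fun g' h' => (hcx.mono h.subset).trans (hx.2.2 g' h')⟩
    cases h'
    exact h.beneath_up hi₀ hj₀ hc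
  rcases hw.split {z | lev c' < lev z} with hw' | ⟨z, hz, k₁, k₂, rfl, hw₁, hw₂⟩
  · have hgC : ∀ g', g = some g' → g' ∈ C := by
      intro g' h'
      have h1 := hx.2.2 g' h'
      rcases (h.mem_iff g').1 h1.right_mem with h2 | ⟨m, hi, hj, rfl⟩
      · exact h2
      · have := h1.lev_lt
        rw [h.lev_b m hi hj] at this
        omega
    have hB : ∀ z ∈ C, Beneath C c' z → z ∈ Between D (some (b m₀)) g → z ∈ Between C (some c') g := by
      intro z hz hcz hzB
      refine ⟨hz, fun a' h' => ?_, fun g' h' => h.beneath_of_old hz (hgC g' h') (hzB.2.2 g' h')⟩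
      cases h'
      exact hcz
    -- Raising the lower bound to lev c' + 1 makes the walk avoid both c and the new vertices, whose
    -- levels are at most j < lev c'.
    obtain ⟨k', hk', hw''⟩ := hC (some c') g (max p (lev c' + 1)) q k x y (fun a' h' => by
        cases h'; omega) hgq (hB x hxC hcx hx) (hB y hyC hcy hy) (hw'.mono (by
        rintro z ⟨⟨h1, h2, h3, h4⟩, h5⟩
        have h5 : lev c' < lev z := h5
        refine ⟨?_, ⟨max_le h2.1 h5, h2.2⟩, ?_, h4⟩
        · rcases (h.mem_iff z).1 h1 with h6 | ⟨m, hi, hj, rfl⟩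
          · exact h6
          · rw [h.lev_b m hi hj] at h5; omega
        · intro h'; cases h'; exact lt_irrefl _ h5))
    refine ⟨k', hk', hw''.mono ?_⟩
    rintro z ⟨⟨h1, h2, h3⟩, h4, h5⟩
    refine ⟨⟨h.subset h1, fun e' h' => ?_, fun g' h' => (h3 g' h').mono h.subset⟩,
      (le_max_left _ _).trans h4, h5⟩
    cases h'
    exact (h.beneath_up hi₀ hj₀ hc).trans ((h2 c' rfl).mono h.subset)
  -- Each step changes the level by one, so the two parts of the walk have lengths at least lev x -
  -- lev c' and lev y - lev c'.
  · have hz : ¬ lev c' < lev z := hz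
    have h1 := hw₁.lev_le
    have h2 := hw₂.lev_le
    have h3 := hw₁.right_mem.2.1.1
    have hxl := hxD.2.1.2
    have hyl := hyD.2.1.2
    refine ⟨_, ?_, (Between.walk_of_beneath hc'B hx (hcx.mono h.subset) (by omega) hxl).symm.trans
      (Between.walk_of_beneath hc'B hy (hcy.mono h.subset) (by omega) hyl)⟩
    omega

/-- A new lower end is treated by `scon_lower`, a new upper end by reversing the levels. If both
ends are old or imaginary, either one of x and y is old and `scon_mixed` applies, or both lie on the
new path and are comparable. -/
theorem scon (h : Alpha N i j a c b C D) (hC : SCon C) : SCon D := by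
  intro e g p q k x y hep hgq hx hy hw
  by_cases he : ∃ m, i ≤ m ∧ m ≤ j ∧ e = some (b m)
  · obtain ⟨m, hi, hj, rfl⟩ := he
    exact h.scon_lower hC hi hj rfl hgq hx hy hw
  by_cases hg : ∃ m, i ≤ m ∧ m ≤ j ∧ g = some (b m)
  · obtain ⟨m, hi, hj, rfl⟩ := hg
    have hp : p ≤ N := hw.left_mem.2.1.1.trans (lev_le _)
    have htop := h.le_top
    have hb : b m = b (N - (N - m)) := by congr 1; omega
    obtain ⟨k', hk', hw'⟩ := h.dual.scon_lower hC.dual (m₀ := N - m) (g := e) (p := N - q)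
      (q := N - p) (k := k) (x := x) (y := y) (by omega) (by omega) hb (by
        intro e' h'
        have h1 := hep e' h'
        have h2 := lev_dual (V := V) e'
        change lev (V := V) e' ≤ p at h1
        change N - p ≤ lev (V := Dual V) e'
        omega) ((between_dual D e (some (b m))).superset hx)
      ((between_dual D e (some (b m))).superset hy) (by
        refine ((walkIn_dual _ _ _ _).2 hw).mono ?_
        rintro z ⟨h1, h2, h3, h4⟩
        exact ⟨h1, (Lv_dual hp).superset h2, h4, h3⟩)
    refine ⟨k', hk', (walkIn_dual _ _ _ _).1 (hw'.mono ?_)⟩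
    rintro z ⟨h1, h2⟩
    exact ⟨(between_dual D e (some (b m))).subset h1, (Lv_dual hp).subset h2⟩
  · push Not at he hg
    rcases (h.mem_iff x).1 hw.left_mem.1 with hxC | ⟨m, hi, hj, rfl⟩
    · exact h.scon_mixed hC he hg hep hgq hxC hx hy hw
    rcases (h.mem_iff y).1 hw.right_mem.1 with hyC | ⟨m', hi', hj', rfl⟩
    · obtain ⟨k', hk', hw'⟩ := h.scon_mixed hC he hg hep hgq hyC hy hx hw.symm
      exact ⟨k', hk', hw'.symm⟩
    · exact walk_of_comparable hx hy (fun z hz => hz.2.1) hw (h.comparable_b hi hj hi' hj')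

end Alpha

/-! ### Strong subspaces -/

/-- The subspace `D` is obtained from `C` by finitely many operations for intervals with `P`. -/
def Strong (N : ℕ) {V : Type u} [ColoredSpace N V] (P : ℕ → ℕ → Prop) (C D : Set V) : Prop :=
  Relation.ReflTransGen (fun C' D' : Set V => ∃ i j, P i j ∧ ∃ a c b, Alpha N i j a c b C' D') C D

/-- All intervals. -/
def allI : ℕ → ℕ → Prop := fun _ _ => True

/-- The intervals with one element. -/
def singI : ℕ → ℕ → Prop := fun i j => i = j

variable {P : ℕ → ℕ → Prop} {E : Set V}

theorem Strong.refl : Strong N P C C := Relation.ReflTransGen.refl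

theorem Strong.trans (h : Strong N P C D) (h' : Strong N P D E) : Strong N P C E :=
  Relation.ReflTransGen.trans h h'

theorem Strong.single (hP : P i j) (h : Alpha N i j a c b C D) : Strong N P C D :=
  Relation.ReflTransGen.single ⟨i, j, hP, a, c, b, h⟩

theorem Strong.all (h : Strong N P C D) : Strong N allI C D := by
  induction h with
  | refl => exact .refl
  | tail _ h ih =>
    obtain ⟨i, j, _, h⟩ := h
    exact .tail ih ⟨i, j, trivial, h⟩

theorem Strong.subset (h : Strong N P C D) : C ⊆ D := by
  induction h with
  | refl => exact subset_rfl
  | tail _ h ih =>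
    obtain ⟨i, j, _, a, c, b, h⟩ := h
    exact ih.trans h.subset

theorem Strong.isometric (h : Strong N P C D) {p q k : ℕ} {x y : V} (hx : x ∈ C) (hy : y ∈ C)
    (hw : WalkIn (Lv N p q ∩ D) k x y) : ∃ k' ≤ k, WalkIn (Lv N p q ∩ C) k' x y := by
  induction h generalizing k with
  | refl => exact ⟨k, le_rfl, hw⟩
  | tail h1 h ih =>
    obtain ⟨i, j, _, a, c, b, h⟩ := h
    obtain ⟨k', hk', hw'⟩ := h.isometric (Strong.subset h1 hx) (Strong.subset h1 hy) hw
    obtain ⟨k'', hk'', hw''⟩ := ih hw'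
    exact ⟨k'', hk''.trans hk', hw''⟩

theorem Strong.beneath (h : Strong N P C D) {x y : V} (hx : x ∈ C) (hy : y ∈ C)
    (hw : Beneath D x y) : Beneath C x y := by
  induction h with
  | refl => exact hw
  | tail h1 h ih =>
    obtain ⟨i, j, _, a, c, b, h⟩ := h
    exact ih (h.beneath_of_old (Strong.subset h1 hx) (Strong.subset h1 hy) hw)

theorem Strong.scon (h : Strong N P C D) (hC : SCon C) : SCon D := by
  induction h with
  | refl => exact hC
  | tail h1 h ih =>
    obtain ⟨i, j, _, a, c, b, h⟩ := h
    exact h.scon ih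

theorem scon_empty : SCon (∅ : Set V) :=
  fun _ _ _ _ _ _ _ _ _ hx _ _ => absurd hx.1 (Set.notMem_empty _)

theorem Strong.finite (h : Strong N P C D) (hC : C.Finite) : D.Finite := by
  induction h with
  | refl => exact hC
  | tail h1 h ih =>
    obtain ⟨i, j, _, a, c, b, h⟩ := h
    refine (ih.union ((Set.finite_Icc i j).image b)).subset ?_
    intro x hx
    rcases (h.mem_iff x).1 hx with hx | ⟨m, hi, hj, rfl⟩
    · exact .inl hx
    · exact .inr ⟨m, ⟨hi, hj⟩, rfl⟩

end Alpha

section Ambient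

variable {N : ℕ} {V : Type u} [ColoredSpace N V]

/-! ### Gates -/

/-- Vertices of `A` connected in an interval of levels are connected inside `A` in this interval. -/
def ConnSub (N : ℕ) {V : Type u} [ColoredSpace N V] (A : Set V) : Prop :=
  ∀ p q x y, x ∈ A → y ∈ A → Conn (Lv N p q) x y → Conn (A ∩ Lv N p q) x y

theorem ConnSub.dual {A : Set V} (h : ConnSub N A) : ConnSub N (dset A) := by
  intro p q x y hx hy hc
  obtain ⟨k, hk⟩ := hc
  have hmem : ∀ z : V, (z ∈ (Lv N p q : Set (Dual V)) ↔ z ∈ (Lv N (N - q) (N - p) : Set V)) := by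
    intro z
    have hx0 := hk.left_mem
    have hp : p ≤ N := hx0.1.trans (lev_le _)
    have h1 := lev_dual (V := V) z
    have h3 := lev_le (V := V) z
    change p ≤ lev (V := Dual V) z ∧ lev (V := Dual V) z ≤ q ↔
      N - q ≤ lev (V := V) z ∧ lev (V := V) z ≤ N - p
    omega
  obtain ⟨k', hk'⟩ := h (N - q) (N - p) x y hx hy
    ⟨k, (walkIn_dual _ _ _ _).1 (hk.mono (T := dset _) fun z hz => (hmem z).1 hz)⟩
  exact ⟨k', ((walkIn_dual _ _ _ _).2 hk').mono fun z hz => ⟨hz.1, (hmem z).2 hz.2⟩⟩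

/-- The vertices with level in `[p, q]` that are not equal to or over `r`. -/
def Avoid (r : V) (p q : ℕ) : Set V := {z | z ∈ Lv N p q ∧ ¬ (z = r ∨ Beneath Set.univ r z)}

/-- Induction on the height h: a walk avoiding r and everything over r can be lowered from height h
+ 1 to h. At a top vertex z of the walk, simple connectedness with upper end z connects neighbours
of z below z. Everything beneath z automatically avoids r and the vertices over r, because z is not
over r. The connectedness of A provides the neighbour of z at which the walk is to be continued. -/
theorem not_conn_avoid (hS : SCon (Set.univ : Set V)) {A : Set V} (hA : ConnSub N A) {x r : V}
    {p : ℕ} (hp : p ≤ lev x) (hr : r ∈ A) (hxr : Beneath Set.univ x r)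
    (hno : ∀ u ∈ A, ¬ Conn (Lv N p (lev r - 1)) x u) {h : ℕ} (hh : lev r - 1 ≤ h) :
    ∀ u ∈ A, ¬ Conn (Avoid r p h) x u := by
  induction h, hh using Nat.le_induction with
  | base => exact fun u hu hc => hno u hu (hc.mono fun z hz => hz.1)
  | succ h hh ih =>
    have hlt := hxr.lev_lt
    -- Here y has already been reached at height at most h, and k counts the steps that remain at
    -- height at most h + 1.
    have main : ∀ k y u, Conn (Avoid r p h) x y → WalkIn (Avoid r p (h + 1)) k y u → u ∈ A →
        False := by
      intro k
      induction k using Nat.strong_induction_on with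
      | _ k ihk =>
      intro y u hxy hw hu
      rcases k with _ | k
      · exact ih u hu (hw.eq_of_zero ▸ hxy)
      obtain ⟨z, hy, hyz, hw⟩ := hw.exists_head
      have hz := hw.left_mem
      by_cases hzl : lev z ≤ h
      · obtain ⟨l, hl⟩ := hxy
        exact ihk k (Nat.lt_succ_self k) z u
          ⟨l + 1, hl.tail hyz ⟨⟨hz.1.1, hzl⟩, hz.2⟩⟩ hw hu
      have hzl : lev z = h + 1 := by have := hz.1.2; omega
      have hyl : lev y + 1 = lev z := by
        have := hxy.right_mem.1.2
        rcases hyz.lev with h' | h' <;> omega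
      have hrz : r ≠ z := fun h' => hz.2 (.inl h'.symm)
      set W : Set V := Lv N p (h + 1) ∩ {w | w ≠ z} with hW
      have hxyW : Conn W x y := hxy.mono fun w hw' =>
        ⟨⟨hw'.1.1, hw'.1.2.trans (Nat.le_succ h)⟩, fun h' => by
          have := hw'.1.2
          rw [h'] at this
          omega⟩
      have hxrW : Conn W x r := by
        refine ⟨_, hxr.walk.mono ?_⟩
        rintro w ⟨_, h1, h2⟩
        refine ⟨⟨?_, ?_⟩, ?_⟩
        · rcases h1 with rfl | h1
          · exact hp
          · have := h1.lev_lt; omega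
        · rcases h2 with rfl | h2
          · omega
          · have := h2.lev_lt; omega
        · rintro rfl
          rcases h2 with rfl | h2
          · exact hrz rfl
          · have := h2.lev_lt; omega
      -- In W, the space without z, the vertices y and z' are connected via x and r. Both lie one
      -- level below z, so simple connectedness with upper end z joins them by a walk beneath z,
      -- hence of height at most h and avoiding everything over r.
      have key : ∀ z', Lk z z' → Conn W r z' → Conn (Avoid r p h) x z' := by
        intro z' hzz' hrz'
        have hl' : lev z' + 1 = lev z := by
          have := hrz'.right_mem.1.2
          rcases hzz'.lev with h' | h' <;> omega
        obtain ⟨k₁, hk₁⟩ := (hxyW.symm.trans hxrW).trans hrz'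
        obtain ⟨k₂, -, hk₂⟩ := hS none (some z) p (h + 1) k₁ y z' (fun _ h' => by cases h')
          (fun c' h' => by cases h'; omega)
          ⟨trivial, fun _ h' => (by cases h'), fun _ h' => by cases h'; exact .of_lk_univ hyz hyl⟩
          ⟨trivial, fun _ h' => (by cases h'),
            fun _ h' => by cases h'; exact .of_lk_univ hzz'.symm hl'⟩
          (hk₁.mono fun w hw' => ⟨trivial, hw'.1, by simp, fun h' => hw'.2 (by cases h'; rfl)⟩)
        refine hxy.trans ⟨k₂, hk₂.mono ?_⟩
        rintro w ⟨hw', hwl⟩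
        have hwz := hw'.2.2 z rfl
        have := hwz.lev_lt
        refine ⟨⟨hwl.1, by omega⟩, fun h' => hz.2 (.inr ?_)⟩
        rcases h' with rfl | h'
        · exact hwz
        · exact h'.trans hwz
      have hWL : W ⊆ Lv N p (h + 1) := Set.inter_subset_left
      -- If z belongs to A, then A connects z with r inside itself, and the vertex following the
      -- last visit of z is an element of A connected to x at height h, against the induction
      -- hypothesis.
      by_cases hzA : z ∈ A
      · have h1 : Conn (Lv N p (h + 1)) z r :=
          ((WalkIn.single hz.1 hyz.symm (hWL hxyW.right_mem)).conn.trans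
            (hxyW.symm.mono hWL)).trans (hxrW.mono hWL)
        obtain ⟨k₁, hk₁⟩ := hA p (h + 1) z r hzA hr h1
        obtain ⟨z', l, -, hzz', hw'⟩ := hk₁.last_visit hrz.symm
        exact ih z' hw'.left_mem.1.1 (key z' hzz' ⟨l, hw'.symm.mono fun w hw' =>
          ⟨hw'.1.2, hw'.2⟩⟩)
      -- If z is not in A, then r and u are connected inside A, thus without z. Following this and
      -- going back along the remaining walk to its last exit z' from z connects r to z' in W, and
      -- from z' fewer steps remain.
      · obtain ⟨z', l, hl, hzz', hw'⟩ := hw.last_visit (fun h' => hzA (h' ▸ hu))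
        have h1 : Conn (Lv N p (h + 1)) r u :=
          (((hxrW.symm.mono hWL).trans (hxyW.mono hWL)).trans
            (WalkIn.single (hWL hxyW.right_mem) hyz hz.1).conn).trans ⟨k, hw.mono fun w hw' => hw'.1⟩
        have h2 : Conn W r u := (hA p (h + 1) r u hr hu h1).mono fun w hw' =>
          ⟨hw'.2, fun h' => hzA (h' ▸ hw'.1)⟩
        have h3 : Conn W r z' := h2.trans ⟨l, hw'.symm.mono fun w hw' => ⟨hw'.1.1, hw'.2⟩⟩
        exact ihk l (by omega) z' u (key z' hzz' h3)
          (hw'.mono Set.inter_subset_left) hu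
    rintro u hu ⟨k, hk⟩
    have hx : x ∈ Avoid r p h := by
      refine ⟨⟨hp, by omega⟩, ?_⟩
      rintro (rfl | h')
      · exact lt_irrefl _ hxr.lev_lt
      · have := h'.lev_lt; omega
    exact main k x u (.refl hx) hk hu

/-- If y is neither c nor over c, then an ascending path from x to y meets neither c nor any vertex
over c, and `not_conn_avoid` excludes it. If c is imaginary, then j = N and the ascending path
itself connects x to A within the levels from i to j. -/
theorem gate_up (hS : SCon (Set.univ : Set V)) {A : Set V} (hA : ConnSub N A) {i j : ℕ} {x : V}
    {c : Option V} (hi : i ≤ lev x) (hc0 : c = none → j = N)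
    (hc : ∀ c', c = some c' → c' ∈ A ∧ lev c' = j + 1 ∧ Beneath Set.univ x c')
    (hd : ∀ u ∈ A, ¬ Conn (Lv N i j) x u) {y : V} (hy : y ∈ A) (hxy : Beneath Set.univ x y) :
    ∃ c', c = some c' ∧ (c' = y ∨ Beneath Set.univ c' y) := by
  rcases c with _ | r
  · refine absurd ?_ (hd y hy)
    rw [hc0 rfl]
    exact hxy.conn_univ hi (lev_le y)
  · obtain ⟨hr, hrl, hxr⟩ := hc r rfl
    refine ⟨r, rfl, ?_⟩
    by_contra hcon
    push Not at hcon
    refine not_conn_avoid hS hA hi hr hxr (by rw [hrl]; exact hd) (h := max (lev y) (lev r))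
      (by omega) y hy ⟨_, hxy.walk.mono ?_⟩
    rintro w ⟨_, h1, h2⟩
    refine ⟨⟨?_, ?_⟩, ?_⟩
    · rcases h1 with rfl | h1
      · exact hi
      · have := h1.lev_lt; omega
    · rcases h2 with rfl | h2
      · omega
      · have := h2.lev_lt; omega
    · rcases h2 with rfl | h2
      · rintro (rfl | h')
        · exact hcon.1 rfl
        · exact hcon.2 h'
      · rintro (rfl | h')
        · exact hcon.2 h2
        · exact hcon.2 (h'.trans h2)

theorem gate_lo (hS : SCon (Set.univ : Set V)) {A : Set V} (hA : ConnSub N A) {i j : ℕ} {x : V}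
    {a : Option V} (hj : lev x ≤ j) (ha0 : a = none → i = 0)
    (ha : ∀ a', a = some a' → a' ∈ A ∧ lev a' + 1 = i ∧ Beneath Set.univ a' x)
    (hiN : i ≤ N) (hd : ∀ u ∈ A, ¬ Conn (Lv N i j) x u) {y : V} (hy : y ∈ A)
    (hxy : Beneath Set.univ y x) : ∃ a', a = some a' ∧ (a' = y ∨ Beneath Set.univ y a') := by
  have h1 := lev_dual (V := V) x
  obtain ⟨a', h2, h3⟩ := gate_up (V := Dual V) (A := dset A) hS.dual hA.dual (i := N - j)
    (j := N - i) (x := x) (c := a) (by omega) (fun h' => by rw [ha0 h']; omega) (fun a' h' => by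
        obtain ⟨h2, h3, h4⟩ := ha a' h'
        refine ⟨h2, ?_, (beneath_dual Set.univ x a').2 h4⟩
        have h5 := lev_dual (V := V) a'
        change lev (V := V) a' + 1 = i at h3
        change lev (V := Dual V) a' = N - i + 1
        omega) (fun u hu hc => hd u hu (by
          obtain ⟨k, hk⟩ := hc
          rw [Lv_dual hiN] at hk
          exact ⟨k, (walkIn_dual _ _ _ _).1 hk⟩)) hy ((beneath_dual Set.univ x y).2 hxy)
  exact ⟨a', h2, h3.imp id fun h => (beneath_dual (V := V) Set.univ a' y).1 h⟩

/-! ### Nice subsets -/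

/-- `a` and `c` are possible end points of a new path with the levels `i, …, j`. -/
structure Ends (N : ℕ) {V : Type u} [ColoredSpace N V] (i j : ℕ) (a c : Option V) (C : Set V) :
    Prop where
  le : i ≤ j
  le_top : j ≤ N
  lo_none : a = none → i = 0
  lo_some : ∀ x, a = some x → x ∈ C ∧ lev x + 1 = i
  up_none : c = none → j = N
  up_some : ∀ x, c = some x → x ∈ C ∧ lev x = j + 1
  ends : ∀ x y, a = some x → c = some y → Beneath C x y

/-- `b i, …, b j` is an ascending path between the (possibly imaginary) vertices `a` and `c`. -/
structure PathAC (N : ℕ) {V : Type u} [ColoredSpace N V] (i j : ℕ) (a c : Option V) (b : ℕ → V) :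
    Prop where
  lev_b : ∀ m, i ≤ m → m ≤ j → lev (b m) = m
  lk_succ : ∀ m, i ≤ m → m + 1 ≤ j → Lk (b m) (b (m + 1))
  lk_lo : ∀ x, a = some x → Lk x (b i)
  lk_up : ∀ x, c = some x → Lk (b j) x

/-- The subspace `A` arises from the empty space by the operations, and it reflects connectedness
in intervals of levels and the relation "beneath". -/
structure Nice (N : ℕ) {V : Type u} [ColoredSpace N V] (A : Set V) : Prop where
  strong : Strong N allI ∅ A
  conn : ConnSub N A
  beneath : ∀ x ∈ A, ∀ y ∈ A, Beneath Set.univ x y → Beneath A x y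

variable {i j : ℕ} {a c : Option V} {b : ℕ → V} {A C D : Set V}

theorem Ends.mono (h : Ends N i j a c C) (hCD : C ⊆ D) : Ends N i j a c D where
  le := h.le
  le_top := h.le_top
  lo_none := h.lo_none
  lo_some x hx := ⟨hCD (h.lo_some x hx).1, (h.lo_some x hx).2⟩
  up_none := h.up_none
  up_some x hx := ⟨hCD (h.up_some x hx).1, (h.up_some x hx).2⟩
  ends x y hx hy := (h.ends x y hx hy).mono hCD

theorem Alpha.toEnds (h : Alpha N i j a c b C D) : Ends N i j a c C :=
  ⟨h.le, h.le_top, h.lo_none, h.lo_some, h.up_none, h.up_some, h.ends⟩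

theorem Nice.finite (h : Nice N A) : A.Finite := h.strong.finite Set.finite_empty

theorem Nice.scon (h : Nice N A) : SCon A := h.strong.scon scon_empty

theorem nice_empty : Nice N (∅ : Set V) :=
  ⟨.refl, fun _ _ _ _ hx => absurd hx (Set.notMem_empty _), fun _ hx => absurd hx (Set.notMem_empty _)⟩

theorem PathAC.beneath_b (h : PathAC N i j a c b) {m m' : ℕ} (hi : i ≤ m) (hm : m < m')
    (hj : m' ≤ j) : Beneath Set.univ (b m) (b m') := by
  induction m' with
  | zero => omega
  | succ n ih =>
    have h1 : Beneath Set.univ (b n) (b (n + 1)) :=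
      .of_lk_univ (h.lk_succ n (by omega) hj)
        (by rw [h.lev_b n (by omega) (by omega), h.lev_b (n + 1) (by omega) (by omega)])
    rcases Nat.lt_or_ge m n with hlt | hge
    · exact (ih hlt (by omega)).trans h1
    · have : m = n := by omega
      exact this ▸ h1

/-- A new path that is not connected to a nice subset is an instance of the operation, and the
result is nice again. -/
theorem Nice.extend (hS : SCon (Set.univ : Set V)) (hA : Nice N A) (he : Ends N i j a c A)
    (hp : PathAC N i j a c b)
    (hd : ∀ m, i ≤ m → m ≤ j → ∀ u ∈ A, ¬ Conn (Lv N i j) (b m) u) :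
    Alpha N i j a c b A (A ∪ b '' Set.Icc i j) ∧ Nice N (A ∪ b '' Set.Icc i j) := by
  have hle := he.le
  have htop := he.le_top
  have hbl : ∀ m, i ≤ m → m ≤ j → b m ∈ (Lv N i j : Set V) := fun m hi hj => by
    refine ⟨?_, ?_⟩ <;> rw [hp.lev_b m hi hj] <;> assumption
  have hup : ∀ m, i ≤ m → m ≤ j → ∀ c', c = some c' → Beneath Set.univ (b m) c' := by
    intro m hi hj c' hc
    have h1 : Beneath Set.univ (b j) c' := .of_lk_univ (hp.lk_up c' hc)
      (by rw [hp.lev_b j hle le_rfl, (he.up_some c' hc).2])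
    rcases Nat.lt_or_ge m j with hlt | hge
    · exact (hp.beneath_b hi hlt le_rfl).trans h1
    · have : m = j := by omega
      exact this ▸ h1
  have hlo : ∀ m, i ≤ m → m ≤ j → ∀ a', a = some a' → Beneath Set.univ a' (b m) := by
    intro m hi hj a' ha
    have h1 : Beneath Set.univ a' (b i) := .of_lk_univ (hp.lk_lo a' ha)
      (by rw [hp.lev_b i le_rfl hle, (he.lo_some a' ha).2])
    rcases Nat.lt_or_ge i m with hlt | hge
    · exact h1.trans (hp.beneath_b le_rfl hlt hj)
    · have : i = m := by omega
      exact this ▸ h1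
  -- The gates determine how the new path relates to A: upwards everything passes through c,
  -- downwards through a.
  have gup : ∀ m, i ≤ m → m ≤ j → ∀ y ∈ A, Beneath Set.univ (b m) y →
      ∃ c', c = some c' ∧ (c' = y ∨ Beneath Set.univ c' y) := fun m hi hj y hy hb =>
    gate_up hS hA.conn (by rw [hp.lev_b m hi hj]; exact hi) he.up_none
      (fun c' hc => ⟨(he.up_some c' hc).1, (he.up_some c' hc).2, hup m hi hj c' hc⟩)
      (hd m hi hj) hy hb
  have glo : ∀ m, i ≤ m → m ≤ j → ∀ y ∈ A, Beneath Set.univ y (b m) →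
      ∃ a', a = some a' ∧ (a' = y ∨ Beneath Set.univ y a') := fun m hi hj y hy hb =>
    gate_lo hS hA.conn (by rw [hp.lev_b m hi hj]; exact hj) he.lo_none
      (fun a' ha => ⟨(he.lo_some a' ha).1, (he.lo_some a' ha).2, hlo m hi hj a' ha⟩)
      (hle.trans htop) (hd m hi hj) hy hb
  have hα : Alpha N i j a c b A (A ∪ b '' Set.Icc i j) := by
    refine ⟨he.le, he.le_top, he.lo_none, he.lo_some, he.up_none, he.up_some, he.ends, hp.lev_b,
      fun m hi hj hm => hd m hi hj _ hm (.refl (hbl m hi hj)), fun x => ?_, ?_⟩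
    · refine or_congr Iff.rfl ⟨?_, ?_⟩
      · rintro ⟨m, h, rfl⟩; exact ⟨m, h.1, h.2, rfl⟩
      · rintro ⟨m, h, h', rfl⟩; exact ⟨m, ⟨h, h'⟩, rfl⟩
    · intro m hi hj x hx
      have hbm := hp.lev_b m hi hj
      constructor
      · intro hl
        have hll := hl.lev
        rcases hx with hx | ⟨m', ⟨hi', hj'⟩, rfl⟩
        · rcases hll with h1 | h1
          -- The vertex x is the gate or over it, while lev x = m + 1 is at most the level j + 1 of
          -- the gate; so x is the gate and m = j.
          · obtain ⟨c', hc, h2⟩ := gup m hi hj x hx (.of_lk_univ hl h1)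
            have h3 := (he.up_some c' hc).2
            rcases h2 with rfl | h2
            · exact .inr (.inr ⟨by omega, hc⟩)
            · have := h2.lev_lt; omega
          · obtain ⟨a', ha, h2⟩ := glo m hi hj x hx (.of_lk_univ hl.symm h1)
            have h3 := (he.lo_some a' ha).2
            rcases h2 with rfl | h2
            · exact .inr (.inl ⟨by omega, ha⟩)
            · have := h2.lev_lt; omega
        · rw [hbm, hp.lev_b m' hi' hj'] at hll
          exact .inl ⟨m', hi', hj', rfl, hll⟩
      · rintro (⟨m', hi', hj', rfl, h1 | h1⟩ | ⟨rfl, h1⟩ | ⟨rfl, h1⟩)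
        · subst h1; exact hp.lk_succ m hi hj'
        · subst h1; exact (hp.lk_succ m' hi' hj).symm
        · exact (hp.lk_lo x h1).symm
        · exact hp.lk_up x h1
  refine ⟨hα, hA.strong.trans (.single trivial hα), ?_, ?_⟩
  · have hbA : ∀ p q m, i ≤ m → m ≤ j → ∀ y ∈ A, Conn (Lv N p q) (b m) y →
        Conn ((A ∪ b '' Set.Icc i j) ∩ Lv N p q) (b m) y := by
      intro p q m hi hj y hy hc
      have hbm := hp.lev_b m hi hj
      have hml := hc.left_mem
      -- The levels from p to q cannot all lie between i and j, since the new path is not connected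
      -- to A there. So the level of a real end point a or c belongs to them; it is reached along
      -- the new path, and from there the connectedness of A takes over.
      by_cases hpi : i ≤ p
      · by_cases hqj : q ≤ j
        · exact absurd (hc.mono (Lv_mono hpi hqj)) (hd m hi hj y hy)
        rcases c with _ | c'
        · have := he.up_none rfl
          refine absurd (hc.mono fun z hz => ?_) (hd m hi hj y hy)
          exact ⟨hpi.trans hz.1, by rw [this]; exact lev_le z⟩
        · obtain ⟨h1, h2⟩ := he.up_some c' rfl
          have h3 := (hα.beneath_up hi hj rfl).conn hml.1 (q := q) (by omega)
          have h4 := hA.conn p q c' y h1 hy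
            (((hup m hi hj c' rfl).conn_univ hml.1 (by omega)).symm.trans hc)
          exact h3.trans (h4.mono (Set.inter_subset_inter_left _ Set.subset_union_left))
      · rcases a with _ | a'
        · have := he.lo_none rfl; omega
        · obtain ⟨h1, h2⟩ := he.lo_some a' rfl
          have h3 := (hα.beneath_lo hi hj rfl).conn (p := p) (by omega) hml.2
          have h4 := hA.conn p q a' y h1 hy
            (((hlo m hi hj a' rfl).conn_univ (by omega) hml.2).trans hc)
          exact h3.symm.trans (h4.mono (Set.inter_subset_inter_left _ Set.subset_union_left))
    rintro p q x y (hx | ⟨m, ⟨hi, hj⟩, rfl⟩) (hy | ⟨m', ⟨hi', hj'⟩, rfl⟩) hc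
    · exact (hA.conn p q x y hx hy hc).mono (Set.inter_subset_inter_left _ Set.subset_union_left)
    · exact (hbA p q m' hi' hj' x hx hc.symm).symm
    · exact hbA p q m hi hj y hy hc
    · have h1 := hc.left_mem
      have h2 := hc.right_mem
      rcases hα.comparable_b hi hj hi' hj' with h3 | h3 | h3
      · rw [← h3]
        exact .refl ⟨.inr ⟨m, ⟨hi, hj⟩, rfl⟩, h1⟩
      · exact h3.conn h1.1 h2.2
      · exact (h3.conn h2.1 h1.2).symm
  · rintro x (hx | ⟨m, ⟨hi, hj⟩, rfl⟩) y (hy | ⟨m', ⟨hi', hj'⟩, rfl⟩) hb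
    · exact (hA.beneath x hx y hy hb).mono hα.subset
    · obtain ⟨a', ha, h1⟩ := glo m' hi' hj' x hx hb
      have h2 := hα.beneath_lo hi' hj' ha
      rcases h1 with rfl | h1
      · exact h2
      · exact ((hA.beneath x hx a' (he.lo_some a' ha).1 h1).mono hα.subset).trans h2
    · obtain ⟨c', hc, h1⟩ := gup m hi hj y hy hb
      have h2 := hα.beneath_up hi hj hc
      rcases h1 with rfl | h1
      · exact h2
      · exact h2.trans ((hA.beneath c' (he.up_some c' hc).1 y hy h1).mono hα.subset)
    · have := hb.lev_lt
      rw [hp.lev_b m hi hj, hp.lev_b m' hi' hj'] at this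
      exact hα.beneath_b hi this hj'

/-! ### Every vertex belongs to a nice extension -/

/-- Every vertex lies on a path through all levels. -/
structure Full (N : ℕ) {V : Type u} [ColoredSpace N V] (C : Set V) : Prop where
  down : ∀ x ∈ C, lev x ≠ 0 → ∃ y ∈ C, Lk y x ∧ lev y + 1 = lev x
  up : ∀ x ∈ C, lev x ≠ N → ∃ y ∈ C, Lk x y ∧ lev y = lev x + 1

theorem Full.exists_bot (h : Full N C) : ∀ (n : ℕ) (x : V), lev x = n → x ∈ C →
    ∃ y, lev y = 0 ∧ y ∈ C ∧ (y = x ∨ Beneath C y x) := by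
  intro n
  induction n with
  | zero => exact fun x hx hxC => ⟨x, hx, hxC, .inl rfl⟩
  | succ n ih =>
    intro x hx hxC
    obtain ⟨y, hyC, hyx, hl⟩ := h.down x hxC (by omega)
    obtain ⟨z, hz, hzC, hzy⟩ := ih y (by omega) hyC
    have h1 := Beneath.of_lk hyC hxC hyx hl
    refine ⟨z, hz, hzC, .inr ?_⟩
    rcases hzy with rfl | hzy
    · exact h1
    · exact hzy.trans h1

theorem Full.exists_top (h : Full N C) : ∀ (n : ℕ) (x : V), lev x + n = N → x ∈ C →
    ∃ y, lev y = N ∧ y ∈ C ∧ (x = y ∨ Beneath C x y) := by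
  intro n
  induction n with
  | zero => exact fun x hx hxC => ⟨x, hx, hxC, .inl rfl⟩
  | succ n ih =>
    intro x hx hxC
    obtain ⟨y, hyC, hyx, hl⟩ := h.up x hxC (by omega)
    obtain ⟨z, hz, hzC, hzy⟩ := ih y (by omega) hyC
    have h1 := Beneath.of_lk hxC hyC hyx hl.symm
    refine ⟨z, hz, hzC, .inr ?_⟩
    rcases hzy with rfl | hzy
    · exact h1
    · exact h1.trans hzy

/-- Indexing the path by levels allows two such paths to be glued at a common vertex; values at
other indices are irrelevant. -/
theorem Beneath.exists_path {x y : V} (h : x = y ∨ Beneath C x y) :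
    ∃ f : ℕ → V, f (lev x) = x ∧ f (lev y) = y ∧
      (∀ m, lev x ≤ m → m ≤ lev y → lev (f m) = m) ∧
      ∀ m, lev x ≤ m → m < lev y → Lk (f m) (f (m + 1)) := by
  rcases h with rfl | h
  · exact ⟨fun _ => x, rfl, rfl, fun m h1 h2 => h1.antisymm h2, fun m h1 h2 => absurd h2 h1.not_gt⟩
  induction h with
  | @single y h =>
    have hl : lev x + 1 = lev y := h.2.2.2
    refine ⟨fun m => if m = lev x then x else y, by simp, by simp [← hl], fun m h1 h2 => ?_,
      fun m h1 h2 => ?_⟩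
    · by_cases hm : m = lev x
      · simp [hm]
      · simp only [hm, if_false]; omega
    · have : m = lev x := by omega
      subst this
      simpa [Lk] using h.2.2.1
  | @tail y z hxy h ih =>
    have hl : lev y + 1 = lev z := h.2.2.2
    have hlt := Beneath.lev_lt hxy
    obtain ⟨f, h1, h2, h3, h4⟩ := ih
    refine ⟨fun m => if m = lev z then z else f m, ?_, by simp, fun m h5 h6 => ?_,
      fun m h5 h6 => ?_⟩
    · have : lev x ≠ lev z := by omega
      simp [this, h1]
    · by_cases hm : m = lev z
      · simp [hm]
      · simp only [hm, if_false]; exact h3 m h5 (by omega)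
    · have : m ≠ lev z := by omega
      simp only [this, if_false]
      by_cases hm : m = lev y
      · subst hm
        rw [if_pos hl, h2]
        exact h.2.2.1
      · rw [if_neg (by omega)]
        exact h4 m h5 (by omega)

/-- A path from a to x is glued to a path from x to c. For an imaginary end, `Full` continues the
path to level 0 or to level N. -/
theorem exists_path_through (hF : Full N (Set.univ : Set V)) {x : V}
    (hx : x ∈ Between Set.univ a c) (hi : i ≤ lev x) (hj : lev x ≤ j)
    (ha0 : a = none → i = 0) (ha : ∀ x, a = some x → lev x + 1 = i)
    (hc0 : c = none → j = N) (hc : ∀ x, c = some x → lev x = j + 1) :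
    ∃ b, PathAC N i j a c b ∧ b (lev x) = x := by
  have hlo : ∃ y, (y = x ∨ Beneath Set.univ y x) ∧
      ((a = none ∧ lev y = i) ∨ (a = some y ∧ lev y + 1 = i)) := by
    rcases a with _ | a'
    · obtain ⟨y, h1, -, h2⟩ := hF.exists_bot _ x rfl trivial
      exact ⟨y, h2, .inl ⟨rfl, h1.trans (ha0 rfl).symm⟩⟩
    · exact ⟨a', .inr (hx.2.1 a' rfl), .inr ⟨rfl, ha a' rfl⟩⟩
  have hup : ∃ y, (x = y ∨ Beneath Set.univ x y) ∧
      ((c = none ∧ lev y = j) ∨ (c = some y ∧ lev y = j + 1)) := by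
    rcases c with _ | c'
    · obtain ⟨y, h1, -, h2⟩ := hF.exists_top (N - lev x) x (by have := lev_le x; omega) trivial
      exact ⟨y, h2, .inl ⟨rfl, h1.trans (hc0 rfl).symm⟩⟩
    · exact ⟨c', .inr (hx.2.2 c' rfl), .inr ⟨rfl, hc c' rfl⟩⟩
  obtain ⟨y, hyx, hy⟩ := hlo
  obtain ⟨z, hxz, hz⟩ := hup
  obtain ⟨f, f1, f2, f3, f4⟩ := Beneath.exists_path hyx
  obtain ⟨g, g1, g2, g3, g4⟩ := Beneath.exists_path hxz
  have hyi : lev y ≤ i := by rcases hy with h | h <;> omega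
  have hzj : j ≤ lev z := by rcases hz with h | h <;> omega
  refine ⟨fun m => if m ≤ lev x then f m else g m, ⟨fun m h1 h2 => ?_, fun m h1 h2 => ?_,
    fun w hw => ?_, fun w hw => ?_⟩, by simp [f2]⟩
  · by_cases hm : m ≤ lev x
    · simp only [hm, if_true]; exact f3 m (by omega) hm
    · simp only [hm, if_false]; exact g3 m (by omega) (by omega)
  · by_cases hm : m + 1 ≤ lev x
    · have : m ≤ lev x := by omega
      simp only [hm, this, if_true]; exact f4 m (by omega) hm
    · simp only [hm, if_false]
      by_cases hm' : m ≤ lev x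
      · have : m = lev x := by omega
        subst this
        simp only [le_refl, if_true, f2]
        have := g4 (lev x) le_rfl (by omega)
        rwa [g1] at this
      · simp only [hm', if_false]; exact g4 m (by omega) (by omega)
  · rcases hy with ⟨h1, h2⟩ | ⟨h1, h2⟩
    · rw [h1] at hw; cases hw
    · rw [h1] at hw; cases hw
      simp only [hi, if_true]
      have := f4 (lev y) le_rfl (by omega)
      rwa [f1, h2] at this
  · rcases hz with ⟨h1, h2⟩ | ⟨h1, h2⟩
    · rw [h1] at hw; cases hw
    · rw [h1] at hw; cases hw
      by_cases hm : j ≤ lev x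
      · have : j = lev x := by omega
        subst this
        simp only [le_refl, if_true, f2]
        have := g4 (lev x) le_rfl (by omega)
        rwa [← h2, g1, g2] at this
      · simp only [hm, if_false]
        have := g4 j (by omega) (by omega)
        rwa [← h2, g2] at this

/-- The vertex u of A need not lie between a and c, so it is replaced twice. A walk inside A from a
to u leaves a for the last time towards a vertex over a; then a walk inside A from c, taken over a,
leaves c towards a vertex that also lies beneath c. Simple connectedness moves the connecting walk
from x between the ends. -/
theorem exists_between (hS : SCon (Set.univ : Set V)) (hA : Nice N A)
    (ha : ∀ x, a = some x → x ∈ A ∧ lev x + 1 = i)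
    (hc : ∀ x, c = some x → x ∈ A ∧ lev x = j + 1) {x u : V}
    (hx : x ∈ Between Set.univ a c) (hi : i ≤ lev x) (hj : lev x ≤ j) (hu : u ∈ A)
    (hxu : Conn (Lv N i j) x u) :
    ∃ z ∈ A, Conn (Between Set.univ a c ∩ Lv N i j) x z := by
  have step : ∃ z ∈ A, z ∈ Between Set.univ a none ∧ Conn (Lv N i j) x z := by
    rcases a with _ | a'
    · exact ⟨u, hu, ⟨trivial, fun _ h => (by cases h), fun _ h => (by cases h)⟩, hxu⟩
    obtain ⟨ha1, ha2⟩ := ha a' rfl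
    have hax := hx.2.1 a' rfl
    have hmono : (Lv N i j : Set V) ⊆ Lv N (lev a') j := Lv_mono (by omega) le_rfl
    obtain ⟨k, hk⟩ := hA.conn (lev a') j a' u ha1 hu
      ((hax.conn_univ le_rfl hj).trans (hxu.mono hmono))
    have hul := hxu.right_mem.1
    -- Level i - 1 is admitted so that the walk can start at a, which has the lowest admitted level;
    -- hence its neighbour z lies over a. After the walk has been moved over a, all its levels are
    -- at least i again.
    obtain ⟨z, l, -, haz, hw⟩ := hk.last_visit (fun h => by rw [← h] at hul; omega)
    have hz := hw.left_mem
    have hzl : lev a' + 1 = lev z := by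
      have := hz.1.2.1
      rcases haz.lev with h | h <;> omega
    have haz' := Beneath.of_lk_univ haz hzl
    have hzB : z ∈ Between Set.univ (some a') none :=
      ⟨trivial, fun _ h => by cases h; exact haz', fun _ h => (by cases h)⟩
    refine ⟨z, hz.1.1, hzB, ?_⟩
    have hcon : Conn (Lv N (lev a') j ∩ {w | w ≠ a'}) x z :=
      (hxu.mono (T := Lv N (lev a') j ∩ {w | w ≠ a'}) fun w hw' =>
        ⟨hmono hw', fun h => by have := hw'.1; rw [h] at this; omega⟩).trans
        ⟨l, hw.symm.mono fun w hw' => ⟨hw'.1.2, hw'.2⟩⟩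
    obtain ⟨k', hk'⟩ := hcon
    obtain ⟨k'', -, hk''⟩ := hS (some a') none (lev a') j k' x z (fun _ h => by cases h; exact le_rfl)
      (fun _ h => (by cases h)) ⟨trivial, fun _ h => by cases h; exact hax, fun _ h => (by cases h)⟩
      hzB (hk'.mono fun w hw' => ⟨trivial, hw'.1, fun h => hw'.2 (by cases h; rfl), by simp⟩)
    refine ⟨k'', hk''.mono fun w hw' => ⟨?_, hw'.2.2⟩⟩
    have := (hw'.1.2.1 a' rfl).lev_lt
    omega
  obtain ⟨z, hzA, hzB, hxz⟩ := step
  have hzl := hxz.right_mem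
  have haw : ∀ w : V, i ≤ lev w → a ≠ some w := fun w hw h => by have := (ha w h).2; omega
  -- The bound q is j + 1 if c is real, since the walk arriving from near c may use that level, and
  -- j if c is imaginary. In both cases the resulting walk between a and c stays at levels up to j.
  have hfin : ∀ z' ∈ A, z' ∈ Between Set.univ a c → ∀ q, (∀ c', c = some c' → q ≤ lev c') →
      (c = none → q = j) → Conn (Lv N i q ∩ {w | c ≠ some w}) x z' →
      Conn (Between Set.univ a c ∩ Lv N i j) x z' := by
    rintro z' hz' hz'B q hq hq' ⟨k, hk⟩
    obtain ⟨k', -, hk'⟩ := hS a c i q k x z' (fun a' h => by have := (ha a' h).2; omega) hq hx hz'B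
      (hk.mono fun w hw => ⟨trivial, hw.1, haw w hw.1.1, hw.2⟩)
    refine ⟨k', hk'.mono fun w hw => ⟨hw.1, hw.2.1, ?_⟩⟩
    rcases c with _ | c'
    · rw [← hq' rfl]; exact hw.2.2
    · have h1 := (hw.1.2.2 c' rfl).lev_lt
      have h2 := (hc c' rfl).2
      omega
  rcases c with _ | c'
  · exact ⟨z, hzA, hfin z hzA hzB j (fun _ h => (by cases h)) (fun _ => rfl)
      (hxz.mono fun w hw => ⟨hw, by simp⟩)⟩
  obtain ⟨hc1, hc2⟩ := hc c' rfl
  have hxc := hx.2.2 c' rfl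
  have hmono : (Lv N i j : Set V) ⊆ Lv N i (j + 1) := Lv_mono le_rfl (by omega)
  obtain ⟨k, hk⟩ := hA.conn i (j + 1) c' z hc1 hzA
    ((hxc.conn_univ hi (by omega)).symm.trans (hxz.mono hmono))
  have hBA : ∀ y ∈ A, (∀ a', a = some a' → Beneath Set.univ a' y) → y ∈ Between A a none :=
    fun y hy h => ⟨hy, fun a' h' => hA.beneath a' (ha a' h').1 y hy (h a' h'),
      fun _ h => (by cases h)⟩
  -- Here the simple connectedness of A itself is used: the walk has to stay in A and over a at the
  -- same time.
  obtain ⟨k', -, hk'⟩ := hA.scon a none i (j + 1) k c' z (fun a' h => by have := (ha a' h).2; omega)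
    (fun _ h => (by cases h)) (hBA c' hc1 fun a' h => (hx.2.1 a' h).trans hxc)
    (hBA z hzA hzB.2.1) (hk.mono fun w hw => ⟨hw.1, hw.2, haw w hw.2.1, by simp⟩)
  obtain ⟨z', l, -, hcz, hw⟩ := hk'.last_visit (fun h => by have := hzl.2; rw [← h] at this; omega)
  have hz' := hw.left_mem
  have hzl' : lev z' + 1 = lev c' := by
    have := hz'.1.2.2
    rcases hcz.lev with h | h <;> omega
  refine ⟨z', hz'.1.1.1, hfin z' hz'.1.1.1 ⟨trivial, fun a' h =>
    (hz'.1.1.2.1 a' h).mono (Set.subset_univ _), fun _ h => ?_⟩ (j + 1) (fun _ h => ?_)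
    (fun h => (by cases h)) ?_⟩
  · cases h; exact .of_lk_univ hcz.symm hzl'
  · cases h; omega
  · refine (hxz.mono (T := Lv N i (j + 1) ∩ {w | some c' ≠ some w}) fun w hw =>
      ⟨hmono hw, fun h => ?_⟩).trans ⟨l, hw.symm.mono fun w hw => ⟨hw.1.2,
      fun h => hw.2 (by cases h; rfl)⟩⟩
    cases h
    have := hw.2
    omega

/-- Induction on the bound n for j - i. If x is not connected to A within the levels from i to j, a
path from a to c through x is added. Otherwise x is joined to A by a walk between a and c, whose
vertices are added one after the other, starting at A. -/
theorem Nice.cover_aux (hS : SCon (Set.univ : Set V)) (hF : Full N (Set.univ : Set V)) (n : ℕ) :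
    ∀ (A : Set V) (i j : ℕ) (a c : Option V) (x : V), Nice N A → j ≤ i + n → j ≤ N →
    (a = none → i = 0) → (∀ x, a = some x → x ∈ A ∧ lev x + 1 = i) → (c = none → j = N) →
    (∀ x, c = some x → x ∈ A ∧ lev x = j + 1) → x ∈ Between Set.univ a c → i ≤ lev x →
    lev x ≤ j → ∃ B, Nice N B ∧ Strong N allI A B ∧ x ∈ B := by
  induction n using Nat.strong_induction_on with
  | _ n ih =>
  intro A i j a c x hA hn hjN ha0 ha hc0 hc hx hi hj
  by_cases hu : ∃ u ∈ A, Conn (Lv N i j) x u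
  · obtain ⟨u, huA, hu⟩ := hu
    obtain ⟨z, hzA, k, hk⟩ := exists_between hS hA ha hc hx hi hj huA hu
    clear hu huA u
    -- Inner induction on the length of the walk from x to A, with A growing.
    induction k generalizing A z with
    | zero => exact ⟨A, hA, .refl, hk.eq_of_zero ▸ hzA⟩
    | succ k ihk =>
      obtain ⟨y, hzS, hzy, hw⟩ := hk.symm.exists_head
      have hy := hw.left_mem
      -- The vertex y is linked to z in A, so z can replace a or c as an end point, and the interval
      -- of levels for y becomes shorter.
      have hB : ∃ B, Nice N B ∧ Strong N allI A B ∧ y ∈ B := by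
        rcases hzy.lev with hl | hl
        · refine ih (n - 1) (by have := hy.2.2; have := hzS.2.1; omega) A (lev y) j (some z) c y hA
            (by have := hzS.2.1; omega) hjN
            (fun h => (by cases h)) (fun w h => by cases h; exact ⟨hzA, hl⟩) hc0 hc
            ⟨trivial, fun w h => ?_, hy.1.2.2⟩ le_rfl hy.2.2
          cases h
          exact .of_lk_univ hzy hl
        · refine ih (n - 1) (by have := hzS.2.2; have := hy.2.1; omega) A i (lev y) a (some z) y hA
            (by have := hzS.2.2; omega)
            (lev_le y) ha0 ha (fun h => (by cases h)) (fun w h => by cases h; exact ⟨hzA, hl.symm⟩)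
            ⟨trivial, hy.1.2.1, fun w h => ?_⟩ hy.2.1 le_rfl
          cases h
          exact .of_lk_univ hzy.symm hl
      obtain ⟨B, hB, hAB, hyB⟩ := hB
      obtain ⟨B', hB', hBB', hxB'⟩ := ihk B hB (fun w h => ⟨hAB.subset (ha w h).1, (ha w h).2⟩)
        (fun w h => ⟨hAB.subset (hc w h).1, (hc w h).2⟩) y hyB hw.symm
      exact ⟨B', hB', hAB.trans hBB', hxB'⟩
  · push Not at hu
    obtain ⟨b, hb, hbx⟩ := exists_path_through hF hx hi hj ha0 (fun w h => (ha w h).2) hc0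
      (fun w h => (hc w h).2)
    have he : Ends N i j a c A := ⟨hi.trans hj, hjN, ha0, ha, hc0, hc, fun y z hy hz =>
      hA.beneath y (ha y hy).1 z (hc z hz).1 ((hx.2.1 y hy).trans (hx.2.2 z hz))⟩
    -- All vertices of the path are connected to x along the path, so none of them is connected to
    -- A.
    obtain ⟨hα, hB⟩ := hA.extend hS he hb (by
      intro m hm hm' u huA hcu
      refine hu u huA (Conn.trans ?_ hcu)
      rw [← hbx]
      rcases lt_trichotomy m (lev x) with h | h | h
      · exact ((hb.beneath_b hm h hj).conn_univ (by rw [hb.lev_b m hm hm']; exact hm)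
          (by rw [hbx]; exact hj)).symm
      · rw [← h]
        exact .refl hcu.left_mem
      · exact (hb.beneath_b hi h hm').conn_univ (by rw [hbx]; exact hi)
          (by rw [hb.lev_b m hm hm']; exact hm'))
    exact ⟨_, hB, .single trivial hα, .inr ⟨lev x, ⟨hi, hj⟩, hbx⟩⟩

/-- In a simply connected space, every vertex belongs to a nice strong extension of a given nice
subset. -/
theorem Nice.cover (hS : SCon (Set.univ : Set V)) (hF : Full N (Set.univ : Set V)) (hA : Nice N A)
    (x : V) : ∃ B, Nice N B ∧ Strong N allI A B ∧ x ∈ B :=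
  Nice.cover_aux hS hF N A 0 N none none x hA (by omega) le_rfl (fun _ => rfl)
    (fun _ h => (by cases h)) (fun _ => rfl) (fun _ h => (by cases h))
    ⟨trivial, fun _ h => (by cases h), fun _ h => (by cases h)⟩ (Nat.zero_le _) (lev_le x)

end Ambient

/-! ### Partial isomorphisms -/

section PartialIso

variable {N : ℕ} {V : Type u} {W : Type v} [ColoredSpace N V] [ColoredSpace N W]

/-- The map `h` is an isomorphism of the subspace `C` with its image. -/
structure PIso (N : ℕ) {V : Type u} {W : Type v} [ColoredSpace N V] [ColoredSpace N W]
    (C : Set V) (h : V → W) : Prop where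
  inj : Set.InjOn h C
  lev_eq : ∀ x ∈ C, lev (h x) = lev x
  lk_iff : ∀ x ∈ C, ∀ y ∈ C, Lk (h x) (h y) ↔ Lk x y

variable {i j : ℕ} {a c : Option V} {b : ℕ → V} {C D : Set V} {h : V → W}

theorem PIso.mono (hh : PIso N D h) (hCD : C ⊆ D) : PIso N C h :=
  ⟨hh.inj.mono hCD, fun x hx => hh.lev_eq x (hCD hx),
    fun x hx y hy => hh.lk_iff x (hCD hx) y (hCD hy)⟩

theorem PIso.exists_inv [Nonempty V] (hh : PIso N C h) :
    ∃ g : W → V, PIso N (h '' C) g ∧ (∀ x ∈ C, g (h x) = x) ∧ g '' (h '' C) = C := by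
  have hg : ∀ x ∈ C, Function.invFunOn h C (h x) = x := fun x hx => hh.inj.leftInvOn_invFunOn hx
  refine ⟨Function.invFunOn h C, ⟨?_, ?_, ?_⟩, hg, ?_⟩
  · rintro _ ⟨x, hx, rfl⟩ _ ⟨y, hy, rfl⟩ hxy
    rw [hg x hx, hg y hy] at hxy
    rw [hxy]
  · rintro _ ⟨x, hx, rfl⟩
    rw [hg x hx, hh.lev_eq x hx]
  · rintro _ ⟨x, hx, rfl⟩ _ ⟨y, hy, rfl⟩
    rw [hg x hx, hg y hy, hh.lk_iff x hx y hy]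
  · rw [Set.image_image]
    exact (Set.image_congr hg).trans (Set.image_id' C)

theorem PIso.beneath (hh : PIso N C h) {x y : V} (hxy : Beneath C x y) :
    Beneath (h '' C) (h x) (h y) := by
  have step : ∀ x y, UpStep C x y → UpStep (h '' C) (h x) (h y) := fun x y hs =>
    ⟨⟨x, hs.1, rfl⟩, ⟨y, hs.2.1, rfl⟩, (hh.lk_iff x hs.1 y hs.2.1).2 hs.2.2.1, by
      change lev (h x) + 1 = lev (h y)
      rw [hh.lev_eq x hs.1, hh.lev_eq y hs.2.1]
      exact hs.2.2.2⟩
  induction hxy with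
  | single hs => exact .single (step _ _ hs)
  | tail _ hs ih => exact .tail ih (step _ _ hs)

theorem Ends.map (he : Ends N i j a c C) (hh : PIso N C h) :
    Ends N i j (a.map h) (c.map h) (h '' C) where
  le := he.le
  le_top := he.le_top
  lo_none h' := he.lo_none (Option.map_eq_none_iff.1 h')
  lo_some x hx := by
    obtain ⟨x, hx', rfl⟩ := Option.map_eq_some_iff.1 hx
    have := he.lo_some x hx'
    exact ⟨⟨x, this.1, rfl⟩, by rw [hh.lev_eq x this.1]; exact this.2⟩
  up_none h' := he.up_none (Option.map_eq_none_iff.1 h')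
  up_some x hx := by
    obtain ⟨x, hx', rfl⟩ := Option.map_eq_some_iff.1 hx
    have := he.up_some x hx'
    exact ⟨⟨x, this.1, rfl⟩, by rw [hh.lev_eq x this.1]; exact this.2⟩
  ends x y hx hy := by
    obtain ⟨x, hx', rfl⟩ := Option.map_eq_some_iff.1 hx
    obtain ⟨y, hy', rfl⟩ := Option.map_eq_some_iff.1 hy
    exact hh.beneath (he.ends x y hx' hy')

theorem map_eq_some_of_injOn {o : Option V} (hinj : Set.InjOn h C) (ho : ∀ x, o = some x → x ∈ C)
    {x : V} (hx : x ∈ C) : o.map h = some (h x) ↔ o = some x := by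
  constructor
  · intro h'
    obtain ⟨y, hy, hyx⟩ := Option.map_eq_some_iff.1 h'
    rw [hy, hinj (ho y hy) hx hyx]
  · rintro rfl; rfl

theorem Alpha.map (hα : Alpha N i j a c b C D) (hh : PIso N D h) :
    Alpha N i j (a.map h) (c.map h) (h ∘ b) (h '' C) (h '' D) := by
  have he := hα.toEnds.map (hh.mono hα.subset)
  refine ⟨he.le, he.le_top, he.lo_none, he.lo_some, he.up_none, he.up_some, he.ends,
    fun m hi hj => ?_, fun m hi hj => ?_, fun x => ?_, ?_⟩
  · exact (hh.lev_eq _ (hα.mem_b hi hj)).trans (hα.lev_b m hi hj)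
  · rintro ⟨x, hx, hxm⟩
    rw [hh.inj (hα.subset hx) (hα.mem_b hi hj) hxm] at hx
    exact hα.not_mem m hi hj hx
  · constructor
    · rintro ⟨x, hx, rfl⟩
      rcases (hα.mem_iff x).1 hx with hx | ⟨m, hi, hj, rfl⟩
      · exact .inl ⟨x, hx, rfl⟩
      · exact .inr ⟨m, hi, hj, rfl⟩
    · rintro (⟨x, hx, rfl⟩ | ⟨m, hi, hj, rfl⟩)
      · exact ⟨x, hα.subset hx, rfl⟩
      · exact ⟨b m, hα.mem_b hi hj, rfl⟩
  · rintro m hi hj _ ⟨x, hx, rfl⟩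
    rw [map_eq_some_of_injOn hh.inj (fun x hx => hα.subset (hα.lo_some x hx).1) hx,
      map_eq_some_of_injOn hh.inj (fun x hx => hα.subset (hα.up_some x hx).1) hx]
    refine (hh.lk_iff _ (hα.mem_b hi hj) x hx).trans ((hα.lk_iff m hi hj x hx).trans
      (or_congr (exists_congr fun m' => ?_) Iff.rfl))
    refine and_congr_right fun hi' => and_congr_right fun hj' => and_congr_left fun _ => ?_
    exact ⟨fun h' => by rw [h']; rfl, fun h' => hh.inj hx (hα.mem_b hi' hj') h'⟩

theorem Alpha.lk_new (hα : Alpha N i j a c b C D) {m m' : ℕ} (hi : i ≤ m) (hj : m ≤ j)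
    (hi' : i ≤ m') (hj' : m' ≤ j) : Lk (b m) (b m') ↔ (m + 1 = m' ∨ m' + 1 = m) := by
  constructor
  · intro h
    have := h.lev
    rwa [hα.lev_b m hi hj, hα.lev_b m' hi' hj'] at this
  · exact fun h => (hα.lk_iff m hi hj _ (hα.mem_b hi' hj')).2 (.inl ⟨m', hi', hj', rfl, h⟩)

/-- A partial isomorphism extends along corresponding operations. -/
theorem Alpha.extend (hα : Alpha N i j a c b C D) (hh : PIso N C h) {b' : ℕ → W} {D' : Set W}
    (hα' : Alpha N i j (a.map h) (c.map h) b' (h '' C) D') :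
    ∃ h' : V → W, PIso N D h' ∧ Set.EqOn h' h C ∧ h' '' D = D' ∧
      ∀ m, i ≤ m → m ≤ j → h' (b m) = b' m := by
  classical
  -- The level of a new vertex is its index on the path, which determines its counterpart.
  let h' : V → W := fun x => if x ∈ C then h x else b' (lev x)
  have hC : Set.EqOn h' h C := fun x hx => if_pos hx
  have hb : ∀ m, i ≤ m → m ≤ j → h' (b m) = b' m := fun m hi hj => by
    simp only [h', if_neg (hα.not_mem m hi hj), hα.lev_b m hi hj]
  have hlk : ∀ m, i ≤ m → m ≤ j → ∀ x ∈ C, (Lk (b' m) (h x) ↔ Lk (b m) x) := by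
    intro m hi hj x hx
    rw [hα.lk_old hi hj hx, hα'.lk_old hi hj ⟨x, hx, rfl⟩,
      map_eq_some_of_injOn hh.inj (fun x hx => (hα.lo_some x hx).1) hx,
      map_eq_some_of_injOn hh.inj (fun x hx => (hα.up_some x hx).1) hx]
  refine ⟨h', ⟨?_, ?_, ?_⟩, hC, ?_, hb⟩
  · intro x hx y hy hxy
    rcases (hα.mem_iff x).1 hx with hx | ⟨m, hi, hj, rfl⟩ <;>
      rcases (hα.mem_iff y).1 hy with hy | ⟨m', hi', hj', rfl⟩
    · rw [hC hx, hC hy] at hxy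
      exact hh.inj hx hy hxy
    · rw [hC hx, hb m' hi' hj'] at hxy
      exact absurd ⟨x, hx, hxy⟩ (hα'.not_mem m' hi' hj')
    · rw [hC hy, hb m hi hj] at hxy
      exact absurd ⟨y, hy, hxy.symm⟩ (hα'.not_mem m hi hj)
    · rw [hb m hi hj, hb m' hi' hj'] at hxy
      have h1 := hα'.lev_b m hi hj
      rw [hxy, hα'.lev_b m' hi' hj'] at h1
      rw [h1]
  · intro x hx
    rcases (hα.mem_iff x).1 hx with hx | ⟨m, hi, hj, rfl⟩
    · rw [hC hx, hh.lev_eq x hx]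
    · rw [hb m hi hj, hα.lev_b m hi hj, hα'.lev_b m hi hj]
  · intro x hx y hy
    rcases (hα.mem_iff x).1 hx with hx | ⟨m, hi, hj, rfl⟩ <;>
      rcases (hα.mem_iff y).1 hy with hy | ⟨m', hi', hj', rfl⟩
    · rw [hC hx, hC hy, hh.lk_iff x hx y hy]
    · rw [hC hx, hb m' hi' hj']
      exact ⟨fun h => ((hlk m' hi' hj' x hx).1 h.symm).symm,
        fun h => ((hlk m' hi' hj' x hx).2 h.symm).symm⟩
    · rw [hC hy, hb m hi hj, hlk m hi hj y hy]
    · rw [hb m hi hj, hb m' hi' hj', hα.lk_new hi hj hi' hj', hα'.lk_new hi hj hi' hj']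
  · ext w
    rw [hα'.mem_iff]
    constructor
    · rintro ⟨x, hx, rfl⟩
      rcases (hα.mem_iff x).1 hx with hx | ⟨m, hi, hj, rfl⟩
      · exact .inl ⟨x, hx, (hC hx).symm⟩
      · exact .inr ⟨m, hi, hj, hb m hi hj⟩
    · rintro (⟨x, hx, rfl⟩ | ⟨m, hi, hj, rfl⟩)
      · exact ⟨x, hα.subset hx, hC hx⟩
      · exact ⟨b m, hα.mem_b hi hj, hb m hi hj⟩

theorem Strong.map {P : ℕ → ℕ → Prop} (hs : Strong N P C D) (hh : PIso N D h) :
    Strong N P (h '' C) (h '' D) := by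
  induction hs with
  | refl => exact .refl
  | tail h1 hα ih =>
    obtain ⟨i, j, hP, a, c, b, hα⟩ := hα
    exact (ih (hh.mono hα.subset)).trans (.single hP (hα.map hh))

/-- The family `F` of subspaces of `W` is closed under the operations for intervals with `P`. -/
def Closed (N : ℕ) {W : Type v} [ColoredSpace N W] (P : ℕ → ℕ → Prop) (F : Set W → Prop) : Prop :=
  ∀ X, F X → ∀ i j a c, P i j → Ends N i j a c X → ∃ b D, Alpha N i j a c b X D ∧ F D

/-- The operations leading from C to D are imitated in W one by one. The family F is that of nice
subspaces in the back-and-forth, and that of strong subspaces of stages of a chain in the proof of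
the Fraïssé property. -/
theorem Strong.extend {P : ℕ → ℕ → Prop} {F : Set W → Prop} (hF : Closed N P F)
    (hs : Strong N P C D) (hh : PIso N C h) (hC : F (h '' C)) :
    ∃ h' : V → W, PIso N D h' ∧ Set.EqOn h' h C ∧ F (h' '' D) := by
  induction hs with
  | refl => exact ⟨h, hh, fun _ _ => rfl, hC⟩
  | tail h1 hα ih =>
    obtain ⟨i, j, hP, a, c, b, hα⟩ := hα
    obtain ⟨h₁, hh₁, heq, hF₁⟩ := ih
    obtain ⟨b', D', hα', hD'⟩ := hF _ hF₁ i j _ _ hP (hα.toEnds.map hh₁)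
    obtain ⟨h₂, hh₂, heq₂, himg, -⟩ := hα.extend hh₁ hα'
    exact ⟨h₂, hh₂, fun x hx => (heq₂ (Strong.subset h1 hx)).trans (heq hx), himg ▸ hD'⟩

end PartialIso

/-! ### Back and forth -/

section BackAndForth

variable {N : ℕ} {V : Type u} {W : Type v} [ColoredSpace N V] [ColoredSpace N W]

/-- Between suitable end points there are paths that are not connected to a given finite set, for
the intervals with `P`. -/
def Rich (N : ℕ) (P : ℕ → ℕ → Prop) (V : Type u) [ColoredSpace N V] : Prop :=
  ∀ i j a c (A : Set V), P i j → A.Finite → Ends N i j a c (Set.univ : Set V) →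
    ∃ b, PathAC N i j a c b ∧ ∀ m, i ≤ m → m ≤ j → ∀ u ∈ A, ¬ Conn (Lv N i j) (b m) u

/-- Nice sets are finite, so richness gives a path not connected to them, and `Nice.extend`
recognises it as an operation with nice result. -/
theorem Rich.closed {P : ℕ → ℕ → Prop} (hV : Rich N P V) (hS : SCon (Set.univ : Set V)) :
    Closed N P (Nice N (V := V)) := by
  intro X hX i j a c hP he
  obtain ⟨b, hb, hd⟩ := hV i j a c X hP hX.finite (he.mono (Set.subset_univ _))
  obtain ⟨h1, h2⟩ := hX.extend hS he hb hd
  exact ⟨b, _, h1, h2⟩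

/-- The saturated spaces. -/
structure Sat (N : ℕ) (V : Type u) [ColoredSpace N V] : Prop where
  scon : SCon (Set.univ : Set V)
  full : Full N (Set.univ : Set V)
  rich : Rich N allI V

/-- The tuples `v` and `w` correspond to each other under an isomorphism of nice subspaces. -/
def NiceIso (N : ℕ) {V : Type u} {W : Type v} [ColoredSpace N V] [ColoredSpace N W] {α : Type}
    (v : α → V) (w : α → W) : Prop :=
  ∃ C h, PIso N C h ∧ Nice N C ∧ Nice N (h '' C) ∧ ∀ a, v a ∈ C ∧ w a = h (v a)

variable {α : Type}

theorem NiceIso.symm [Nonempty V] {v : α → V} {w : α → W} (h : NiceIso N v w) : NiceIso N w v := by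
  obtain ⟨C, h, hh, hC, hC', hvw⟩ := h
  obtain ⟨g, hg, hgh, hgi⟩ := hh.exists_inv
  refine ⟨h '' C, g, hg, hC', by rwa [hgi], fun a => ?_⟩
  rw [(hvw a).2, hgh _ (hvw a).1]
  exact ⟨⟨_, (hvw a).1, rfl⟩, rfl⟩

/-- The "forth" step: x is covered by a nice strong extension of C, and the operations producing
this extension are imitated in W. -/
theorem NiceIso.exists_snoc (hV : Sat N V) (hW : Sat N W) {n : ℕ} {v : α → V} {w : α → W}
    {xs : Fin n → V} {ys : Fin n → W} (h : NiceIso N (Sum.elim v xs) (Sum.elim w ys)) (x : V) :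
    ∃ y : W, NiceIso N (Sum.elim v (Fin.snoc xs x : Fin (n + 1) → V))
      (Sum.elim w (Fin.snoc ys y : Fin (n + 1) → W)) := by
  obtain ⟨C, h, hh, hC, hC', hvw⟩ := h
  obtain ⟨D, hD, hCD, hx⟩ := hC.cover hV.scon hV.full x
  obtain ⟨h', hh', heq, hD'⟩ := hCD.extend (hW.rich.closed hW.scon) hh hC'
  refine ⟨h' x, D, h', hh', hD, hD', ?_⟩
  rintro (a | k)
  · have := hvw (.inl a)
    exact ⟨hCD.subset this.1, this.2.trans (heq this.1).symm⟩
  · refine Fin.lastCases ?_ (fun k => ?_) k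
    · simpa using hx
    · have := hvw (.inr k)
      simp only [Sum.elim_inr, Fin.snoc_castSucc] at this ⊢
      exact ⟨hCD.subset this.1, this.2.trans (heq this.1).symm⟩

theorem psTerm_eq {β : Type*} (t : (psLang N).Term β) : ∃ x, t = Term.var x := by
  cases t with
  | var x => exact ⟨x, rfl⟩
  | func f _ => exact Empty.elim f

/-- Tuples that correspond under an isomorphism of nice subspaces of saturated spaces satisfy the
same formulas. -/
theorem NiceIso.realize_iff [Nonempty V] [Nonempty W] (hV : Sat N V) (hW : Sat N W) {n : ℕ}
    (φ : (psLang N).BoundedFormula α n) : ∀ {v : α → V} {w : α → W} {xs : Fin n → V}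
    {ys : Fin n → W}, NiceIso N (Sum.elim v xs) (Sum.elim w ys) →
    (φ.Realize v xs ↔ φ.Realize w ys) := by
  induction φ with
  | falsum => intros; exact Iff.rfl
  | equal t₁ t₂ =>
    intro v w xs ys h
    obtain ⟨x, rfl⟩ := psTerm_eq t₁
    obtain ⟨y, rfl⟩ := psTerm_eq t₂
    obtain ⟨C, h, hh, -, -, hvw⟩ := h
    change Sum.elim v xs x = Sum.elim v xs y ↔ Sum.elim w ys x = Sum.elim w ys y
    rw [(hvw x).2, (hvw y).2]
    exact (hh.inj.eq_iff (hvw x).1 (hvw y).1).symm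
  | rel R ts =>
    intro v w xs ys h
    obtain ⟨C, h, hh, -, -, hvw⟩ := h
    have hts : ∀ k, ∃ x, ts k = Term.var x := fun k => psTerm_eq (ts k)
    choose f hf using hts
    obtain rfl : ts = fun k => Term.var (f k) := funext hf
    cases R with
    | level i =>
      change level (Sum.elim v xs (f 0)) = i ↔ level (Sum.elim w ys (f 0)) = i
      have := hh.lev_eq _ (hvw (f 0)).1
      rw [← (hvw (f 0)).2] at this
      rw [Fin.ext_iff, Fin.ext_iff]
      change lev _ = _ ↔ lev _ = _
      rw [this]
    | edge =>
      change Lk (Sum.elim v xs (f 0)) (Sum.elim v xs (f 1)) ↔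
        Lk (Sum.elim w ys (f 0)) (Sum.elim w ys (f 1))
      rw [(hvw (f 0)).2, (hvw (f 1)).2]
      exact (hh.lk_iff _ (hvw (f 0)).1 _ (hvw (f 1)).1).symm
  | imp _ _ ih₁ ih₂ =>
    intro v w xs ys h
    rw [BoundedFormula.realize_imp, BoundedFormula.realize_imp, ih₁ h, ih₂ h]
  | all _ ih =>
    intro v w xs ys h
    rw [BoundedFormula.realize_all, BoundedFormula.realize_all]
    constructor
    · intro h' y
      obtain ⟨x, hx⟩ := h.symm.exists_snoc hW hV y
      exact (ih hx.symm).1 (h' x)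
    · intro h' x
      obtain ⟨y, hy⟩ := h.exists_snoc hV hW x
      exact (ih hy).2 (h' y)

theorem NiceIso.formula_iff [Nonempty V] [Nonempty W] (hV : Sat N V) (hW : Sat N W)
    (φ : (psLang N).Formula α) {v : α → V} {w : α → W} (h : NiceIso N v w) :
    φ.Realize v ↔ φ.Realize w := by
  refine NiceIso.realize_iff hV hW φ ?_
  obtain ⟨C, h, hh, hC, hC', hvw⟩ := h
  refine ⟨C, h, hh, hC, hC', ?_⟩
  rintro (a | k)
  · exact hvw a
  · exact k.elim0

end BackAndForth

/-! ### The meaning of the formulas -/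

section Formulas

theorem realize_levF_relMap {N : ℕ} {M : Type u} [(psLang N).Structure M] {α : Type} {w : α → M}
    {i : Fin (N + 1)} {x : α} : (levF i x).Realize w ↔
    Structure.RelMap (L := psLang N) (PSRel.level i : PSRel N 1) ![w x] :=
  Formula.realize_rel₁ (L := psLang N)

theorem realize_edgeF_relMap {N : ℕ} {M : Type u} [(psLang N).Structure M] {α : Type} {w : α → M}
    {x y : α} : (edgeF N x y).Realize w ↔
    Structure.RelMap (L := psLang N) (PSRel.edge : PSRel N 2) ![w x, w y] :=
  Formula.realize_rel₂ (L := psLang N)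

variable {N : ℕ} {V : Type u} [ColoredSpace N V] {α : Type} {w : α → V}

/-- The lower end point denoted by a variable. -/
def loEnd (w : α → V) : WithBot α → Option V
  | ⊥ => none
  | (a : α) => some (w a)

/-- The upper end point denoted by a variable. -/
def upEnd (w : α → V) : WithTop α → Option V
  | ⊤ => none
  | (a : α) => some (w a)

theorem loEnd_bot : loEnd w ⊥ = none := rfl

theorem upEnd_top : upEnd w ⊤ = none := rfl

theorem loEnd_map {β : Type} (g : β → α) (a : WithBot β) :
    loEnd w (a.map g) = loEnd (w ∘ g) a := by
  induction a using WithBot.recBotCoe <;> rfl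

theorem upEnd_map {β : Type} (g : β → α) (a : WithTop β) :
    upEnd w (a.map g) = upEnd (w ∘ g) a := by
  induction a using WithTop.recTopCoe <;> rfl

theorem realize_levF {i : Fin (N + 1)} {x : α} : (levF i x).Realize w ↔ level (w x) = i := by
  exact realize_levF_relMap

theorem realize_edgeF {x y : α} : (edgeF N x y).Realize w ↔ Lk (w x) (w y) := by
  exact realize_edgeF_relMap

theorem realize_eqF {x y : α} : (eqF N x y).Realize w ↔ w x = w y := by
  rw [eqF, Formula.realize_equal]
  rfl

theorem realize_inF {i j : Fin (N + 1)} {x : α} :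
    (inF i j x).Realize w ↔ w x ∈ (Lv N i j : Set V) := by
  rw [inF, Formula.realize_iSup]
  simp only [realize_levF]
  constructor
  · rintro ⟨⟨m, hm⟩, h⟩
    have h : level (w x) = m := h
    rw [← h] at hm
    exact hm
  · exact fun h => ⟨⟨level (w x), h⟩, rfl⟩

theorem realize_upF {x y : α} :
    (upF N x y).Realize w ↔ Lk (w x) (w y) ∧ lev (w x) + 1 = lev (w y) := by
  rw [upF, Formula.realize_inf, realize_edgeF, Formula.realize_iSup]
  refine and_congr_right fun _ => ?_
  simp only [Formula.realize_inf, realize_levF]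
  constructor
  · rintro ⟨m, h1, h2⟩
    simp [lev, h1, h2]
  · intro h
    have h1 := lev_le (w y)
    refine ⟨⟨lev (w x), by omega⟩, Fin.ext rfl, Fin.ext ?_⟩
    simpa [lev] using h.symm

theorem realize_beneathF {x y : α} :
    (beneathF N x y).Realize w ↔ Beneath Set.univ (w x) (w y) := by
  rw [beneathF, Formula.realize_iSup]
  simp only [Formula.realize_iExs, Formula.realize_inf, realize_eqF, Formula.realize_iInf,
    realize_upF, Sum.elim_inl, Sum.elim_inr]
  constructor
  · rintro ⟨d, p, ⟨h1, h2⟩, h3⟩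
    rw [← h1, ← h2]
    have key : ∀ (m : ℕ) (hm : m + 1 < (d : ℕ) + 2), Beneath Set.univ (p 0) (p ⟨m + 1, hm⟩) := by
      intro m
      induction m with
      | zero => exact fun hm => .of_lk_univ (h3 0).1 (h3 0).2
      | succ m ih =>
        intro hm
        exact (ih (by omega)).trans
          (.of_lk_univ (h3 ⟨m + 1, by omega⟩).1 (h3 ⟨m + 1, by omega⟩).2)
    exact key d (by omega)
  · intro h
    have hlt := h.lev_lt
    have hle := lev_le (w y)
    obtain ⟨f, f1, f2, f3, f4⟩ := Beneath.exists_path (.inr h)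
    -- The index d stands for d + 2 vertices, that is, for d + 1 steps; this has to be the level
    -- difference.
    refine ⟨⟨lev (w y) - lev (w x) - 1, by omega⟩, fun e => f (lev (w x) + e), ⟨?_, ?_⟩, ?_⟩
    · simpa using f1
    · change f (lev (w x) + (lev (w y) - lev (w x) - 1 + 1)) = w y
      have : lev (w x) + (lev (w y) - lev (w x) - 1 + 1) = lev (w y) := by omega
      rw [this, f2]
    · intro e
      have he : (e : ℕ) < lev (w y) - lev (w x) - 1 + 1 := e.2
      refine ⟨?_, ?_⟩
      · simpa [add_assoc] using f4 (lev (w x) + e) (by omega) (by omega)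
      · simp only [Fin.val_castSucc, Fin.val_succ]
        rw [f3 _ (by omega) (by omega), f3 _ (by omega) (by omega)]
        omega

theorem realize_betweenF {a : WithBot α} {c : WithTop α} {x : α} :
    (betweenF N a c x).Realize w ↔ w x ∈ Between Set.univ (loEnd w a) (upEnd w c) := by
  rw [betweenF, Formula.realize_inf]
  have h1 : (overLoF N x a).Realize w ↔
      ∀ a', loEnd w a = some a' → Beneath Set.univ a' (w x) := by
    induction a using WithBot.recBotCoe with
    | bot => simp [overLoF, loEnd]
    | coe a => simp [overLoF, loEnd, realize_beneathF]
  have h2 : (beneathUpF N x c).Realize w ↔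
      ∀ c', upEnd w c = some c' → Beneath Set.univ (w x) c' := by
    induction c using WithTop.recTopCoe with
    | top => simp [beneathUpF, upEnd]
    | coe a => simp [beneathUpF, upEnd, realize_beneathF]
  rw [h1, h2]
  exact ⟨fun h => ⟨trivial, h⟩, fun h => h.2⟩

theorem realize_endsBeneathF {a : WithBot α} {c : WithTop α} :
    (endsBeneathF N a c).Realize w ↔
      ∀ x y, loEnd w a = some x → upEnd w c = some y → Beneath Set.univ x y := by
  induction a using WithBot.recBotCoe with
  | bot => simp [endsBeneathF, loEnd]
  | coe a =>
    induction c using WithTop.recTopCoe with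
    | top => simp [endsBeneathF, beneathUpF, upEnd]
    | coe c => simp [endsBeneathF, beneathUpF, upEnd, loEnd, realize_beneathF]

theorem realize_neLoF {a : WithBot α} {x : α} :
    (neLoF N x a).Realize w ↔ loEnd w a ≠ some (w x) := by
  induction a using WithBot.recBotCoe with
  | bot => simp [neLoF, loEnd]
  | coe a => simp [neLoF, loEnd, realize_eqF, eq_comm]

theorem realize_neUpF {a : WithTop α} {x : α} :
    (neUpF N x a).Realize w ↔ upEnd w a ≠ some (w x) := by
  induction a using WithTop.recTopCoe with
  | top => simp [neUpF, upEnd]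
  | coe a => simp [neUpF, upEnd, realize_eqF, eq_comm]

theorem realize_loLeF {a : WithBot α} {i : Fin (N + 1)} :
    (loLeF i a).Realize w ↔ ∀ a', loEnd w a = some a' → lev a' ≤ i := by
  induction a using WithBot.recBotCoe with
  | bot => simp [loLeF, loEnd]
  | coe a => simp [loLeF, loEnd, realize_inF, Lv]

theorem realize_upGeF {a : WithTop α} {i : Fin (N + 1)} :
    (upGeF i a).Realize w ↔ ∀ a', upEnd w a = some a' → (i : ℕ) ≤ lev a' := by
  induction a using WithTop.recTopCoe with
  | top => simp [upGeF, upEnd]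
  | coe a => simp [upGeF, upEnd, realize_inF, Lv, lev_le]

theorem realize_loEqF {a : WithBot α} {i : Fin (N + 1)} :
    (loEqF i a).Realize w ↔ (loEnd w a = none → (i : ℕ) = 0) ∧
      ∀ a', loEnd w a = some a' → lev a' + 1 = i := by
  induction a using WithBot.recBotCoe with
  | bot =>
    by_cases hi : (i : ℕ) = 0 <;> simp only [loEqF, hi, loEnd, if_true, if_false] <;> simp
  | coe a =>
    simp only [loEqF, loEnd, Formula.realize_iSup, realize_levF]
    simp only [reduceCtorEq, false_implies, true_and, Option.some.injEq, forall_eq']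
    constructor
    · rintro ⟨⟨m, hm⟩, h⟩
      rw [lev, h]
      exact hm
    · exact fun h => ⟨⟨level (w a), h⟩, rfl⟩

theorem realize_upEqF {a : WithTop α} {j : Fin (N + 1)} :
    (upEqF j a).Realize w ↔ (upEnd w a = none → (j : ℕ) = N) ∧
      ∀ a', upEnd w a = some a' → lev a' = j + 1 := by
  induction a using WithTop.recTopCoe with
  | top =>
    by_cases hj : (j : ℕ) = N <;> simp only [upEqF, hj, upEnd, if_true, if_false] <;> simp
  | coe a =>
    simp only [upEqF, upEnd, Formula.realize_iSup, realize_levF]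
    simp only [reduceCtorEq, false_implies, true_and, Option.some.injEq, forall_eq']
    constructor
    · rintro ⟨⟨m, hm⟩, h⟩
      rw [lev, h]
      exact hm
    · exact fun h => ⟨⟨level (w a), h⟩, rfl⟩

theorem realize_edgeLoF {a : WithBot α} {x : α} :
    (edgeLoF N x a).Realize w ↔ ∀ a', loEnd w a = some a' → Lk a' (w x) := by
  induction a using WithBot.recBotCoe with
  | bot => simp [edgeLoF, loEnd]
  | coe a => simp [edgeLoF, loEnd, realize_edgeF]

theorem realize_edgeUpF {a : WithTop α} {x : α} :
    (edgeUpF N x a).Realize w ↔ ∀ a', upEnd w a = some a' → Lk (w x) a' := by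
  induction a using WithTop.recTopCoe with
  | top => simp [edgeUpF, upEnd]
  | coe a => simp [edgeUpF, upEnd, realize_edgeF]

theorem realize_stepsF {k : ℕ} {p : Fin (k + 1) → α} :
    (stepsF N k p).Realize w ↔ ∀ e : Fin k, Lk (w (p e.castSucc)) (w (p e.succ)) := by
  simp only [stepsF, Formula.realize_iInf, realize_edgeF]

theorem walkIn_iff {S : Set V} {k : ℕ} {x y : V} : WalkIn S k x y ↔
    ∃ p : Fin (k + 1) → V, p 0 = x ∧ p (Fin.last k) = y ∧
      (∀ e : Fin k, Lk (p e.castSucc) (p e.succ)) ∧ ∀ e, p e ∈ S := by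
  constructor
  · intro h
    induction h with
    | @refl x h => exact ⟨fun _ => x, rfl, rfl, fun e => e.elim0, fun _ => h⟩
    | @tail k x y z h1 h2 h3 ih =>
      obtain ⟨p, p1, p2, p3, p4⟩ := ih
      refine ⟨Fin.snoc p z, ?_, Fin.snoc_last _ _, fun e => ?_, fun e => ?_⟩
      · rw [← p1]
        exact Fin.snoc_castSucc (α := fun _ => V) z p 0
      · refine Fin.lastCases ?_ (fun e => ?_) e
        · rw [Fin.snoc_castSucc (α := fun _ => V), Fin.succ_last, Fin.snoc_last, p2]
          exact h2
        · rw [Fin.snoc_castSucc (α := fun _ => V), Fin.succ_castSucc,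
            Fin.snoc_castSucc (α := fun _ => V)]
          exact p3 e
      · refine Fin.lastCases ?_ (fun e => ?_) e
        · rw [Fin.snoc_last]; exact h3
        · rw [Fin.snoc_castSucc (α := fun _ => V)]; exact p4 e
  · rintro ⟨p, rfl, rfl, p3, p4⟩
    induction k with
    | zero => exact .refl (p4 0)
    | succ k ih =>
      have h1 := ih (fun e => p e.castSucc) (fun e => p3 e.castSucc) (fun e => p4 _)
      exact .tail h1 (p3 (Fin.last k)) (p4 _)

theorem realize_pathLeF {i j : Fin (N + 1)} {k : ℕ} {a : WithBot α} {c : WithTop α} {x y : α} :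
    (pathLeF i j k a c x y).Realize w ↔ ∃ k' ≤ k,
      WalkIn (Between Set.univ (loEnd w a) (upEnd w c) ∩ Lv N i j) k' (w x) (w y) := by
  rw [pathLeF, Formula.realize_iSup]
  simp only [Formula.realize_iExs, Formula.realize_inf, realize_eqF, Formula.realize_iInf,
    realize_stepsF, realize_inF, realize_betweenF, Sum.elim_inl, Sum.elim_inr, loEnd_map, upEnd_map,
    Sum.elim_comp_inl]
  constructor
  · rintro ⟨d, p, ⟨⟨h1, h2⟩, h3⟩, h4⟩
    exact ⟨d, Nat.lt_succ_iff.1 d.2, walkIn_iff.2 ⟨p, h1, h2, h3, fun e => (h4 e).symm⟩⟩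
  · rintro ⟨k', hk', hw⟩
    obtain ⟨p, h1, h2, h3, h4⟩ := walkIn_iff.1 hw
    exact ⟨⟨k', Nat.lt_succ_iff.2 hk'⟩, p, ⟨⟨h1, h2⟩, h3⟩, fun e => (h4 e).symm⟩

end Formulas

theorem realize_allClosure {N : ℕ} {M : Type u} [(psLang N).Structure M] {β : Type} [Finite β]
    {φ : (psLang N).Formula β} : M ⊨ allClosure φ ↔ ∀ w : β → M, φ.Realize w := by
  rw [allClosure, Sentence.Realize, Formula.realize_iAlls]
  refine forall_congr' fun w => ?_
  rw [Formula.realize_relabel]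
  exact Iff.rfl

/-! ### The axioms -/

section Axioms

variable {N : ℕ} {V : Type u} [ColoredSpace N V]

/-- Between suitable end points there are paths at a given distance from a given finite set. -/
def ExtProp (N : ℕ) (V : Type u) [ColoredSpace N V] : Prop :=
  ∀ i j a c (A : Set V) (k : ℕ), A.Finite → Ends N i j a c (Set.univ : Set V) →
    ∃ b, PathAC N i j a c b ∧
      ∀ m, i ≤ m → m ≤ j → ∀ u ∈ A, ∀ k' ≤ k, ¬ WalkIn (Lv N i j) k' (b m) u

theorem realize_simplyConnectedAxiom {i j : Fin (N + 1)} {k : ℕ} {lo : WithBot (Fin 2)}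
    {up : WithTop (Fin 2)} : V ⊨ simplyConnectedAxiom i j k lo up ↔
    ∀ (w : Fin 2 → V) (p : Fin (k + 1) → V),
      (∀ x y, loEnd w lo = some x → upEnd w up = some y → Beneath Set.univ x y) →
      (∀ a', loEnd w lo = some a' → lev a' ≤ i) → (∀ c', upEnd w up = some c' → (j : ℕ) ≤ lev c') →
      p 0 ∈ Between Set.univ (loEnd w lo) (upEnd w up) →
      p (Fin.last k) ∈ Between Set.univ (loEnd w lo) (upEnd w up) →
      (∀ e : Fin k, Lk (p e.castSucc) (p e.succ)) →
      (∀ e, p e ∈ (Lv N i j : Set V) ∧ loEnd w lo ≠ some (p e) ∧ upEnd w up ≠ some (p e)) →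
      ∃ k' ≤ k, WalkIn (Between Set.univ (loEnd w lo) (upEnd w up) ∩ Lv N i j) k' (p 0)
        (p (Fin.last k)) := by
  rw [simplyConnectedAxiom, realize_allClosure]
  simp only [Formula.realize_imp, Formula.realize_inf, realize_endsBeneathF, realize_loLeF,
    realize_upGeF, realize_betweenF, realize_stepsF, Formula.realize_iInf, realize_inF,
    realize_neLoF, realize_neUpF, realize_pathLeF, loEnd_map, upEnd_map, and_imp, and_assoc]
  constructor
  · intro h w p
    exact h (Sum.elim w p)
  · intro h w
    exact h (w ∘ Sum.inl) (w ∘ Sum.inr)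

theorem realize_extensionAxiom {i j : Fin (N + 1)} {n k : ℕ} {lo : WithBot (Fin n)}
    {up : WithTop (Fin n)} : V ⊨ extensionAxiom i j n k lo up ↔
    ∀ w : Fin n → V,
      (∀ x y, loEnd w lo = some x → upEnd w up = some y → Beneath Set.univ x y) →
      (loEnd w lo = none → (i : ℕ) = 0) → (∀ a', loEnd w lo = some a' → lev a' + 1 = i) →
      (upEnd w up = none → (j : ℕ) = N) → (∀ c', upEnd w up = some c' → lev c' = j + 1) →
      ∃ b : Fin (N + 1) → V, (∀ m : Set.Icc i j, level (b m) = m) ∧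
        (∀ m : {m : Fin N // i ≤ m.castSucc ∧ m.succ ≤ j}, Lk (b m.1.castSucc) (b m.1.succ)) ∧
        (∀ a', loEnd w lo = some a' → Lk a' (b i)) ∧ (∀ c', upEnd w up = some c' → Lk (b j) c') ∧
        ∀ (m : Set.Icc i j) (e : Fin n), ¬ ∃ k' ≤ k, WalkIn (Lv N i j) k' (b m) (w e) := by
  have huniv : Between (Set.univ : Set V) none none = Set.univ := by
    ext z
    simp [Between]
  rw [extensionAxiom, realize_allClosure]
  simp only [Formula.realize_imp, Formula.realize_inf, realize_endsBeneathF, realize_loEqF,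
    realize_upEqF, Formula.realize_iExs, realize_levF, realize_edgeF, realize_edgeLoF,
    realize_edgeUpF, Formula.realize_iInf, Formula.realize_not,
    realize_pathLeF, loEnd_map, upEnd_map, and_imp, and_assoc, Sum.elim_inl, Sum.elim_inr,
    Sum.elim_comp_inl, loEnd_bot, upEnd_top, huniv, Set.univ_inter]

theorem scon_of_model (h : V ⊨ PS N) : SCon (Set.univ : Set V) := by
  intro a c p q k x y ha hc hx hy hw
  have hxl := hw.left_mem.2.1
  have hp : p ≤ N := hxl.1.trans (lev_le x)
  have hlo : ∃ (lo : WithBot (Fin 2)) (up : WithTop (Fin 2)) (w : Fin 2 → V),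
      loEnd w lo = a ∧ upEnd w up = c := by
    rcases a with _ | a <;> rcases c with _ | c
    · exact ⟨⊥, ⊤, fun _ => x, rfl, rfl⟩
    · exact ⟨⊥, (1 : Fin 2), fun _ => c, rfl, rfl⟩
    · exact ⟨(0 : Fin 2), ⊤, fun _ => a, rfl, rfl⟩
    · exact ⟨(0 : Fin 2), (1 : Fin 2), ![a, c], rfl, rfl⟩
  obtain ⟨lo, up, w, rfl, rfl⟩ := hlo
  -- The axioms index levels by `Fin (N + 1)`; replacing q by its minimum with N changes nothing, as
  -- no level exceeds N.
  have hax := h.realize_of_mem (simplyConnectedAxiom (⟨p, by omega⟩ : Fin (N + 1))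
    (⟨min q N, by omega⟩ : Fin (N + 1)) k lo up) (.inl (.inr ⟨_, _, _, _, _, rfl⟩))
  rw [realize_simplyConnectedAxiom] at hax
  obtain ⟨f, rfl, rfl, f3, f4⟩ := walkIn_iff.1 hw
  obtain ⟨k', hk', hw'⟩ := hax w f (fun y z hy hz => (hx.2.1 y hy).trans (hx.2.2 z hz)) ha
    (fun c' h => (min_le_left _ _).trans (hc c' h)) hx hy f3
    (fun e => ⟨⟨(f4 e).2.1.1, le_min (f4 e).2.1.2 (lev_le _)⟩, (f4 e).2.2⟩)
  exact ⟨k', hk', hw'.mono fun z hz => ⟨hz.1, hz.2.1, hz.2.2.trans (min_le_left _ _)⟩⟩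

/-- Real end points are added to the enumerated set, because the axioms can refer to them only
through a variable. -/
theorem exists_params (a c : Option V) {A : Set V} (hA : A.Finite) : ∃ (n : ℕ) (w : Fin n → V)
    (lo : WithBot (Fin n)) (up : WithTop (Fin n)), loEnd w lo = a ∧ upEnd w up = c ∧
      A ⊆ Set.range w := by
  have hsub : ∀ o : Option V, {x | o = some x}.Finite := fun o =>
    Set.Subsingleton.finite fun x hx y hy => Option.some.inj (hx.symm.trans hy)
  obtain ⟨n, w, -, hw⟩ := ((hA.union (hsub a)).union (hsub c)).fin_param
  have hlo : ∃ lo, loEnd w lo = a := by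
    rcases a with _ | a
    · exact ⟨⊥, rfl⟩
    · have : a ∈ Set.range w := by rw [hw]; exact .inl (.inr rfl)
      obtain ⟨e, rfl⟩ := this
      exact ⟨(e : Fin n), rfl⟩
  have hup : ∃ up, upEnd w up = c := by
    rcases c with _ | c
    · exact ⟨⊤, rfl⟩
    · have : c ∈ Set.range w := by rw [hw]; exact .inr rfl
      obtain ⟨e, rfl⟩ := this
      exact ⟨(e : Fin n), rfl⟩
  obtain ⟨lo, hlo⟩ := hlo
  obtain ⟨up, hup⟩ := hup
  exact ⟨n, w, lo, up, hlo, hup, hw ▸ fun x hx => .inl (.inl hx)⟩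

theorem extProp_of_model (h : V ⊨ PS N) : ExtProp N V := by
  intro i j a c A k hA he
  have hle := he.le
  have htop := he.le_top
  obtain ⟨n, w, lo, up, rfl, rfl, hw⟩ := exists_params a c hA
  have hax := h.realize_of_mem (extensionAxiom (⟨i, by omega⟩ : Fin (N + 1))
    (⟨j, by omega⟩ : Fin (N + 1)) n k lo up) (.inr ⟨_, _, _, _, _, _, Fin.mk_le_mk.2 hle, rfl⟩)
  rw [realize_extensionAxiom] at hax
  obtain ⟨b, b1, b2, b3, b4, b5⟩ := hax w he.ends he.lo_none (fun x hx => (he.lo_some x hx).2)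
    he.up_none (fun x hx => (he.up_some x hx).2)
  -- `Fin.ofNat` makes the path a function on all natural numbers; reduction modulo N + 1 has no
  -- effect on the indices in use.
  have hof : ∀ m (hm : m ≤ j), (Fin.ofNat (N + 1) m : Fin (N + 1)) = ⟨m, by omega⟩ := fun m hm =>
    Fin.ext (Nat.mod_eq_of_lt (by omega))
  refine ⟨fun m => b (Fin.ofNat (N + 1) m), ⟨fun m hi hj => ?_, fun m hi hj => ?_, fun x hx => ?_,
    fun x hx => ?_⟩, fun m hi hj u hu k' hk' hwk => ?_⟩
  · have := b1 ⟨⟨m, by omega⟩, hi, hj⟩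
    simp only [hof m hj, lev, this]
  · have := b2 ⟨⟨m, by omega⟩, hi, hj⟩
    simp only [hof m (by omega), hof (m + 1) hj]
    exact this
  · simp only [hof i hle]
    exact b3 x hx
  · simp only [hof j le_rfl]
    exact b4 x hx
  · obtain ⟨e, rfl⟩ := hw hu
    simp only [hof m hj] at hwk
    exact b5 ⟨⟨m, by omega⟩, hi, hj⟩ e ⟨k', hk', hwk⟩

theorem model_coloredAxioms : V ⊨ coloredAxioms N := by
  refine (Theory.model_iff _).2 ?_
  rintro φ (((rfl | ⟨i, j, hij, rfl⟩) | rfl) | rfl)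
  · rw [realize_allClosure]
    intro w
    rw [realize_inF]
    exact ⟨Nat.zero_le _, lev_le _⟩
  · rw [realize_allClosure]
    intro w
    rw [Formula.realize_not, Formula.realize_inf, realize_levF, realize_levF]
    rintro ⟨h1, h2⟩
    exact hij (h1.symm.trans h2)
  · rw [realize_allClosure]
    intro w
    rw [Formula.realize_imp, realize_edgeF, realize_edgeF]
    exact Lk.symm
  · rw [realize_allClosure]
    intro w
    rw [Formula.realize_imp, Formula.realize_sup, realize_edgeF, realize_upF, realize_upF]
    intro h
    exact h.lev.imp (fun h' => ⟨h, h'⟩) (fun h' => ⟨h.symm, h'⟩)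

theorem model_PS (hS : SCon (Set.univ : Set V)) (hE : ExtProp N V) : V ⊨ PS N := by
  refine (Theory.model_iff _).2 ?_
  rintro φ ((hφ | ⟨i, j, k, lo, up, rfl⟩) | ⟨i, j, n, k, lo, up, hij, rfl⟩)
  · exact model_coloredAxioms.realize_of_mem φ hφ
  · rw [realize_simplyConnectedAxiom]
    intro w p h1 h2 h3 h4 h5 h6 h7
    exact hS _ _ i j k _ _ h2 h3 h4 h5
      (walkIn_iff.2 ⟨p, rfl, rfl, h6, fun e => ⟨trivial, h7 e⟩⟩)
  · rw [realize_extensionAxiom]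
    intro w h1 h2 h3 h4 h5
    obtain ⟨b, hb, hd⟩ := hE i j (loEnd w lo) (upEnd w up) (Set.range w) k (Set.finite_range w)
      ⟨hij, Nat.lt_succ_iff.1 j.2, h2, fun x hx => ⟨trivial, h3 x hx⟩, h4,
        fun x hx => ⟨trivial, h5 x hx⟩, h1⟩
    refine ⟨fun m => b m, fun m => Fin.ext (hb.lev_b m m.2.1 m.2.2), fun m => ?_, hb.lk_lo,
      hb.lk_up, ?_⟩
    · exact hb.lk_succ m.1 m.2.1 m.2.2
    · rintro m e ⟨k', hk', hw⟩
      exact hd m m.2.1 m.2.2 (w e) ⟨e, rfl⟩ k' hk' hw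

/-- The extension property with no vertices to avoid gives a path from the bottom to x and one from
x to the top; their vertices next to x are the required neighbours. -/
theorem ExtProp.full (hE : ExtProp N V) : Full N (Set.univ : Set V) := by
  constructor
  · intro x _ hx
    have hle := lev_le x
    obtain ⟨b, hb, -⟩ := hE 0 (lev x - 1) none (some x) ∅ 0 Set.finite_empty
      ⟨Nat.zero_le _, by omega, fun _ => rfl, fun _ h => (by cases h), fun h => (by cases h),
        fun y h => by cases h; exact ⟨trivial, by omega⟩, fun _ _ h => (by cases h)⟩
    exact ⟨_, trivial, hb.lk_up x rfl, by rw [hb.lev_b _ (Nat.zero_le _) le_rfl]; omega⟩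
  · intro x _ hx
    have hle := lev_le x
    obtain ⟨b, hb, -⟩ := hE (lev x + 1) N (some x) none ∅ 0 Set.finite_empty
      ⟨by omega, le_rfl, fun h => (by cases h), fun y h => by cases h; exact ⟨trivial, rfl⟩,
        fun _ => rfl, fun _ h => (by cases h), fun _ _ _ h => (by cases h)⟩
    exact ⟨_, trivial, hb.lk_lo x rfl, hb.lev_b _ le_rfl (by omega)⟩

/-- There are no links inside a single level, so there a vertex is connected only to itself and
positive distance already means not connected. This is why every model, saturated or not, can
imitate singleton operations. -/
theorem ExtProp.rich_singI (hE : ExtProp N V) : Rich N singI V := by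
  rintro i j a c A rfl hA he
  obtain ⟨b, hb, hd⟩ := hE i i a c A 0 hA he
  refine ⟨b, hb, ?_⟩
  rintro m hi hj u hu ⟨k, hk⟩
  rcases k with _ | k
  · exact hd m hi hj u hu 0 le_rfl hk
  · obtain ⟨y, h1, h2, h3⟩ := hk.exists_head
    have h4 := h3.left_mem
    have := h1.1
    have := h1.2
    have := h4.1
    have := h4.2
    rcases h2.lev with h | h <;> omega

theorem Rich.extProp (h : Rich N allI V) : ExtProp N V := by
  intro i j a c A k hA he
  obtain ⟨b, hb, hd⟩ := h i j a c A trivial hA he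
  exact ⟨b, hb, fun m hi hj u hu k' _ hw => hd m hi hj u hu ⟨k', hw⟩⟩

end Axioms

/-- Every model of the axioms of colored spaces is a colored space. -/
theorem exists_coloredSpace {N : ℕ} {M : Type u} [S : (psLang N).Structure M]
    (h : M ⊨ coloredAxioms N) : ∃ C : ColoredSpace N M, @psStructure N M C = S := by
  have hlevel : ∀ x : M, ∃ i : Fin (N + 1),
      Structure.RelMap (L := psLang N) (PSRel.level i : PSRel N 1) ![x] := by
    intro x
    have h1 := realize_allClosure.1 (h.realize_of_mem _ (.inl (.inl (.inl rfl)))) fun _ => x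
    rw [inF, Formula.realize_iSup] at h1
    obtain ⟨i, hi⟩ := h1
    exact ⟨i, realize_levF_relMap.1 hi⟩
  choose f hf using hlevel
  have hlev : ∀ x i, Structure.RelMap (L := psLang N) (PSRel.level i : PSRel N 1) ![x] ↔
      f x = i := by
    intro x i
    refine ⟨fun hi => ?_, fun hi => hi ▸ hf x⟩
    by_contra hne
    have h1 := realize_allClosure.1 (h.realize_of_mem _ (.inl (.inl (.inr ⟨f x, i, hne, rfl⟩))))
      fun _ => x
    rw [Formula.realize_not, Formula.realize_inf, realize_levF_relMap, realize_levF_relMap] at h1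
    exact h1 ⟨hf x, hi⟩
  have hedge : ∀ x y : M, Structure.RelMap (L := psLang N) (PSRel.edge : PSRel N 2) ![x, y] →
      (Structure.RelMap (L := psLang N) (PSRel.edge : PSRel N 2) ![y, x] ∧
      ((f x : ℕ) + 1 = f y ∨ (f y : ℕ) + 1 = f x)) := by
    intro x y hxy
    have h1 := realize_allClosure.1 (h.realize_of_mem _ (.inl (.inr rfl))) ![x, y]
    have h2 := realize_allClosure.1 (h.realize_of_mem _ (.inr rfl)) ![x, y]
    rw [Formula.realize_imp, realize_edgeF_relMap, realize_edgeF_relMap] at h1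
    rw [Formula.realize_imp, realize_edgeF_relMap, Formula.realize_sup, upF, upF,
      Formula.realize_inf, Formula.realize_inf, Formula.realize_iSup, Formula.realize_iSup] at h2
    refine ⟨h1 hxy, ?_⟩
    rcases h2 hxy with ⟨-, m, h3⟩ | ⟨-, m, h3⟩
    · rw [Formula.realize_inf, realize_levF_relMap, realize_levF_relMap] at h3
      have h4 := (hlev x _).1 h3.1
      have h5 := (hlev y _).1 h3.2
      left
      rw [h4, h5]
      simp
    · rw [Formula.realize_inf, realize_levF_relMap, realize_levF_relMap] at h3
      have h4 := (hlev y _).1 h3.1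
      have h5 := (hlev x _).1 h3.2
      right
      rw [h4, h5]
      simp
  let G : SimpleGraph M :=
    { Adj := fun x y => Structure.RelMap (L := psLang N) (PSRel.edge : PSRel N 2) ![x, y]
      symm := ⟨fun x y hxy => (hedge x y hxy).1⟩
      loopless := ⟨fun x hx => by have := (hedge x x hx).2; omega⟩ }
  let C : ColoredSpace N M := ⟨f, G, fun hxy => (hedge _ _ hxy).2⟩
  refine ⟨C, ?_⟩
  · refine Structure.ext ?_ ?_
    · funext n g
      exact Empty.elim g
    · funext n r
      cases r with
      | level i =>
        funext x
        have hx : x = ![x 0] := by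
          funext k
          fin_cases k
          rfl
        refine propext ((hlev (x 0) i).symm.trans ?_)
        rw [← hx]
      | edge =>
        funext x
        have hx : x = ![x 0, x 1] := by
          funext k
          fin_cases k <;> rfl
        change Structure.RelMap (L := psLang N) (PSRel.edge : PSRel N 2) ![x 0, x 1] = _
        rw [← hx]

/-! ### Ultrapowers -/

section Ultrapower

/-- The ultrapower of `V` with respect to a nonprincipal ultrafilter on the natural numbers. -/
abbrev UPower (V : Type u) : Type u :=
  ((Filter.hyperfilter ℕ : Ultrafilter ℕ) : Filter ℕ).Product (fun _ : ℕ => V)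

theorem exists_reps {V : Type u} {α : Type*} (v : α → UPower V) :
    ∃ x : α → ℕ → V, v = fun a => ((x a : ℕ → V) : UPower V) := by
  choose x hx using fun a => Quotient.exists_rep (v a)
  exact ⟨x, funext fun a => (hx a).symm⟩

/-- Ultrapowers are saturated for countably many formulas. -/
theorem upower_realize_all {L : FirstOrder.Language.{0, 0}} {V : Type u} [L.Structure V]
    [Nonempty V] {α β : Type*} (φ : ℕ → L.Formula (α ⊕ β)) (v : α → UPower V)
    (h : ∀ n, ∃ w : β → UPower V, ∀ k ≤ n, (φ k).Realize (Sum.elim v w)) :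
    ∃ w : β → UPower V, ∀ k, (φ k).Realize (Sum.elim v w) := by
  classical
  have key : ∀ (ψ : L.Formula (α ⊕ β)) (x : α → ℕ → V) (y : β → ℕ → V),
      ψ.Realize (Sum.elim (fun a => ((x a : ℕ → V) : UPower V))
        (fun b => ((y b : ℕ → V) : UPower V))) ↔
      ∀ᶠ i in ((Filter.hyperfilter ℕ : Ultrafilter ℕ) : Filter ℕ),
        ψ.Realize (Sum.elim (fun a => x a i) (fun b => y b i)) := by
    intro ψ x y
    have h1 := Ultraproduct.realize_formula_cast (u := Filter.hyperfilter ℕ)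
      (M := fun _ : ℕ => V) ψ (Sum.elim x y)
    convert h1 using 2
    · funext a
      cases a <;> rfl
    · funext i
      congr 1
      funext a
      cases a <;> rfl
  obtain ⟨x, rfl⟩ := exists_reps v
  choose w hw using h
  choose y hy using fun n => exists_reps (w n)
  -- `S i n`: at coordinate i, the n-th approximate solution satisfies the formulas with index at
  -- most n.
  let S : ℕ → ℕ → Prop := fun i n =>
    ∀ k ≤ n, (φ k).Realize (Sum.elim (fun a => x a i) (fun b => y n b i))
  have hS : ∀ n, ∀ᶠ i in ((Filter.hyperfilter ℕ : Ultrafilter ℕ) : Filter ℕ), S i n := by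
    intro n
    have h1 : ∀ k ∈ Finset.range (n + 1),
        ∀ᶠ i in ((Filter.hyperfilter ℕ : Ultrafilter ℕ) : Filter ℕ),
          (φ k).Realize (Sum.elim (fun a => x a i) (fun b => y n b i)) := by
      intro k hk
      rw [← key]
      have h2 := hw n k (Nat.lt_succ_iff.1 (Finset.mem_range.1 hk))
      rwa [hy n] at h2
    filter_upwards [(Filter.eventually_all_finset _).2 h1] with i hi k hk
    exact hi k (Finset.mem_range.2 (Nat.lt_succ_iff.2 hk))
  -- Diagonal choice: coordinate i uses the largest n ≤ i with `S i n`. For a fixed k, almost all i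
  -- satisfy k ≤ i and `S i k`, so the chosen index is at least k and the k-th formula holds at i.
  refine ⟨fun b => ((fun i => y (Nat.findGreatest (S i) i) b i : ℕ → V) : UPower V), fun k => ?_⟩
  refine (key _ x fun b i => y (Nat.findGreatest (S i) i) b i).2 ?_
  have hk : ∀ᶠ i in ((Filter.hyperfilter ℕ : Ultrafilter ℕ) : Filter ℕ), k ≤ i :=
    (Nat.hyperfilter_le_atTop) (Filter.eventually_ge_atTop k)
  filter_upwards [hS k, hk] with i hi hki
  exact Nat.findGreatest_spec (P := S i) hki hi k (Nat.le_findGreatest hki hi)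

/-- Every model of `PS N` has an elementary extension that is saturated for countably many
formulas. -/
theorem exists_elementary_extension {N : ℕ} {V : Type u} [ColoredSpace N V] [Nonempty V]
    (hV : V ⊨ PS N) : ∃ (W : Type u) (_ : ColoredSpace N W) (δ : V → W), Nonempty W ∧
      W ⊨ PS N ∧
      (∀ (α : Type) (φ : (psLang N).Formula α) (v : α → V), φ.Realize (δ ∘ v) ↔ φ.Realize v) ∧
      ∀ (α β : Type) (φ : ℕ → (psLang N).Formula (α ⊕ β)) (v : α → W),
        (∀ n, ∃ w : β → W, ∀ k ≤ n, (φ k).Realize (Sum.elim v w)) →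
        ∃ w : β → W, ∀ k, (φ k).Realize (Sum.elim v w) := by
  suffices H : ∃ (W : Type u) (S : (psLang N).Structure W) (δ : V → W), Nonempty W ∧
      W ⊨ PS N ∧
      (∀ (α : Type) (φ : (psLang N).Formula α) (v : α → V), φ.Realize (δ ∘ v) ↔ φ.Realize v) ∧
      ∀ (α β : Type) (φ : ℕ → (psLang N).Formula (α ⊕ β)) (v : α → W),
        (∀ n, ∃ w : β → W, ∀ k ≤ n, (φ k).Realize (Sum.elim v w)) →
        ∃ w : β → W, ∀ k, (φ k).Realize (Sum.elim v w) by
    obtain ⟨W, S, δ, hne, hW, h1, h2⟩ := H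
    obtain ⟨C, rfl⟩ := exists_coloredSpace (hW.mono fun φ hφ => .inl (.inl hφ))
    exact ⟨W, C, δ, hne, hW, h1, h2⟩
  refine ⟨UPower V, inferInstance, fun x => ((fun _ => x : ℕ → V) : UPower V), inferInstance,
    ?_, ?_, fun α β φ v h => upower_realize_all φ v h⟩
  · refine (Theory.model_iff _).2 fun φ hφ => ?_
    exact (Ultraproduct.sentence_realize φ).2 (.of_forall fun _ => hV.realize_of_mem φ hφ)
  · intro α φ v
    refine (Ultraproduct.realize_formula_cast (u := Filter.hyperfilter ℕ)
      (M := fun _ : ℕ => V) φ (fun a _ => v a)).trans ?_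
    exact Filter.eventually_const

end Ultrapower

/-! ### Saturation and elementary maps -/

section Saturation

variable {N : ℕ} {V : Type u} {W : Type v} [ColoredSpace N V] [ColoredSpace N W]

/-- The variables of the second kind form a path with given ends at distance more than `k` from
the variables of the first kind. -/
noncomputable def farPathF {N n : ℕ} (i j : Fin (N + 1)) (lo : WithBot (Fin n))
    (up : WithTop (Fin n)) (k : ℕ) : (psLang N).Formula (Fin n ⊕ Fin (N + 1)) :=
  (Formula.iInf fun m : Set.Icc i j => levF m.1 (Sum.inr m.1)) ⊓
  (Formula.iInf fun m : {m : Fin N // i ≤ m.castSucc ∧ m.succ ≤ j} =>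
    edgeF N (Sum.inr m.1.castSucc) (Sum.inr m.1.succ)) ⊓
  edgeLoF N (Sum.inr i) (lo.map Sum.inl) ⊓ edgeUpF N (Sum.inr j) (up.map Sum.inl) ⊓
  Formula.iInf fun m : Set.Icc i j => Formula.iInf fun e : Fin n =>
    (pathLeF i j k ⊥ ⊤ (Sum.inr m.1) (Sum.inl e)).not

theorem realize_farPathF {n k : ℕ} {i j : Fin (N + 1)} {lo : WithBot (Fin n)}
    {up : WithTop (Fin n)} {w : Fin n → V} {b : Fin (N + 1) → V} :
    (farPathF i j lo up k).Realize (Sum.elim w b) ↔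
      PathAC N i j (loEnd w lo) (upEnd w up) (fun m => b (Fin.ofNat (N + 1) m)) ∧
      ∀ (m : Set.Icc i j) (e : Fin n), ∀ k' ≤ k, ¬ WalkIn (Lv N i j) k' (b m) (w e) := by
  have huniv : Between (Set.univ : Set V) none none = Set.univ := by
    ext z
    simp [Between]
  have hof : ∀ m : Fin (N + 1), Fin.ofNat (N + 1) m = m := fun m =>
    Fin.ext (Nat.mod_eq_of_lt m.2)
  rw [farPathF]
  simp only [Formula.realize_inf, realize_levF, realize_edgeF, realize_edgeLoF,
    realize_edgeUpF, Formula.realize_iInf, Formula.realize_not,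
    realize_pathLeF, loEnd_map, upEnd_map, Sum.elim_inl, Sum.elim_inr,
    Sum.elim_comp_inl, loEnd_bot, upEnd_top, huniv, Set.univ_inter, not_exists, not_and]
  refine and_congr_left fun _ => ⟨fun ⟨⟨⟨h1, h2⟩, h3⟩, h4⟩ => ⟨fun m hi hj => ?_,
    fun m hi hj => ?_, fun x hx => ?_, fun x hx => ?_⟩, fun h => ⟨⟨⟨fun m => ?_, fun m => ?_⟩,
    fun x hx => ?_⟩, fun x hx => ?_⟩⟩
  · have hm : m < N + 1 := by omega
    have : level (b ⟨m, hm⟩) = ⟨m, hm⟩ := h1 ⟨⟨m, hm⟩, hi, hj⟩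
    rw [← hof ⟨m, hm⟩] at this
    exact (congrArg Fin.val this).trans (Nat.mod_eq_of_lt hm)
  · have hm : m < N := by omega
    have : Lk (b (Fin.castSucc ⟨m, hm⟩)) (b (Fin.succ ⟨m, hm⟩)) := h2 ⟨⟨m, hm⟩, hi, hj⟩
    rw [← hof (Fin.castSucc _), ← hof (Fin.succ _)] at this
    exact this
  · rw [hof]; exact h3 x hx
  · rw [hof]; exact h4 x hx
  · have := h.lev_b m m.2.1 m.2.2
    rw [hof] at this
    exact Fin.ext this
  · have := h.lk_succ m.1 m.2.1 m.2.2
    rw [← hof (Fin.castSucc _), ← hof (Fin.succ _)]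
    exact this
  · rw [← hof i]; exact h.lk_lo x hx
  · rw [← hof j]; exact h.lk_up x hx

/-- Paths at distance more than k from the parameters exist for each k. A simultaneous solution of
these conditions for all k is a path at infinite distance, that is, not connected to the parameters.
-/
theorem sat_of_countably_saturated (hW : W ⊨ PS N)
    (hsat : ∀ (α β : Type) (φ : ℕ → (psLang N).Formula (α ⊕ β)) (v : α → W),
      (∀ n, ∃ w : β → W, ∀ k ≤ n, (φ k).Realize (Sum.elim v w)) →
      ∃ w : β → W, ∀ k, (φ k).Realize (Sum.elim v w)) : Sat N W := by
  have hE := extProp_of_model hW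
  refine ⟨scon_of_model hW, hE.full, ?_⟩
  intro i j a c A _ hA he
  have hle := he.le
  have htop := he.le_top
  have hof : ∀ m : Fin (N + 1), Fin.ofNat (N + 1) m = m := fun m =>
    Fin.ext (Nat.mod_eq_of_lt m.2)
  obtain ⟨n, w, lo, up, rfl, rfl, hw⟩ := exists_params a c hA
  obtain ⟨b, hb⟩ := hsat (Fin n) (Fin (N + 1))
    (farPathF ⟨i, by omega⟩ ⟨j, by omega⟩ lo up) w fun k => by
      obtain ⟨b, hb, hd⟩ := hE i j _ _ (Set.range w) k (Set.finite_range w) he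
      refine ⟨fun m => b m, fun k' hk' => realize_farPathF.2 ⟨?_, ?_⟩⟩
      · have hval : ∀ m, m ≤ j → ((Fin.ofNat (N + 1) m : Fin (N + 1)) : ℕ) = m := fun m hm =>
          Nat.mod_eq_of_lt (by omega)
        refine ⟨fun m hi hj => ?_, fun m hi hj => ?_, fun x hx => ?_, fun x hx => ?_⟩
        · simp only [hval m hj]; exact hb.lev_b m hi hj
        · simp only [hval m (Nat.le_of_succ_le hj), hval _ hj]; exact hb.lk_succ m hi hj
        · simp only [hval i hle]; exact hb.lk_lo x hx
        · simp only [hval j le_rfl]; exact hb.lk_up x hx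
      · exact fun m e l hl => hd m m.2.1 m.2.2 _ ⟨e, rfl⟩ l (hl.trans hk')
  refine ⟨_, (realize_farPathF.1 (hb 0)).1, ?_⟩
  rintro m hi hj u hu ⟨k, hk⟩
  obtain ⟨e, rfl⟩ := hw hu
  have hm : m < N + 1 := by omega
  refine (realize_farPathF.1 (hb k)).2 ⟨⟨m, hm⟩, hi, hj⟩ e k le_rfl ?_
  change WalkIn (Lv N i j) k (b ⟨m, hm⟩) (w e)
  rw [← hof ⟨m, hm⟩]
  exact hk

variable {δ : V → W}

theorem pIso_of_elementary
    (hδ : ∀ (α : Type) (φ : (psLang N).Formula α) (v : α → V), φ.Realize (δ ∘ v) ↔ φ.Realize v) :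
    PIso N Set.univ δ := by
  refine ⟨fun x _ y _ hxy => ?_, fun x _ => ?_, fun x _ y _ => ?_⟩
  · exact realize_eqF.1 ((hδ _ (eqF N (0 : Fin 2) 1) ![x, y]).1 (realize_eqF.2 hxy))
  · exact congrArg Fin.val
      (realize_levF.1 ((hδ (Fin 1) (levF (level x) 0) ![x]).2 (realize_levF.2 rfl)))
  · have := hδ (Fin 2) (edgeF N 0 1) ![x, y]
    rwa [realize_edgeF, realize_edgeF] at this

/-- Reconciles the form of walks in `realize_pathLeF`, with imaginary end points and bounds at most
N, with walks in `Lv N p q`. -/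
theorem between_none_inter_Lv (p q : ℕ) :
    Between (Set.univ : Set V) none none ∩ Lv N p (min q N) = Lv N p q := by
  ext z
  have := lev_le z
  simp [Between, Lv, this]

/-- Being joined by a walk of bounded length is expressed by a formula, so connectedness of two
images descends to V. There the walk can be chosen in A, and δ carries it back. The relation
"beneath" is a formula as well. -/
theorem Nice.map_elementary
    (hδ : ∀ (α : Type) (φ : (psLang N).Formula α) (v : α → V), φ.Realize (δ ∘ v) ↔ φ.Realize v)
    {A : Set V} (hA : Nice N A) : Nice N (δ '' A) := by
  have hp := (pIso_of_elementary hδ).mono (Set.subset_univ A)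
  refine ⟨?_, ?_, ?_⟩
  · have := hA.strong.map hp
    rwa [Set.image_empty] at this
  · rintro p q _ _ ⟨x, hx, rfl⟩ ⟨y, hy, rfl⟩ ⟨k, hk⟩
    have hpN : p ≤ N := hk.left_mem.1.trans (lev_le _)
    have h1 := hδ _ (pathLeF (⟨p, by omega⟩ : Fin (N + 1)) (⟨min q N, by omega⟩ : Fin (N + 1)) k
      ⊥ ⊤ (0 : Fin 2) 1) ![x, y]
    rw [realize_pathLeF, realize_pathLeF, loEnd_bot, loEnd_bot, upEnd_top, upEnd_top] at h1
    rw [← between_none_inter_Lv] at hk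
    obtain ⟨k', -, hw⟩ := h1.1 ⟨k, le_rfl, hk⟩
    have hw' : WalkIn (Between Set.univ none none ∩ Lv N p (min q N)) k' x y := hw
    rw [between_none_inter_Lv] at hw'
    obtain ⟨l, hl⟩ := hA.conn p q x y hx hy ⟨k', hw'⟩
    obtain ⟨f, rfl, rfl, f3, f4⟩ := walkIn_iff.1 hl
    refine ⟨l, walkIn_iff.2 ⟨δ ∘ f, rfl, rfl, fun e => ?_, fun e => ⟨⟨f e, (f4 e).1, rfl⟩, ?_⟩⟩⟩
    · exact (hp.lk_iff _ (f4 _).1 _ (f4 _).1).2 (f3 e)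
    · have := (f4 e).2
      change p ≤ lev (δ (f e)) ∧ lev (δ (f e)) ≤ q
      rw [hp.lev_eq _ (f4 e).1]
      exact this
  · rintro _ ⟨x, hx, rfl⟩ _ ⟨y, hy, rfl⟩ hxy
    refine hp.beneath (hA.beneath x hx y hy ?_)
    exact realize_beneathF.1 ((hδ _ (beneathF N (0 : Fin 2) 1) ![x, y]).1 (realize_beneathF.2 hxy))

end Saturation

/-! ### Chains of strong subspaces -/

section Chains

variable {N : ℕ} {V : Type u} [ColoredSpace N V] {P : ℕ → ℕ → Prop}

theorem Alpha.full {i j : ℕ} {a c : Option V} {b : ℕ → V} {C D : Set V}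
    (h : Alpha N i j a c b C D) (hC : Full N C) : Full N D := by
  constructor
  · intro x hx h0
    rcases (h.mem_iff x).1 hx with hx | ⟨m, hi, hj, rfl⟩
    · obtain ⟨y, hy, h1⟩ := hC.down x hx h0
      exact ⟨y, h.subset hy, h1⟩
    · rw [h.lev_b m hi hj] at h0 ⊢
      rcases hi.eq_or_lt with rfl | hlt
      · rcases ha : a with _ | y
        · exact absurd (h.lo_none ha) h0
        · exact ⟨y, h.subset (h.lo_some y ha).1, h.lk_lo ha, (h.lo_some y ha).2⟩
      · obtain ⟨n, rfl⟩ : ∃ n, m = n + 1 := ⟨m - 1, by omega⟩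
        refine ⟨b n, h.mem_b (by omega) (by omega), h.lk_succ (by omega) (by omega), ?_⟩
        rw [h.lev_b n (by omega) (by omega)]
  · intro x hx h0
    rcases (h.mem_iff x).1 hx with hx | ⟨m, hi, hj, rfl⟩
    · obtain ⟨y, hy, h1⟩ := hC.up x hx h0
      exact ⟨y, h.subset hy, h1⟩
    · rw [h.lev_b m hi hj] at h0 ⊢
      rcases hj.eq_or_lt with rfl | hlt
      · rcases hc : c with _ | y
        · exact absurd (h.up_none hc) h0
        · exact ⟨y, h.subset (h.up_some y hc).1, h.lk_up hc, (h.up_some y hc).2⟩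
      · exact ⟨b (m + 1), h.mem_b (by omega) (by omega), h.lk_succ (by omega) (by omega),
          h.lev_b (m + 1) (by omega) (by omega)⟩

theorem Strong.full {C D : Set V} (h : Strong N P C D) (hC : Full N C) : Full N D := by
  induction h with
  | refl => exact hC
  | tail h1 h ih =>
    obtain ⟨i, j, _, a, c, b, h⟩ := h
    exact h.full ih

/-- The space is the union of a chain of finite strong subspaces, which is rich for the operations
for intervals with `P`. -/
structure Chain (N : ℕ) {V : Type u} [ColoredSpace N V] (P : ℕ → ℕ → Prop) (A : ℕ → Set V) :
    Prop where
  cover : ∀ x, ∃ n, x ∈ A n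
  strong : ∀ n m, n ≤ m → Strong N P (A n) (A m)
  start : Strong N allI ∅ (A 0)
  ops : ∀ n i j a c, P i j → Ends N i j a c (A n) → ∃ m b, n ≤ m ∧
    Alpha N i j a c b (A n) (A n ∪ b '' Set.Icc i j) ∧ Strong N P (A n ∪ b '' Set.Icc i j) (A m)

/-! ### What the union of a chain inherits from its finite stages -/

namespace Chain

variable {A : ℕ → Set V}

theorem mono (h : Chain N P A) {n m : ℕ} (hnm : n ≤ m) : A n ⊆ A m := (h.strong n m hnm).subset

theorem strong_empty (h : Chain N P A) (n : ℕ) : Strong N allI ∅ (A n) :=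
  h.start.trans (h.strong 0 n (Nat.zero_le n)).all

theorem finite (h : Chain N P A) (n : ℕ) : (A n).Finite :=
  (h.strong_empty n).finite Set.finite_empty

theorem exists_subset (h : Chain N P A) {X : Set V} (hX : X.Finite) : ∃ n, X ⊆ A n := by
  induction X, hX using Set.Finite.induction_on with
  | empty => exact ⟨0, Set.empty_subset _⟩
  | @insert x X _ _ ih =>
    obtain ⟨n, hn⟩ := ih
    obtain ⟨m, hm⟩ := h.cover x
    refine ⟨max n m, Set.insert_subset (h.mono (le_max_right _ _) hm)
      (hn.trans (h.mono (le_max_left _ _)))⟩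

theorem exists_walkIn (h : Chain N P A) {S : Set V} {k : ℕ} {x y : V} (hw : WalkIn S k x y) :
    ∃ n, WalkIn (S ∩ A n) k x y := by
  induction hw with
  | @refl x hx =>
    obtain ⟨n, hn⟩ := h.cover x
    exact ⟨n, .refl ⟨hx, hn⟩⟩
  | @tail k x y z h1 h2 h3 ih =>
    obtain ⟨n, hn⟩ := ih
    obtain ⟨m, hm⟩ := h.cover z
    exact ⟨max n m, .tail (hn.mono (Set.inter_subset_inter_right _ (h.mono (le_max_left _ _)))) h2
      ⟨h3, h.mono (le_max_right _ _) hm⟩⟩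

theorem exists_beneath (h : Chain N P A) {x y : V} (hxy : Beneath Set.univ x y) :
    ∃ n, Beneath (A n) x y := by
  induction hxy with
  | @single y hs =>
    obtain ⟨n, hn⟩ := h.cover x
    obtain ⟨m, hm⟩ := h.cover y
    exact ⟨max n m, .of_lk (h.mono (le_max_left _ _) hn) (h.mono (le_max_right _ _) hm)
      hs.2.2.1 hs.2.2.2⟩
  | @tail y z _ hs ih =>
    obtain ⟨n, hn⟩ := ih
    obtain ⟨m, hm⟩ := h.cover z
    exact ⟨max n m, (hn.mono (h.mono (le_max_left _ _))).trans
      (.of_lk (h.mono (le_max_left _ _) hn.right_mem) (h.mono (le_max_right _ _) hm)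
      hs.2.2.1 hs.2.2.2)⟩

theorem strong_max (h : Chain N P A) {D : Set V} {n : ℕ} (hD : Strong N P D (A n)) (m : ℕ) :
    Strong N P D (A (max m n)) :=
  hD.trans (h.strong _ _ (le_max_right _ _))

/-- Every walk of the union lies in some stage, and D is strong in all sufficiently late stages. -/
theorem isometric (h : Chain N P A) {D : Set V} {n : ℕ} (hD : Strong N P D (A n)) {p q k : ℕ}
    {x y : V} (hx : x ∈ D) (hy : y ∈ D) (hw : WalkIn (Lv N p q) k x y) :
    ∃ k' ≤ k, WalkIn (Lv N p q ∩ D) k' x y := by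
  obtain ⟨m, hm⟩ := h.exists_walkIn hw
  exact (h.strong_max hD m).isometric hx hy
    (hm.mono (Set.inter_subset_inter_right _ (h.mono (le_max_left _ _))))

theorem beneath (h : Chain N P A) {D : Set V} {n : ℕ} (hD : Strong N P D (A n)) {x y : V}
    (hx : x ∈ D) (hy : y ∈ D) (hxy : Beneath Set.univ x y) : Beneath D x y := by
  obtain ⟨m, hm⟩ := h.exists_beneath hxy
  exact (h.strong_max hD m).beneath hx hy (hm.mono (h.mono (le_max_left _ _)))

theorem nice (h : Chain N P A) (n : ℕ) : Nice N (A n) := by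
  refine ⟨h.strong_empty n, ?_, fun x hx y hy => h.beneath .refl hx hy⟩
  rintro p q x y hx hy ⟨k, hk⟩
  obtain ⟨k', -, hw⟩ := h.isometric .refl hx hy hk
  exact ⟨k', hw.mono fun z hz => ⟨hz.2, hz.1⟩⟩

theorem ends (h : Chain N P A) {i j : ℕ} {a c : Option V} (he : Ends N i j a c Set.univ) {n : ℕ}
    (ha : ∀ x, a = some x → x ∈ A n) (hc : ∀ x, c = some x → x ∈ A n) :
    Ends N i j a c (A n) where
  le := he.le
  le_top := he.le_top
  lo_none := he.lo_none
  lo_some x hx := ⟨ha x hx, (he.lo_some x hx).2⟩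
  up_none := he.up_none
  up_some x hx := ⟨hc x hx, (he.up_some x hx).2⟩
  ends x y hx hy := h.beneath .refl (ha x hx) (hc y hy) (he.ends x y hx hy)

theorem exists_ends (h : Chain N P A) {i j : ℕ} {a c : Option V} (he : Ends N i j a c Set.univ)
    {X : Set V} (hX : X.Finite) : ∃ n, X ⊆ A n ∧ Ends N i j a c (A n) := by
  have hsub : ∀ o : Option V, {x | o = some x}.Finite := fun o =>
    Set.Subsingleton.finite fun x hx y hy => Option.some.inj (hx.symm.trans hy)
  obtain ⟨n, hn⟩ := h.exists_subset ((hX.union (hsub a)).union (hsub c))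
  exact ⟨n, fun x hx => hn (.inl (.inl hx)), h.ends he (fun x hx => hn (.inl (.inr hx)))
    (fun x hx => hn (.inr hx))⟩

theorem scon (h : Chain N P A) : SCon (Set.univ : Set V) := by
  intro a c p q k x y ha hc hx hy hw
  have hbet : ∀ x, x ∈ Between Set.univ a c → ∃ n, x ∈ Between (A n) a c := by
    intro x hx
    have h1 : ∃ n, ∀ a', a = some a' → Beneath (A n) a' x := by
      rcases a with _ | a
      · exact ⟨0, fun _ h => (by cases h)⟩
      · obtain ⟨n, hn⟩ := h.exists_beneath (hx.2.1 a rfl)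
        exact ⟨n, fun _ h => by cases h; exact hn⟩
    have h2 : ∃ n, ∀ c', c = some c' → Beneath (A n) x c' := by
      rcases c with _ | c
      · exact ⟨0, fun _ h => (by cases h)⟩
      · obtain ⟨n, hn⟩ := h.exists_beneath (hx.2.2 c rfl)
        exact ⟨n, fun _ h => by cases h; exact hn⟩
    obtain ⟨n₁, h1⟩ := h1
    obtain ⟨n₂, h2⟩ := h2
    obtain ⟨n₃, h3⟩ := h.cover x
    refine ⟨max n₁ (max n₂ n₃), h.mono (by omega) h3, fun a' h' => (h1 a' h').mono (h.mono (by omega)),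
      fun c' h' => (h2 c' h').mono (h.mono (by omega))⟩
  obtain ⟨n₁, h1⟩ := hbet x hx
  obtain ⟨n₂, h2⟩ := hbet y hy
  obtain ⟨n₃, h3⟩ := h.exists_walkIn hw
  have hm₁ := h.mono (show n₁ ≤ max n₁ (max n₂ n₃) by omega)
  have hm₂ := h.mono (show n₂ ≤ max n₁ (max n₂ n₃) by omega)
  have hm₃ := h.mono (show n₃ ≤ max n₁ (max n₂ n₃) by omega)
  obtain ⟨k', hk', hw'⟩ := (h.nice (max n₁ (max n₂ n₃))).scon a c p q k x y ha hc
    (Between.mono hm₁ h1) (Between.mono hm₂ h2)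
    (h3.mono fun z hz => ⟨hm₃ hz.2, hz.1.2⟩)
  exact ⟨k', hk', hw'.mono (Set.inter_subset_inter_left _ (Between.mono (Set.subset_univ _)))⟩

theorem full (h : Chain N P A) : Full N (Set.univ : Set V) := by
  have hf : ∀ n, Full N (A n) := fun n => (h.strong_empty n).full
    ⟨fun _ hx => absurd hx (Set.notMem_empty _), fun _ hx => absurd hx (Set.notMem_empty _)⟩
  constructor
  · intro x _ hx
    obtain ⟨n, hn⟩ := h.cover x
    obtain ⟨y, -, hy⟩ := (hf n).down x hn hx
    exact ⟨y, trivial, hy⟩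
  · intro x _ hx
    obtain ⟨n, hn⟩ := h.cover x
    obtain ⟨y, -, hy⟩ := (hf n).up x hn hx
    exact ⟨y, trivial, hy⟩

end Chain

theorem Alpha.pathAC {i j : ℕ} {a c : Option V} {b : ℕ → V} {C D : Set V}
    (h : Alpha N i j a c b C D) : PathAC N i j a c b :=
  ⟨h.lev_b, fun _ hi hj => h.lk_succ hi hj, fun _ hx => h.lk_lo hx, fun _ hx => h.lk_up hx⟩

/-- Within the levels from i to j the new path is isolated in D: its only links to old vertices lead
to a and c, of levels i - 1 and j + 1. -/
theorem Alpha.not_walkIn {i j : ℕ} {a c : Option V} {b : ℕ → V} {C D : Set V}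
    (h : Alpha N i j a c b C D) {m k : ℕ} (hi : i ≤ m) (hj : m ≤ j) {u : V} (hu : u ∈ C)
    (hw : WalkIn (Lv N i j ∩ D) k (b m) u) : False := by
  have key : ∃ m', i ≤ m' ∧ m' ≤ j ∧ u = b m' := by
    obtain ⟨x, hx⟩ : ∃ x, x = b m := ⟨_, rfl⟩
    rw [← hx] at hw
    clear hu
    induction hw with
    | refl _ => exact ⟨m, hi, hj, hx⟩
    | @tail k x y z h1 h2 h3 ih =>
      obtain ⟨m', hi', hj', rfl⟩ := ih hx
      rcases (h.lk_iff m' hi' hj' z h3.2).1 h2 with ⟨l, h4, h5, h6, -⟩ | ⟨-, h4⟩ | ⟨-, h4⟩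
      · exact ⟨l, h4, h5, h6⟩
      · have := (h.lo_some z h4).2
        have := h3.1.1
        omega
      · have := (h.up_some z h4).2
        have := h3.1.2
        omega
  obtain ⟨m', hi', hj', rfl⟩ := key
  exact h.not_mem m' hi' hj' hu

/-- The path added to a stage containing X is isolated from that stage in its own levels. The
enlarged stage is strong in a later one, so by isometry no later connection arises. -/
theorem Chain.rich {A : ℕ → Set V} (h : Chain N P A) : Rich N P V := by
  intro i j a c X hP hX he
  obtain ⟨n, hn, he'⟩ := h.exists_ends he hX
  obtain ⟨m, b, -, hα, hs⟩ := h.ops n i j a c hP he'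
  refine ⟨b, hα.pathAC, fun l hi hj u hu hc => ?_⟩
  obtain ⟨k, hk⟩ := hc
  obtain ⟨k', -, hw⟩ := h.isometric hs (hα.mem_b hi hj) (hα.subset (hn hu)) hk
  exact hα.not_walkIn hi hj (hn hu) hw

theorem Full.exists_between (h : Full N (Set.univ : Set V)) [Nonempty V] {i j : ℕ}
    {a c : Option V} (he : Ends N i j a c Set.univ) :
    ∃ x, x ∈ Between Set.univ a c ∧ i ≤ lev x ∧ lev x ≤ j := by
  have hle := he.le
  have htop := he.le_top
  rcases a with _ | a
  · have hi := he.lo_none rfl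
    rcases c with _ | c
    · have hj := he.up_none rfl
      obtain ⟨x⟩ := ‹Nonempty V›
      refine ⟨x, ⟨trivial, fun _ h => (by cases h), fun _ h => (by cases h)⟩, by omega, ?_⟩
      rw [hj]
      exact lev_le x
    · have hc := (he.up_some c rfl).2
      obtain ⟨y, -, h1, h2⟩ := h.down c trivial (by omega)
      exact ⟨y, ⟨trivial, fun _ h => (by cases h),
        fun _ h => by cases h; exact .of_lk_univ h1 h2⟩, by omega, by omega⟩
  · have ha := (he.lo_some a rfl).2
    rcases c with _ | c
    · have hj := he.up_none rfl
      obtain ⟨y, -, h1, h2⟩ := h.up a trivial (by omega)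
      exact ⟨y, ⟨trivial, fun _ h => by cases h; exact .of_lk_univ h1 h2.symm,
        fun _ h => (by cases h)⟩, by omega, by omega⟩
    · have hc := (he.up_some c rfl).2
      obtain ⟨y, h1, h2⟩ := Relation.TransGen.head'_iff.1 (he.ends a c rfl rfl)
      have h3 : lev a + 1 = lev y := h1.2.2.2
      rcases Relation.reflTransGen_iff_eq_or_transGen.1 h2 with rfl | h2
      · omega
      · exact ⟨y, ⟨trivial, fun _ h => by cases h; exact .single h1,
          fun _ h => by cases h; exact h2⟩, by omega, by omega⟩

/-! ### Far paths from singleton operations, and the resulting axioms -/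

namespace Chain

variable {A : ℕ → Set V}

/-- Replacing one vertex of a path increases its distance from a given finite set. -/
theorem exists_replacement (h : Chain N singI A) {i j : ℕ} {a c : Option V} {b : ℕ → V}
    (he : Ends N i j a c Set.univ) (hb : PathAC N i j a c b) {X : Set V} (hX : X.Finite) {k m : ℕ}
    (hi : i ≤ m) (hj : m ≤ j)
    (hd : ∀ m', i ≤ m' → m' ≤ j → m' ≠ m → ∀ u ∈ X, ∀ l < k, ¬ WalkIn (Lv N i j) l (b m') u) :
    ∃ y, PathAC N i j a c (Function.update b m y) ∧
      ∀ u ∈ X, ∀ l ≤ k, ¬ WalkIn (Lv N i j) l y u := by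
  have htop := he.le_top
  -- The neighbours of b m on the path; the replacement y arises by a singleton operation between
  -- them.
  let a' : Option V := if m = i then a else some (b (m - 1))
  let c' : Option V := if m = j then c else some (b (m + 1))
  have ha' : ∀ x, a' = some x → Lk x (b m) ∧ lev x + 1 = m ∧
      ((m = i ∧ a = some x) ∨ (i < m ∧ x = b (m - 1))) := by
    intro x hx
    by_cases hm : m = i
    · subst hm
      rw [show a' = a from if_pos rfl] at hx
      exact ⟨hb.lk_lo x hx, (he.lo_some x hx).2, .inl ⟨rfl, hx⟩⟩
    · rw [show a' = some (b (m - 1)) from if_neg hm] at hx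
      cases hx
      obtain ⟨m, rfl⟩ : ∃ n, m = n + 1 := ⟨m - 1, by omega⟩
      exact ⟨hb.lk_succ m (by omega) (by omega),
        by rw [hb.lev_b _ (by omega) (by omega)]; rfl, .inr ⟨by omega, rfl⟩⟩
  have hc' : ∀ x, c' = some x → Lk (b m) x ∧ lev x = m + 1 ∧
      ((m = j ∧ c = some x) ∨ (m < j ∧ x = b (m + 1))) := by
    intro x hx
    by_cases hm : m = j
    · subst hm
      rw [show c' = c from if_pos rfl] at hx
      exact ⟨hb.lk_up x hx, (he.up_some x hx).2, .inl ⟨rfl, hx⟩⟩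
    · rw [show c' = some (b (m + 1)) from if_neg hm] at hx
      cases hx
      exact ⟨hb.lk_succ m (by omega) (by omega),
        hb.lev_b _ (by omega) (by omega), .inr ⟨by omega, rfl⟩⟩
  have hlm := hb.lev_b m hi hj
  have he' : Ends N m m a' c' Set.univ := by
    refine ⟨le_rfl, hj.trans htop, fun h0 => ?_, fun x hx => ⟨trivial, (ha' x hx).2.1⟩, fun h0 => ?_,
      fun x hx => ⟨trivial, (hc' x hx).2.1⟩, fun x y hx hy => ?_⟩
    · by_cases hm : m = i
      · rw [show a' = a from if_pos hm] at h0
        exact hm.trans (he.lo_none h0)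
      · rw [show a' = some (b (m - 1)) from if_neg hm] at h0
        cases h0
    · by_cases hm : m = j
      · rw [show c' = c from if_pos hm] at h0
        exact hm.trans (he.up_none h0)
      · rw [show c' = some (b (m + 1)) from if_neg hm] at h0
        cases h0
    · obtain ⟨h1, h2, -⟩ := ha' x hx
      obtain ⟨h3, h4, -⟩ := hc' y hy
      exact (Beneath.of_lk_univ h1 (by omega)).trans (.of_lk_univ h3 (by omega))
  obtain ⟨n, hn, he''⟩ := h.exists_ends he' hX
  obtain ⟨m', b', -, hα, hs⟩ := h.ops n m m a' c' rfl he''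
  have hly := hα.lev_b m le_rfl le_rfl
  refine ⟨b' m, ⟨fun l h1 h2 => ?_, fun l h1 h2 => ?_, fun x hx => ?_, fun x hx => ?_⟩, ?_⟩
  · by_cases hlm : l = m
    · subst hlm
      rw [Function.update_self]
      exact hly
    · rw [Function.update_of_ne hlm]
      exact hb.lev_b l h1 h2
  · by_cases hlm : l = m
    · subst hlm
      rw [Function.update_self, Function.update_of_ne (by omega)]
      exact hα.lk_up (if_neg (by omega))
    · rw [Function.update_of_ne hlm]
      by_cases hlm' : l + 1 = m
      · subst hlm'
        rw [Function.update_self]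
        exact hα.lk_lo (if_neg (by omega))
      · rw [Function.update_of_ne hlm']
        exact hb.lk_succ l h1 h2
  · by_cases hm : i = m
    · subst hm
      rw [Function.update_self]
      exact hα.lk_lo ((if_pos rfl).trans hx)
    · rw [Function.update_of_ne hm]
      exact hb.lk_lo x hx
  · by_cases hm : j = m
    · subst hm
      rw [Function.update_self]
      exact hα.lk_up ((if_pos rfl).trans hx)
    · rw [Function.update_of_ne hm]
      exact hb.lk_up x hx
  · intro u hu l hl hw
    -- By isometry the walk may be taken in the stage enlarged by y, where the only neighbours of y
    -- are a' and c'. Inside the levels from i to j the first step therefore leads to b (m - 1) or b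
    -- (m + 1), from which X is at distance at least k.
    obtain ⟨l', hl', hw'⟩ := h.isometric hs (hα.mem_b le_rfl le_rfl) (hα.subset (hn hu)) hw
    rcases l' with _ | l'
    · exact hα.not_mem m le_rfl le_rfl (hw'.eq_of_zero ▸ hn hu)
    · obtain ⟨z, -, hz, hwz⟩ := hw'.exists_head
      have hwz' := hwz.mono Set.inter_subset_left
      have hzl := hwz'.left_mem
      rcases (hα.lk_iff m le_rfl le_rfl z hwz.left_mem.2).1 hz with
        ⟨l, h1, h2, -, h3⟩ | ⟨-, h1⟩ | ⟨-, h1⟩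
      · omega
      · obtain ⟨-, h2, ⟨rfl, -⟩ | ⟨h3, rfl⟩⟩ := ha' z h1
        · have := hzl.1
          omega
        · exact hd (m - 1) (by omega) (by omega) (by omega) u hu l' (by omega) hwz'
      · obtain ⟨-, h2, ⟨rfl, -⟩ | ⟨h3, rfl⟩⟩ := hc' z h1
        · have := hzl.2
          omega
        · exact hd (m + 1) (by omega) (by omega) (by omega) u hu l' (by omega) hwz'

/-- Induction on the distance k: replacing all vertices of a path in turn, from the lowest to the
highest, raises every distance by one. Any path serves for k = 0. -/
theorem exists_far_path [Nonempty V] (h : Chain N singI A) {i j : ℕ} {a c : Option V}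
    (he : Ends N i j a c Set.univ) {X : Set V} (hX : X.Finite) (k : ℕ) :
    ∃ b, PathAC N i j a c b ∧
      ∀ m, i ≤ m → m ≤ j → ∀ u ∈ X, ∀ l < k, ¬ WalkIn (Lv N i j) l (b m) u := by
  induction k with
  | zero =>
    obtain ⟨x, hx, hi, hj⟩ := h.full.exists_between he
    obtain ⟨b, hb, -⟩ := exists_path_through h.full hx hi hj he.lo_none
      (fun x hx => (he.lo_some x hx).2) he.up_none (fun x hx => (he.up_some x hx).2)
    exact ⟨b, hb, fun _ _ _ _ _ l hl => absurd hl l.not_lt_zero⟩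
  | succ k ih =>
    -- The first t vertices have been replaced and have distance at least k + 1; all others still
    -- have distance at least k.
    suffices H : ∀ t, i + t ≤ j + 1 → ∃ b, PathAC N i j a c b ∧
        (∀ m, i ≤ m → m ≤ j → ∀ u ∈ X, ∀ l < k, ¬ WalkIn (Lv N i j) l (b m) u) ∧
        ∀ m, i ≤ m → m < i + t → ∀ u ∈ X, ∀ l < k + 1, ¬ WalkIn (Lv N i j) l (b m) u by
      have hle := he.le
      obtain ⟨b, hb, -, hd⟩ := H (j + 1 - i) (by omega)
      exact ⟨b, hb, fun m hi hj => hd m hi (by omega)⟩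
    intro t
    induction t with
    | zero =>
      obtain ⟨b, hb, hd⟩ := ih
      exact fun _ => ⟨b, hb, hd, fun m h1 h2 => absurd h2 (by omega)⟩
    | succ t iht =>
      intro ht
      obtain ⟨b, hb, hd, hd'⟩ := iht (by omega)
      obtain ⟨y, hy, hdy⟩ := h.exists_replacement he hb hX (m := i + t) (k := k) (by omega)
        (by omega) (fun m h1 h2 _ => hd m h1 h2)
      refine ⟨_, hy, fun m h1 h2 u hu l hl => ?_, fun m h1 h2 u hu l hl => ?_⟩
      · by_cases hm : m = i + t
        · subst hm
          rw [Function.update_self]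
          exact hdy u hu l hl.le
        · rw [Function.update_of_ne hm]
          exact hd m h1 h2 u hu l hl
      · by_cases hm : m = i + t
        · subst hm
          rw [Function.update_self]
          exact hdy u hu l (Nat.lt_succ_iff.1 hl)
        · rw [Function.update_of_ne hm]
          exact hd' m h1 (by omega) u hu l hl

theorem extProp [Nonempty V] (h : Chain N singI A) : ExtProp N V := by
  intro i j a c X k hX he
  obtain ⟨b, hb, hd⟩ := h.exists_far_path he hX (k + 1)
  exact ⟨b, hb, fun m hi hj u hu l hl => hd m hi hj u hu l (Nat.lt_succ_iff.2 hl)⟩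

theorem sat (h : Chain N allI A) : Sat N V := ⟨h.scon, h.full, h.rich⟩

end Chain

end Chains

/-! ### Elementarity -/

section Elementarity

variable {N : ℕ} {V : Type u} {W : Type v} [ColoredSpace N V] [ColoredSpace N W]

theorem PIso.comp {U : Type*} [ColoredSpace N U] {C : Set V} {h : V → W} {g : W → U}
    (hg : PIso N (h '' C) g) (hh : PIso N C h) : PIso N C (g ∘ h) where
  inj := hg.inj.comp hh.inj (Set.mapsTo_image h C)
  lev_eq x hx := (hg.lev_eq _ ⟨x, hx, rfl⟩).trans (hh.lev_eq x hx)
  lk_iff x hx y hy := (hg.lk_iff _ ⟨x, hx, rfl⟩ _ ⟨y, hy, rfl⟩).trans (hh.lk_iff x hx y hy)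

/-- Tuples that correspond under an isomorphism of nice subspaces of models of `PS N` satisfy the
same formulas. -/
theorem NiceIso.formula_iff_of_model [Nonempty V] [Nonempty W] (hV : V ⊨ PS N) (hW : W ⊨ PS N)
    {α : Type} (φ : (psLang N).Formula α) {v : α → V} {w : α → W} (h : NiceIso N v w) :
    φ.Realize v ↔ φ.Realize w := by
  -- Both models are replaced by saturated elementary extensions. The isomorphism becomes the
  -- composition of the inverse of δ, of h and of ε, between nice subspaces of the extensions.
  obtain ⟨V', _, δ, _, hV', hδ, hVs⟩ := exists_elementary_extension hV
  obtain ⟨W', _, ε, _, hW', hε, hWs⟩ := exists_elementary_extension hW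
  rw [← hδ, ← hε]
  refine NiceIso.formula_iff (sat_of_countably_saturated hV' hVs)
    (sat_of_countably_saturated hW' hWs) φ ?_
  obtain ⟨C, h, hh, hC, hC', hvw⟩ := h
  have hδC := (pIso_of_elementary hδ).mono (Set.subset_univ C)
  obtain ⟨g, hg, hgδ, hgi⟩ := hδC.exists_inv
  have himg : (h ∘ g) '' (δ '' C) = h '' C := by rw [Set.image_comp, hgi]
  have hhg : PIso N (δ '' C) (h ∘ g) := PIso.comp (by rwa [hgi]) hg
  refine ⟨δ '' C, ε ∘ (h ∘ g), PIso.comp ((pIso_of_elementary hε).mono (Set.subset_univ _)) hhg,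
    hC.map_elementary hδ, ?_, fun a => ⟨⟨v a, (hvw a).1, rfl⟩, ?_⟩⟩
  · rw [Set.image_comp, himg]
    exact hC'.map_elementary hε
  · simp only [Function.comp_apply]
    rw [hgδ _ (hvw a).1, (hvw a).2]

/-- Every model contains a flag, which is nice, and is closed under singleton operations on nice
subsets. So the chain is copied stage by stage with nice images. Every tuple lies in a stage, where
the map is an isomorphism of nice subspaces and hence preserves formulas. -/
theorem Chain.exists_elementaryEmbedding {A : ℕ → Set V} (h : Chain N singI A) {F : Set V}
    {b : ℕ → V} (hF : Alpha N 0 N none none b ∅ F) (hFA : Strong N singI F (A 0))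
    (hV : V ⊨ PS N) [Nonempty W] (hW : W ⊨ PS N) : Nonempty (V ↪ₑ[psLang N] W) := by
  classical
  have : Nonempty V := ⟨b 0⟩
  have hS := scon_of_model hW
  have hE := extProp_of_model hW
  have hcl := hE.rich_singI.closed hS
  obtain ⟨y⟩ := ‹Nonempty W›
  have h0 : ∃ f : V → W, PIso N (A 0) f ∧ Nice N (f '' A 0) := by
    have he : Ends N 0 N none none (Set.univ : Set W) := ⟨Nat.zero_le _, le_rfl, fun _ => rfl,
      fun _ h => (by cases h), fun _ => rfl, fun _ h => (by cases h), fun _ _ h => (by cases h)⟩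
    obtain ⟨b', hb', -⟩ := hE 0 N none none ∅ 0 Set.finite_empty he
    obtain ⟨hα, hN⟩ := nice_empty.extend hS (⟨Nat.zero_le _, le_rfl, fun _ => rfl,
      fun _ h => (by cases h), fun _ => rfl, fun _ h => (by cases h), fun _ _ h => (by cases h)⟩ :
      Ends N 0 N none none (∅ : Set W)) hb' (fun _ _ _ u hu => absurd hu (Set.notMem_empty u))
    -- The flag is an extension of the empty set, on which a constant map is vacuously a partial
    -- isomorphism.
    obtain ⟨f, hf, -, hfF, -⟩ := hF.extend (h := fun _ => y) (b' := b')
      (D' := ∅ ∪ b' '' Set.Icc 0 N) ⟨fun x hx => absurd hx (Set.notMem_empty x),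
        fun x hx => absurd hx (Set.notMem_empty x), fun x hx => absurd hx (Set.notMem_empty x)⟩
      (by rw [Set.image_empty]; exact hα)
    obtain ⟨f', hf', -, hN'⟩ := hFA.extend hcl hf (by rw [hfF]; exact hN)
    exact ⟨f', hf', hN'⟩
  have hstep : ∀ n (f : V → W), PIso N (A n) f → Nice N (f '' A n) →
      ∃ f' : V → W, PIso N (A (n + 1)) f' ∧ Nice N (f' '' A (n + 1)) ∧ Set.EqOn f' f (A n) := by
    intro n f hf hN
    obtain ⟨f', h1, h2, h3⟩ := (h.strong n (n + 1) n.le_succ).extend hcl hf hN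
    exact ⟨f', h1, h3, h2⟩
  choose! next hn1 hn2 hn3 using hstep
  obtain ⟨f₀, hf₀⟩ := h0
  let f : ℕ → V → W := fun n => Nat.rec f₀ (fun n g => next n g) n
  have hf : ∀ n, PIso N (A n) (f n) ∧ Nice N (f n '' A n) := by
    intro n
    induction n with
    | zero => exact hf₀
    | succ n ih => exact ⟨hn1 n _ ih.1 ih.2, hn2 n _ ih.1 ih.2⟩
  have hext : ∀ n m, n ≤ m → Set.EqOn (f m) (f n) (A n) := by
    intro n m hnm
    induction m, hnm using Nat.le_induction with
    | base => exact fun _ _ => rfl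
    | succ m hnm ih =>
      exact fun x hx => (hn3 m _ (hf m).1 (hf m).2 (h.mono hnm hx)).trans (ih hx)
  choose r hr using h.cover
  let g : V → W := fun x => f (r x) x
  have hg : ∀ n, Set.EqOn (f n) g (A n) := by
    intro n x hx
    rcases le_total n (r x) with h' | h'
    · exact (hext n (r x) h' hx).symm
    · exact hext (r x) n h' (hr x)
  refine ⟨⟨g, fun n φ x => ?_⟩⟩
  obtain ⟨m, hm⟩ := h.exists_subset (Set.finite_range x)
  refine (NiceIso.formula_iff_of_model hV hW φ ⟨A m, f m, (hf m).1, h.nice m, (hf m).2,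
    fun a => ⟨hm ⟨a, rfl⟩, (hg m (hm ⟨a, rfl⟩)).symm⟩⟩).symm

/-- Countability allows a type over finitely many parameters to be enumerated, as countable
saturation requires. -/
instance countable_symbols : Countable (psLang N).Symbols := by
  have h1 : Countable (Σ n, (psLang N).Functions n) := by
    have : IsEmpty (Σ n, (psLang N).Functions n) := ⟨fun f => Empty.elim f.2⟩
    infer_instance
  have h2 : Countable (Σ n, (psLang N).Relations n) := by
    let f : (Σ n, PSRel N n) → Option (Fin (N + 1)) := fun r => match r with
      | ⟨_, .level i⟩ => some i
      | ⟨_, .edge⟩ => none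
    refine Function.Injective.countable (f := f) ?_
    rintro ⟨_, r⟩ ⟨_, s⟩ hrs
    cases r <;> cases s <;> simp_all [f]
  exact inferInstanceAs (Countable ((Σ n, (psLang N).Functions n) ⊕ Σ n, (psLang N).Relations n))

/-- The type is realised by some y in the ultrapower. A nice set covering y and strong over the
image of a stage containing the parameters is embedded into V over that stage; the image of y
satisfies the same formulas. -/
theorem Chain.isOmegaSaturated {A : ℕ → Set V} (h : Chain N allI A) :
    IsOmegaSaturated (psLang N) V := by
  intro X hX p hp
  -- Finite satisfiability of the empty subset shows that V is nonempty.
  obtain ⟨x₀, -⟩ := hp ∅ (by simp)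
  have : Nonempty V := ⟨x₀⟩
  rcases p.eq_empty_or_nonempty with rfl | hpne
  · exact ⟨x₀, fun _ hφ => absurd hφ (Set.notMem_empty _)⟩
  have hV : V ⊨ PS N := model_PS h.scon h.rich.extProp
  obtain ⟨W, _, δ, _, hW, hδ, hsat⟩ := exists_elementary_extension hV
  have : Finite X := hX
  obtain ⟨n, ⟨e⟩⟩ := Finite.exists_equiv_fin X
  let w : Fin n → V := fun k => (e.symm k : V)
  -- `T` replaces the constants for the parameters by variables, so that formulas can be compared
  -- across spaces.
  let T : (psLang N)[[X]].Formula (Fin 1) → (psLang N).Formula (Fin n ⊕ Fin 1) := fun φ =>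
    Formula.relabel (Sum.map e id) (BoundedFormula.constantsVarsEquiv φ : (psLang N).Formula _)
  have hT : ∀ φ (x : Fin 1 → V), (T φ).Realize (Sum.elim w x) ↔ φ.Realize x := by
    intro φ x
    have hwe : Sum.elim w x ∘ Sum.map e id =
        Sum.elim (fun a : X => (((psLang N).con a : (psLang N)[[X]].Constants) : V)) x := by
      funext k
      rcases k with k | k
      · simp [w]
      · rfl
    rw [Formula.realize_relabel, hwe]
    exact BoundedFormula.realize_constantsVarsEquiv
  have : Nonempty (T '' p) := (hpne.image T).to_subtype
  obtain ⟨ψ, hψ⟩ := exists_surjective_nat (T '' p)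
  choose ρ hρp hρ using fun k => (ψ k).2
  obtain ⟨y, hy⟩ := hsat (Fin n) (Fin 1) (fun k => T (ρ k)) (δ ∘ w) fun k => by
    classical
    obtain ⟨x, hx⟩ := hp ((Finset.range (k + 1)).image ρ) (by
      intro φ hφ
      simp only [Finset.coe_image, Set.mem_image] at hφ
      obtain ⟨l, -, rfl⟩ := hφ
      exact hρp l)
    refine ⟨δ ∘ fun _ => x, fun l hl => ?_⟩
    rw [← Sum.comp_elim, hδ, hT]
    exact hx _ (Finset.mem_image_of_mem _ (Finset.mem_range.2 (Nat.lt_succ_iff.2 hl)))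
  have hWs := sat_of_countably_saturated hW hsat
  obtain ⟨m, hm⟩ := h.exists_subset hX
  -- B is strong over the image of `A m`. Inverting δ on this image and imitating the operations
  -- leading to B in V fixes the parameters.
  obtain ⟨B, hB, hAB, hyB⟩ := ((h.nice m).map_elementary hδ).cover hWs.scon hWs.full (y 0)
  obtain ⟨g, hg, hgδ, hgi⟩ := ((pIso_of_elementary hδ).mono (Set.subset_univ (A m))).exists_inv
  obtain ⟨g', hg', heq, hN⟩ := hAB.extend (h.rich.closed h.scon) hg (by rw [hgi]; exact h.nice m)
  refine ⟨g' (y 0), fun φ hφ => ?_⟩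
  obtain ⟨k, hk⟩ := hψ ⟨T φ, φ, hφ, rfl⟩
  have hkφ : T (ρ k) = T φ := (hρ k).trans (congrArg Subtype.val hk)
  have h1 := hy k
  rw [hkφ] at h1
  rw [← hT]
  refine (NiceIso.formula_iff hWs h.sat (T φ) ⟨B, g', hg', hB, hN, ?_⟩).1 h1
  rintro (l | l)
  · have hwl : w l ∈ A m := hm (e.symm l).2
    refine ⟨hAB.subset ⟨w l, hwl, rfl⟩, ?_⟩
    exact ((heq ⟨w l, hwl, rfl⟩).trans (hgδ _ hwl)).symm
  · obtain rfl : l = 0 := Subsingleton.elim _ _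
    exact ⟨hyB, rfl⟩

end Elementarity

/-! ### The operations in terms of natural numbers -/

section Translation

variable {N : ℕ} {V : Type u} [ColoredSpace N V]

/-- The lower end point as an optional vertex. -/
def loOpt : WithBot V → Option V
  | ⊥ => none
  | (a : V) => some a

/-- The upper end point as an optional vertex. -/
def upOpt : WithTop V → Option V
  | ⊤ => none
  | (a : V) => some a

theorem loOpt_eq_some {a : WithBot V} {x : V} : loOpt a = some x ↔ a = x := by
  induction a using WithBot.recBotCoe <;> simp [loOpt]

theorem upOpt_eq_some {a : WithTop V} {x : V} : upOpt a = some x ↔ a = x := by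
  induction a using WithTop.recTopCoe <;> simp [upOpt]

theorem exists_loOpt (o : Option V) : ∃ a, loOpt a = o := by
  rcases o with _ | x
  · exact ⟨⊥, rfl⟩
  · exact ⟨x, rfl⟩

theorem exists_upOpt (o : Option V) : ∃ a, upOpt a = o := by
  rcases o with _ | x
  · exact ⟨⊤, rfl⟩
  · exact ⟨x, rfl⟩

theorem lowerLevel_iff {i : Fin (N + 1)} {a : WithBot V} : LowerLevel i a ↔
    (loOpt a = none → (i : ℕ) = 0) ∧ ∀ x, loOpt a = some x → lev x + 1 = i := by
  induction a using WithBot.recBotCoe <;> simp [loOpt, LowerLevel, lev]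

theorem upperLevel_iff {j : Fin (N + 1)} {a : WithTop V} : UpperLevel j a ↔
    (upOpt a = none → (j : ℕ) = N) ∧ ∀ x, upOpt a = some x → lev x = j + 1 := by
  induction a using WithTop.recTopCoe <;> simp [upOpt, UpperLevel, lev]

theorem endsBeneath_iff {C : Set V} {a : WithBot V} {c : WithTop V} : EndsBeneath C a c ↔
    (∀ x, loOpt a = some x → x ∈ C) ∧ (∀ y, upOpt c = some y → y ∈ C) ∧
      ∀ x y, loOpt a = some x → upOpt c = some y → Beneath C x y := by
  induction a using WithBot.recBotCoe <;> induction c using WithTop.recTopCoe <;>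
    simp [upOpt, loOpt, EndsBeneath]
  exact ⟨fun h => ⟨h.left_mem, h.right_mem, h⟩, fun h => h.2.2⟩

theorem ofNat_val (m : Fin (N + 1)) : Fin.ofNat (N + 1) m = m := Fin.ext (Nat.mod_eq_of_lt m.2)

theorem ofNat_of_le {m : ℕ} (hm : m ≤ N) :
    Fin.ofNat (N + 1) m = ⟨m, Nat.lt_succ_of_le hm⟩ := Fin.ext (Nat.mod_eq_of_lt (by omega))

theorem alphaStep_iff {i j : Fin (N + 1)} {C D : Set V} :
    AlphaStep i j C D ↔ ∃ a c b, Alpha N i j a c b C D := by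
  have hj := Nat.lt_succ_iff.1 j.2
  constructor
  · rintro ⟨hij, a, c, b, ha, hc, he, hb, rfl, hlk⟩
    rw [lowerLevel_iff] at ha
    rw [upperLevel_iff] at hc
    rw [endsBeneath_iff] at he
    have hmem : ∀ m : ℕ, ∀ h1 : (i : ℕ) ≤ m, ∀ h2 : m ≤ (j : ℕ),
        (⟨m, by omega⟩ : Fin (N + 1)) ∈ Set.Icc i j := fun m h1 h2 => ⟨h1, h2⟩
    refine ⟨loOpt a, upOpt c, fun m => b (Fin.ofNat (N + 1) m), hij, hj, ha.1,
      fun x hx => ⟨he.1 x hx, ha.2 x hx⟩, hc.1, fun x hx => ⟨he.2.1 x hx, hc.2 x hx⟩, he.2.2,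
      fun m h1 h2 => ?_, fun m h1 h2 => ?_, fun x => ?_, fun m h1 h2 x hx => ?_⟩
    · rw [ofNat_of_le (h2.trans hj)]
      exact congrArg Fin.val (hb _ (hmem m h1 h2)).1
    · rw [ofNat_of_le (h2.trans hj)]
      exact (hb _ (hmem m h1 h2)).2
    · refine or_congr Iff.rfl ⟨?_, ?_⟩
      · rintro ⟨m, hm, rfl⟩
        exact ⟨m, hm.1, hm.2, by rw [ofNat_val]⟩
      · rintro ⟨m, h1, h2, rfl⟩
        refine ⟨_, hmem m h1 h2, by rw [ofNat_of_le (h2.trans hj)]⟩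
    · rw [ofNat_of_le (h2.trans hj), loOpt_eq_some, upOpt_eq_some]
      refine (hlk _ (hmem m h1 h2) x hx).trans (or_congr ⟨?_, ?_⟩ (or_congr ?_ ?_))
      · rintro ⟨m', hm', rfl, h⟩
        exact ⟨m', hm'.1, hm'.2, by rw [ofNat_val], h⟩
      · rintro ⟨m', h3, h4, rfl, h⟩
        exact ⟨_, hmem m' h3 h4, by rw [ofNat_of_le (h4.trans hj)], h⟩
      · rw [Fin.ext_iff]
      · rw [Fin.ext_iff]
  · rintro ⟨a, c, b, h⟩
    obtain ⟨a, rfl⟩ := exists_loOpt a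
    obtain ⟨c, rfl⟩ := exists_upOpt c
    refine ⟨h.le, a, c, fun m => b m, lowerLevel_iff.2 ⟨h.lo_none, fun x hx => (h.lo_some x hx).2⟩,
      upperLevel_iff.2 ⟨h.up_none, fun x hx => (h.up_some x hx).2⟩,
      endsBeneath_iff.2 ⟨fun x hx => (h.lo_some x hx).1, fun x hx => (h.up_some x hx).1, h.ends⟩,
      fun m hm => ⟨Fin.ext (h.lev_b m hm.1 hm.2), h.not_mem m hm.1 hm.2⟩, ?_,
      fun m hm x hx => ?_⟩
    · ext x
      rw [h.mem_iff]
      refine or_congr Iff.rfl ⟨?_, ?_⟩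
      · rintro ⟨m, h1, h2, rfl⟩
        exact ⟨⟨m, by omega⟩, ⟨h1, h2⟩, rfl⟩
      · rintro ⟨m, hm, rfl⟩
        exact ⟨m, hm.1, hm.2, rfl⟩
    · have h1 := h.lk_iff m hm.1 hm.2 x hx
      rw [loOpt_eq_some, upOpt_eq_some] at h1
      refine h1.trans (or_congr ⟨?_, ?_⟩ (or_congr ?_ ?_))
      · rintro ⟨m', h3, h4, rfl, h⟩
        exact ⟨⟨m', by omega⟩, ⟨h3, h4⟩, rfl, h⟩
      · rintro ⟨m', hm', rfl, h⟩
        exact ⟨m', hm'.1, hm'.2, rfl, h⟩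
      · rw [Fin.ext_iff]
      · rw [Fin.ext_iff]

variable {P : ℕ → ℕ → Prop} {Q : Fin (N + 1) → Fin (N + 1) → Prop}

theorem strongSub_iff (hPQ : ∀ i j : Fin (N + 1), Q i j ↔ P i j) {C D : Set V} :
    StrongSub Q C D ↔ Strong N P C D := by
  constructor
  · intro h
    refine Relation.ReflTransGen.lift id ?_ _ _ h
    rintro X Y ⟨i, j, hQ, h⟩
    exact ⟨i, j, (hPQ i j).1 hQ, alphaStep_iff.1 h⟩
  · intro h
    refine Relation.ReflTransGen.lift id ?_ _ _ h
    rintro X Y ⟨i, j, hP, a, c, b, h⟩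
    have h1 := h.le
    have h2 := h.le_top
    exact ⟨⟨i, by omega⟩, ⟨j, by omega⟩, (hPQ _ _).2 hP, alphaStep_iff.2 ⟨a, c, b, h⟩⟩

/-- A flag is itself the result of an operation on the empty space with both ends imaginary. Thus
members of the class generated from a flag also arise from the empty space by operations. -/
theorem isFlag_iff {F : Set V} : IsFlag F ↔ ∃ b, Alpha N 0 N none none b ∅ F := by
  constructor
  · rintro ⟨a, rfl, h1, h2⟩
    have hlev : ∀ m ≤ N, lev (a (Fin.ofNat (N + 1) m)) = m := fun m hm => by
      rw [ofNat_of_le hm]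
      exact congrArg Fin.val (h1 _)
    refine ⟨fun m => a (Fin.ofNat (N + 1) m), Nat.zero_le _, le_rfl, fun _ => rfl,
      fun _ h => (by cases h), fun _ => rfl, fun _ h => (by cases h), fun _ _ h => (by cases h),
      fun m _ hm => hlev m hm, fun m _ _ h => h, fun x => ?_, fun m _ hm x hx => ?_⟩
    · constructor
      · rintro ⟨m, rfl⟩
        exact .inr ⟨m, Nat.zero_le _, Nat.lt_succ_iff.1 m.2, by rw [ofNat_val]⟩
      · rintro (h | ⟨m, -, -, rfl⟩)
        · exact absurd h (Set.notMem_empty _)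
        · exact ⟨_, rfl⟩
    · have hstep : ∀ m, m + 1 ≤ N →
          Lk (a (Fin.ofNat (N + 1) m)) (a (Fin.ofNat (N + 1) (m + 1))) := by
        intro m hm
        rw [ofNat_of_le hm, ofNat_of_le (by omega)]
        exact h2 ⟨m, by omega⟩
      constructor
      · obtain ⟨l, rfl⟩ := hx
        intro h
        have h3 := h.lev
        have h4 := hlev l (Nat.lt_succ_iff.1 l.2)
        rw [ofNat_val] at h4
        rw [hlev m hm, h4] at h3
        exact .inl ⟨l, Nat.zero_le _, Nat.lt_succ_iff.1 l.2, by rw [ofNat_val], h3⟩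
      · rintro (⟨l, -, hl, rfl, rfl | rfl⟩ | ⟨-, h⟩ | ⟨-, h⟩)
        · exact hstep m hl
        · exact (hstep l hm).symm
        · cases h
        · cases h
  · rintro ⟨b, h⟩
    refine ⟨fun m => b m, ?_, fun m => Fin.ext (h.lev_b m (Nat.zero_le _) (Nat.lt_succ_iff.1 m.2)),
      fun m => h.lk_succ (Nat.zero_le _) m.2⟩
    ext x
    rw [h.mem_iff]
    constructor
    · rintro (hx | ⟨m, -, hm, rfl⟩)
      · exact absurd hx (Set.notMem_empty _)
      · exact ⟨⟨m, by omega⟩, rfl⟩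
    · rintro ⟨m, rfl⟩
      exact .inr ⟨m, Nat.zero_le _, Nat.lt_succ_iff.1 m.2, rfl⟩

end Translation

/-! ### Strong embeddings -/

section StrongEmbeddings

variable {N : ℕ} {P : ℕ → ℕ → Prop} {V : Type u} {W : Type v} [ColoredSpace N V] [ColoredSpace N W]

theorem pIso_val (C : Set V) (D : Set C) : PIso N D (Subtype.val : C → V) :=
  ⟨Subtype.val_injective.injOn, fun _ _ => rfl, fun _ _ _ _ => Iff.rfl⟩

theorem Strong.image_iff {h : V → W} (hh : PIso N Set.univ h) {C D : Set V} :
    Strong N P (h '' C) (h '' D) ↔ Strong N P C D := by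
  refine ⟨fun hs => ?_, fun hs => hs.map (hh.mono (Set.subset_univ D))⟩
  rcases isEmpty_or_nonempty V with hV | hV
  · rw [Set.eq_empty_of_isEmpty C, Set.eq_empty_of_isEmpty D]
    exact .refl
  · obtain ⟨g, hg, hgh, -⟩ := hh.exists_inv
    have himg : ∀ X : Set V, g '' (h '' X) = X := fun X => by
      rw [Set.image_image]
      exact (Set.image_congr fun x _ => hgh x trivial).trans (Set.image_id' X)
    have := hs.map (hg.mono (Set.image_mono (Set.subset_univ D)))
    rwa [himg, himg] at this

theorem isStrongEmbedding_iff {Q : Fin (N + 1) → Fin (N + 1) → Prop}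
    (hPQ : ∀ i j : Fin (N + 1), Q i j ↔ P i j) {V W : Type u} [ColoredSpace N V] [ColoredSpace N W]
    {f : V → W} : IsStrongEmbedding Q f ↔
      PIso N Set.univ f ∧ Strong N P (Set.range f) Set.univ := by
  constructor
  · rintro ⟨h1, h2, h3, h4⟩
    exact ⟨⟨h1.injOn, fun x _ => congrArg Fin.val (h2 x), fun x _ y _ => h3 x y⟩,
      (strongSub_iff hPQ).1 h4⟩
  · rintro ⟨h1, h2⟩
    exact ⟨Set.injOn_univ.1 h1.inj, fun x => Fin.ext (h1.lev_eq x trivial),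
      fun x y => h1.lk_iff x trivial y trivial, (strongSub_iff hPQ).2 h2⟩

theorem isStrongEmbedding_inclusion {Q : Fin (N + 1) → Fin (N + 1) → Prop}
    (hPQ : ∀ i j : Fin (N + 1), Q i j ↔ P i j) {C D : Set V} (h : C ⊆ D) :
    IsStrongEmbedding Q (Set.inclusion h) ↔ Strong N P C D := by
  rw [isStrongEmbedding_iff hPQ, ← Strong.image_iff (pIso_val D Set.univ), Set.image_univ,
    Subtype.range_val, ← Set.range_comp]
  have hr : Set.range (Subtype.val ∘ Set.inclusion h) = C := by
    ext x
    simp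
  rw [hr]
  refine and_iff_right ⟨(Set.inclusion_injective h).injOn, fun _ _ => rfl, fun _ _ _ _ => Iff.rfl⟩

end StrongEmbeddings

/-! ### Free amalgamation of operations -/

section Commute

variable {N : ℕ} {V : Type u} [ColoredSpace N V] {P : ℕ → ℕ → Prop} {i j : ℕ} {a c : Option V}
  {b : ℕ → V} {C D X Y : Set V}

theorem Alpha.eq_union (h : Alpha N i j a c b C D) : D = C ∪ b '' Set.Icc i j := by
  ext x
  rw [h.mem_iff]
  refine or_congr Iff.rfl ⟨?_, ?_⟩
  · rintro ⟨m, h1, h2, rfl⟩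
    exact ⟨m, ⟨h1, h2⟩, rfl⟩
  · rintro ⟨m, hm, rfl⟩
    exact ⟨m, hm.1, hm.2, rfl⟩

theorem Alpha.restrict (h : Alpha N i j a c b Y D) (hXY : X ⊆ Y) (he : Ends N i j a c X) :
    Alpha N i j a c b X (X ∪ b '' Set.Icc i j) := by
  refine ⟨he.le, he.le_top, he.lo_none, he.lo_some, he.up_none, he.up_some, he.ends, h.lev_b,
    fun m h1 h2 hm => h.not_mem m h1 h2 (hXY hm), fun x => or_congr Iff.rfl ⟨?_, ?_⟩,
    fun m h1 h2 x hx => h.lk_iff m h1 h2 x ?_⟩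
  · rintro ⟨m, hm, rfl⟩
    exact ⟨m, hm.1, hm.2, rfl⟩
  · rintro ⟨m, h1, h2, rfl⟩
    exact ⟨m, ⟨h1, h2⟩, rfl⟩
  · rw [h.eq_union]
    exact Set.union_subset_union_left _ hXY hx

/-- The path b is linked to Y only at its ends, which lie in X, while the path d lies outside of X.
So the two paths are not linked, and d may be added after b. -/
theorem Alpha.commute (h : Alpha N i j a c b Y D) (he : Ends N i j a c X) {i' j' : ℕ}
    {a' c' : Option V} {d : ℕ → V} {X' : Set V} (hs : Alpha N i' j' a' c' d X X') (hY : X' ⊆ Y) :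
    Alpha N i' j' a' c' d (X ∪ b '' Set.Icc i j) (X' ∪ b '' Set.Icc i j) := by
  have hlk : ∀ l, i ≤ l → l ≤ j → ∀ m, i' ≤ m → m ≤ j' → ¬ Lk (d m) (b l) := by
    intro l h1 h2 m h3 h4 h5
    rcases (h.lk_old h1 h2 (hY (hs.mem_b h3 h4))).1 h5.symm with ⟨-, h6⟩ | ⟨-, h6⟩
    · exact hs.not_mem m h3 h4 (he.lo_some _ h6).1
    · exact hs.not_mem m h3 h4 (he.up_some _ h6).1
  refine ⟨hs.le, hs.le_top, hs.lo_none, fun x hx => ⟨.inl (hs.lo_some x hx).1, (hs.lo_some x hx).2⟩,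
    hs.up_none, fun x hx => ⟨.inl (hs.up_some x hx).1, (hs.up_some x hx).2⟩,
    fun x y hx hy => (hs.ends x y hx hy).mono Set.subset_union_left, hs.lev_b, ?_, ?_, ?_⟩
  · rintro m h1 h2 (hm | ⟨l, hl, hlm⟩)
    · exact hs.not_mem m h1 h2 hm
    · exact h.not_mem l hl.1 hl.2 (hlm ▸ hY (hs.mem_b h1 h2))
  · intro x
    rw [Set.mem_union, Set.mem_union, hs.mem_iff]
    exact or_right_comm
  · rintro m h1 h2 x (hx | ⟨l, hl, rfl⟩)
    · exact hs.lk_iff m h1 h2 x hx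
    · refine iff_of_false (hlk l hl.1 hl.2 m h1 h2) ?_
      have hb := h.not_mem l hl.1 hl.2
      rintro (⟨m', h3, h4, h5, -⟩ | ⟨-, h5⟩ | ⟨-, h5⟩)
      · exact hb (h5 ▸ hY (hs.mem_b h3 h4))
      · exact hb (hY (hs.subset (hs.lo_some _ h5).1))
      · exact hb (hY (hs.subset (hs.up_some _ h5).1))

/-- Free amalgamation: an operation with ends in X may be carried out over the larger Y without
destroying strongness. -/
theorem Strong.commute (hs : Strong N P X Y) (h : Alpha N i j a c b Y D) (he : Ends N i j a c X) :
    Strong N P (X ∪ b '' Set.Icc i j) (Y ∪ b '' Set.Icc i j) := by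
  suffices H : ∀ X', Strong N P X X' → X' ⊆ Y →
      Strong N P (X ∪ b '' Set.Icc i j) (X' ∪ b '' Set.Icc i j) from H Y hs subset_rfl
  intro X' hX'
  induction hX' with
  | refl => exact fun _ => .refl
  | tail h1 h2 ih =>
    obtain ⟨i', j', hP, a', c', d, hα⟩ := h2
    exact fun hY => (ih (hα.subset.trans hY)).trans
      (.single hP (h.commute (he.mono (Strong.subset h1)) hα hY))

end Commute

/-! ### Free extensions -/

section FreeExtension

variable {N : ℕ} {V : Type u} [ColoredSpace N V] {i j : ℕ} {a c : Option V}

/-- The space obtained from `V` by adding a new path of the levels `i, …, j` from `a` to `c`. -/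
@[reducible]
def freeExtension (he : Ends N i j a c (Set.univ : Set V)) :
    ColoredSpace N (V ⊕ ULift.{u} (Fin (j - i + 1))) where
  level := Sum.elim level fun m => ⟨i + m.down, by
    have h1 := he.le
    have h2 := he.le_top
    omega⟩
  graph :=
    { Adj := fun x y => match x, y with
        | .inl x, .inl y => Lk x y
        | .inl x, .inr m => (i + m.down = i ∧ a = some x) ∨ (i + m.down = j ∧ c = some x)
        | .inr m, .inl x => (i + m.down = i ∧ a = some x) ∨ (i + m.down = j ∧ c = some x)
        | .inr m, .inr l => (i + m.down + 1 = i + l.down) ∨ (i + l.down + 1 = i + m.down)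
      symm := ⟨by
        rintro (x | m) (y | l) h
        · exact Lk.symm h
        · exact h
        · exact h
        · exact h.symm⟩
      loopless := ⟨by
        rintro (x | m) h
        · have := Lk.lev h
          omega
        · rcases h with h | h <;> omega⟩ }
  adj_level := by
    have h3 : ∀ (x : V) (m : ULift.{u} (Fin (j - i + 1))),
        (i + m.down = i ∧ a = some x) ∨ (i + m.down = j ∧ c = some x) →
        lev x + 1 = i + m.down ∨ i + m.down + 1 = lev x := by
      rintro x m (⟨h1, h2⟩ | ⟨h1, h2⟩)
      · exact .inl (by rw [h1]; exact (he.lo_some x h2).2)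
      · exact .inr (by rw [h1]; exact (he.up_some x h2).2.symm)
    rintro (x | m) (y | l) h
    · exact Lk.lev h
    · exact h3 x l h
    · exact (h3 y m h).symm
    · exact h

theorem exists_freeExtension (he : Ends N i j a c (Set.univ : Set V)) :
    ∃ (W : Type u) (_ : ColoredSpace N W) (f : V → W) (b : ℕ → W), PIso N Set.univ f ∧
      Alpha N i j (a.map f) (c.map f) b (Set.range f) Set.univ := by
  have hval : ∀ m, i ≤ m → m ≤ j → i + (Fin.ofNat (j - i + 1) (m - i) : ℕ) = m := by
    intro m h1 h2
    have : (Fin.ofNat (j - i + 1) (m - i) : ℕ) = m - i := Nat.mod_eq_of_lt (by omega)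
    omega
  have hsome : ∀ (o : Option V) (x : V), o.map (Sum.inl : V → V ⊕ ULift.{u} (Fin (j - i + 1))) =
      some (Sum.inl x) ↔ o = some x := by
    intro o x
    cases o <;> simp
  let b : ℕ → V ⊕ ULift.{u} (Fin (j - i + 1)) := fun m => Sum.inr ⟨Fin.ofNat _ (m - i)⟩
  have hb : ∀ m : ULift.{u} (Fin (j - i + 1)), Sum.inr m = b (i + m.down) := by
    intro m
    refine congrArg Sum.inr (ULift.ext _ _ (Fin.ext ?_))
    have := hval (i + m.down) (by omega) (by have := m.down.2; have := he.le; omega)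
    change (m.down : ℕ) = (Fin.ofNat (j - i + 1) (i + m.down - i) : ℕ)
    omega
  let _ := freeExtension he
  have hf : PIso N Set.univ (Sum.inl : V → V ⊕ ULift.{u} (Fin (j - i + 1))) :=
    ⟨Sum.inl_injective.injOn, fun _ _ => rfl, fun _ _ _ _ => Iff.rfl⟩
  have he' := he.map hf
  rw [Set.image_univ] at he'
  refine ⟨V ⊕ ULift.{u} (Fin (j - i + 1)), inferInstance, Sum.inl, b, hf,
    he'.le, he'.le_top, he'.lo_none, he'.lo_some, he'.up_none, he'.up_some, he'.ends,
    fun m h1 h2 => hval m h1 h2, ?_, ?_, ?_⟩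
  · rintro m - - ⟨x, hx⟩
    cases hx
  · rintro (x | m)
    · exact iff_of_true trivial (.inl ⟨x, rfl⟩)
    · refine iff_of_true trivial (.inr ⟨i + m.down, by omega, ?_, hb m⟩)
      have := m.down.2
      have := he.le
      omega
  · rintro m h1 h2 (x | l) -
    · have hl : Lk (b m) (Sum.inl x) ↔
          (i + (Fin.ofNat (j - i + 1) (m - i) : ℕ) = i ∧ a = some x) ∨
          (i + (Fin.ofNat (j - i + 1) (m - i) : ℕ) = j ∧ c = some x) := Iff.rfl
      rw [hl, hval m h1 h2, hsome, hsome]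
      refine (or_iff_right ?_).symm
      rintro ⟨m', -, -, h3, -⟩
      cases h3
    · have hl : Lk (b m) (Sum.inr l) ↔
          (i + (Fin.ofNat (j - i + 1) (m - i) : ℕ) + 1 = i + l.down) ∨
          (i + l.down + 1 = i + (Fin.ofNat (j - i + 1) (m - i) : ℕ)) := Iff.rfl
      rw [hl, hval m h1 h2]
      have hlj : i + (l.down : ℕ) ≤ j := by
        have := l.down.2
        have := he.le
        omega
      constructor
      · exact fun h => .inl ⟨i + l.down, by omega, hlj, hb l, h⟩
      · rintro (⟨m', h3, h4, h5, h6⟩ | ⟨-, h5⟩ | ⟨-, h5⟩)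
        · have : i + (l.down : ℕ) = m' := by
            rw [hb l] at h5
            have h7 := hval m' h3 h4
            have h8 := hval (i + l.down) (by omega) hlj
            have h9 := congrArg ULift.down (Sum.inr.inj h5)
            rw [Fin.ext_iff] at h9
            dsimp only at h9
            omega
          rwa [this]
        · cases ha : a <;> simp [ha] at h5
        · cases hc : c <;> simp [hc] at h5

end FreeExtension

/-! ### Fraïssé limits and chains -/

section Limits

variable {N : ℕ}

/-- The possible starting points of the constructions: the empty set, or a flag. -/
def StartSet (N : ℕ) (flag : Prop) {V : Type u} [ColoredSpace N V] (F : Set V) : Prop :=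
  (¬ flag ∧ F = ∅) ∨ (flag ∧ ∃ b, Alpha N 0 N none none b ∅ F)

/-- The space `V` is finite and is obtained from a starting point by the operations for the
intervals with `P`. -/
def Generated (N : ℕ) (flag : Prop) (P : ℕ → ℕ → Prop) {V : Type u} [ColoredSpace N V]
    (C : Set V) : Prop :=
  C.Finite ∧ ∃ F, StartSet N flag F ∧ Strong N P F C

variable {flag : Prop} {P : ℕ → ℕ → Prop}

section Basic

variable {V : Type u} {W : Type v} [ColoredSpace N V] [ColoredSpace N W]

theorem StartSet.strong {F : Set V} (h : StartSet N flag F) : Strong N allI ∅ F := by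
  rcases h with ⟨-, rfl⟩ | ⟨-, b, h⟩
  · exact .refl
  · exact .single trivial h

theorem StartSet.map {F : Set V} {h : V → W} (hF : StartSet N flag F) (hh : PIso N F h) :
    StartSet N flag (h '' F) := by
  rcases hF with ⟨hf, rfl⟩ | ⟨hf, b, hF⟩
  · exact .inl ⟨hf, Set.image_empty h⟩
  · have := hF.map hh
    rw [Set.image_empty] at this
    exact .inr ⟨hf, _, this⟩

theorem Generated.map {C : Set V} {h : V → W} (hC : Generated N flag P C) (hh : PIso N C h) :
    Generated N flag P (h '' C) := by
  obtain ⟨h1, F, h2, h3⟩ := hC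
  exact ⟨h1.image h, h '' F, h2.map (hh.mono h3.subset), h3.map hh⟩

theorem Generated.image_iff {C : Set V} {h : V → W} (hh : PIso N C h) :
    Generated N flag P (h '' C) ↔ Generated N flag P C := by
  refine ⟨fun hC => ?_, fun hC => hC.map hh⟩
  rcases isEmpty_or_nonempty V with hV | hV
  · obtain ⟨h1, F, h2, h3⟩ := hC
    obtain rfl : C = ∅ := Set.eq_empty_of_isEmpty C
    rw [Set.image_empty] at h3
    obtain rfl : F = ∅ := Set.subset_empty_iff.1 h3.subset
    have h4 : ¬ flag := by
      rcases h2 with ⟨h2, -⟩ | ⟨-, b, h2⟩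
      · exact h2
      · exact absurd (h2.mem_b (Nat.zero_le 0) (Nat.zero_le N)) (Set.notMem_empty _)
    exact ⟨Set.finite_empty, ∅, .inl ⟨h4, rfl⟩, .refl⟩
  · obtain ⟨g, hg, -, hgi⟩ := hh.exists_inv
    have := hC.map hg
    rwa [hgi] at this

theorem generated_coe (C : Set V) :
    Generated N flag P (Set.univ : Set C) ↔ Generated N flag P C := by
  rw [← Generated.image_iff (pIso_val C Set.univ), Set.image_univ, Subtype.range_val]

theorem Ends.coe {C : Set V} {i j : ℕ} {a c : Option V} (he : Ends N i j a c C) :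
    ∃ a' c' : Option C, a'.map Subtype.val = a ∧ c'.map Subtype.val = c ∧
      Ends N i j a' c' (Set.univ : Set C) := by
  have hopt : ∀ o : Option V, (∀ x, o = some x → x ∈ C) →
      ∃ o' : Option C, o'.map Subtype.val = o := by
    rintro (_ | x) h
    · exact ⟨none, rfl⟩
    · exact ⟨some ⟨x, h x rfl⟩, rfl⟩
  obtain ⟨a', rfl⟩ := hopt a fun x hx => (he.lo_some x hx).1
  obtain ⟨c', rfl⟩ := hopt c fun x hx => (he.up_some x hx).1
  refine ⟨a', c', rfl, rfl, he.le, he.le_top, fun h => he.lo_none (h ▸ rfl),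
    fun x hx => ⟨trivial, (he.lo_some x (hx ▸ rfl)).2⟩, fun h => he.up_none (h ▸ rfl),
    fun x hx => ⟨trivial, (he.up_some x (hx ▸ rfl)).2⟩, fun x y hx hy => ?_⟩
  have hb : ∀ (u w : V), Beneath C u w → ∀ (hu : u ∈ C) (hw : w ∈ C),
      Beneath (Set.univ : Set C) ⟨u, hu⟩ ⟨w, hw⟩ := by
    intro u w h
    induction h with
    | single hs => exact fun hu hw => .single ⟨trivial, trivial, hs.2.2⟩
    | tail _ hs ih => exact fun hu hw => .tail (ih hu hs.1) ⟨trivial, trivial, hs.2.2⟩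
  exact hb x y (he.ends x y (hx ▸ rfl) (hy ▸ rfl)) x.2 y.2

end Basic

variable {K : ∀ (V : Type u) [ColoredSpace N V], Prop} {Q : Fin (N + 1) → Fin (N + 1) → Prop}
  {V : Type u} [ColoredSpace N V]

/-- Richness is applied only to extensions by a single free path; the image of such an extension in
a later stage is the operation demanded by `Chain.ops`. -/
theorem exists_chain_of_isFraisseLimit (hPQ : ∀ i j : Fin (N + 1), Q i j ↔ P i j)
    (hK : ∀ (V : Type u) [ColoredSpace N V], K V ↔ Generated N flag P (Set.univ : Set V))
    (h : IsFraisseLimit (fun V [ColoredSpace N V] => K V)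
      (fun {V W} [ColoredSpace N V] [ColoredSpace N W] (f : V → W) => IsStrongEmbedding Q f) V) :
    ∃ A : ℕ → Set V, Chain N P A ∧ ∃ F, StartSet N flag F ∧ Strong N P F (A 0) := by
  obtain ⟨A, h1, h2, h3, h4⟩ := h
  have hG : ∀ n, Generated N flag P (A n) := fun n => (generated_coe _).1 ((hK _).1 (h2 n))
  obtain ⟨-, F, hF, hFA⟩ := hG 0
  refine ⟨A, ⟨fun x => ?_, fun n m hnm => ?_, hF.strong.trans hFA.all, ?_⟩, F, hF, hFA⟩
  · have : x ∈ ⋃ i, A i := h1 ▸ Set.mem_univ x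
    exact Set.mem_iUnion.1 this
  · obtain ⟨hsub, hS⟩ := h3 n m hnm
    exact (isStrongEmbedding_inclusion hPQ hsub).1 hS
  · intro n i j a c hP he
    obtain ⟨a', c', rfl, rfl, he'⟩ := he.coe
    obtain ⟨B, _, f, b, hf, hα⟩ := exists_freeExtension he'
    have hKB : K B := by
      refine (hK B).2 ?_
      obtain ⟨h5, F', h6, h7⟩ := ((generated_coe (A n)).2 (hG n)).map hf
      rw [Set.image_univ] at h5 h7
      have h8 := h7.trans (.single hP hα)
      exact ⟨(Strong.single (P := P) hP hα).finite h5, F', h6, h8⟩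
    obtain ⟨m, hnm, g, hg, hgf⟩ := h4 n B hKB f
      ((isStrongEmbedding_iff hPQ).2 ⟨hf, .single hP hα⟩)
    obtain ⟨hg1, hg2⟩ := (isStrongEmbedding_iff hPQ).1 hg
    have hgv : PIso N Set.univ ((Subtype.val : A m → V) ∘ g) := PIso.comp (pIso_val _ _) hg1
    have hα' := hα.map hgv
    have hval : ((Subtype.val : A m → V) ∘ g) ∘ f = Subtype.val := funext hgf
    rw [Option.map_map, Option.map_map, hval, ← Set.range_comp, hval, Subtype.range_val] at hα'
    have himg := hα'.eq_union
    refine ⟨m, _, hnm, himg ▸ hα', ?_⟩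
    rw [← himg, Set.image_univ, Set.range_comp]
    have := hg2.map (pIso_val (A m) Set.univ)
    rwa [Set.image_univ, Subtype.range_val] at this

/-- An arbitrary strong extension is imitated one operation at a time, keeping the image strong in
some stage. -/
theorem Chain.isFraisseLimit (hPQ : ∀ i j : Fin (N + 1), Q i j ↔ P i j)
    (hK : ∀ (V : Type u) [ColoredSpace N V], K V ↔ Generated N flag P (Set.univ : Set V))
    {A : ℕ → Set V} (h : Chain N P A) [Nonempty V] {F : Set V} (hF : StartSet N flag F)
    (hFA : Strong N P F (A 0)) :
    IsFraisseLimit (fun V [ColoredSpace N V] => K V)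
      (fun {V W} [ColoredSpace N V] [ColoredSpace N W] (f : V → W) => IsStrongEmbedding Q f) V := by
  refine ⟨A, ?_, fun n => ?_, fun n m hnm => ?_, fun n B _ _ f hf => ?_⟩
  · exact Set.eq_univ_of_forall fun x => Set.mem_iUnion.2 (h.cover x)
  · exact (hK _).2 ((generated_coe _).2
      ⟨h.finite n, F, hF, hFA.trans (h.strong 0 n (Nat.zero_le n))⟩)
  · exact ⟨h.mono hnm, (isStrongEmbedding_inclusion hPQ _).2 (h.strong n m hnm)⟩
  · obtain ⟨hf1, hf2⟩ := (isStrongEmbedding_iff hPQ).1 hf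
    have hinj : Function.Injective f := Set.injOn_univ.1 hf1.inj
    obtain ⟨y⟩ := ‹Nonempty V›
    -- On the image of f this is the inverse of f; elsewhere the value y is a dummy.
    let g : B → V := Function.extend f Subtype.val fun _ => y
    have hgf : ∀ x, g (f x) = x := fun x => hinj.extend_apply _ _ x
    have hg : PIso N (Set.range f) g := by
      refine ⟨?_, ?_, ?_⟩
      · rintro _ ⟨x, rfl⟩ _ ⟨z, rfl⟩ hxz
        rw [hgf, hgf] at hxz
        rw [Subtype.ext hxz]
      · rintro _ ⟨x, rfl⟩
        rw [hgf]
        exact (hf1.lev_eq x trivial).symm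
      · rintro _ ⟨x, rfl⟩ _ ⟨z, rfl⟩
        rw [hgf, hgf]
        exact (hf1.lk_iff x trivial z trivial).symm
    -- An operation over X, which is strong in `A m`, is carried out over all of `A m`. Its
    -- restriction to X remains strong by free amalgamation.
    have hcl : Closed N P fun X : Set V => ∃ m, n ≤ m ∧ Strong N P X (A m) := by
      rintro X ⟨m, hm, hX⟩ i j a c hP he
      obtain ⟨l, b, hml, hα, hs⟩ := h.ops m i j a c hP (he.mono hX.subset)
      exact ⟨b, _, hα.restrict hX.subset he, l, hm.trans hml, (hX.commute hα he).trans hs⟩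
    obtain ⟨g', hg', heq, m, hnm, hs⟩ := hf2.extend hcl hg ⟨n, le_rfl, by
      rw [← Set.range_comp, show g ∘ f = Subtype.val from funext hgf, Subtype.range_val]
      exact .refl⟩
    rw [Set.image_univ] at hs
    refine ⟨m, hnm, fun x => ⟨g' x, hs.subset ⟨x, rfl⟩⟩, (isStrongEmbedding_iff hPQ).2 ⟨?_, ?_⟩,
      fun x => (heq ⟨x, rfl⟩).trans (hgf x)⟩
    · exact ⟨fun x hx z hz hxz => hg'.inj hx hz (congrArg Subtype.val hxz), hg'.lev_eq, hg'.lk_iff⟩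
    · rw [← Strong.image_iff (pIso_val (A m) Set.univ), Set.image_univ, Subtype.range_val,
        ← Set.range_comp]
      exact hs

theorem allIntervals_iff (i j : Fin (N + 1)) : allIntervals N i j ↔ allI i j := Iff.rfl

theorem singletons_iff (i j : Fin (N + 1)) : singletons N i j ↔ singI i j := Fin.ext_iff

theorem kInfty_iff : KInfty N V ↔ Generated N False allI (Set.univ : Set V) := by
  refine and_congr Set.finite_univ_iff.symm ?_
  rw [strongSub_iff allIntervals_iff]
  constructor
  · exact fun h => ⟨∅, .inl ⟨not_false, rfl⟩, h⟩
  · rintro ⟨F, ⟨-, rfl⟩ | ⟨h, -⟩, hs⟩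
    · exact hs
    · exact h.elim

theorem kZero_iff : KZero N V ↔ Generated N True singI (Set.univ : Set V) := by
  refine and_congr Set.finite_univ_iff.symm (exists_congr fun F => ?_)
  rw [strongSub_iff singletons_iff, isFlag_iff]
  refine and_congr ⟨fun h => .inr ⟨trivial, h⟩, ?_⟩ Iff.rfl
  rintro (⟨h, -⟩ | ⟨-, h⟩)
  · exact absurd trivial h
  · exact h

end Limits

/-! ### Existence of the limits -/

section Restrict

variable {N : ℕ} {V : Type u} [ColoredSpace N V] {P : ℕ → ℕ → Prop}

/-- A rich chain of strong subspaces is a chain in its union. -/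
theorem chain_iUnion {A : ℕ → Set V} (hstrong : ∀ n m, n ≤ m → Strong N P (A n) (A m))
    (hstart : Strong N allI ∅ (A 0)) (hne : (A 0).Nonempty)
    (hops : ∀ n i j a c, P i j → Ends N i j a c (A n) → ∃ m b, n ≤ m ∧
      Alpha N i j a c b (A n) (A n ∪ b '' Set.Icc i j) ∧
      Strong N P (A n ∪ b '' Set.Icc i j) (A m)) :
    Chain N P fun n => (Subtype.val ⁻¹' A n : Set ↥(⋃ n, A n)) := by
  obtain ⟨x₀, hx₀⟩ := hne
  have : Nonempty ↥(⋃ n, A n) := ⟨⟨x₀, Set.mem_iUnion.2 ⟨0, hx₀⟩⟩⟩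
  have hval : PIso N (Set.univ : Set ↥(⋃ n, A n)) Subtype.val := pIso_val _ _
  have himg : ∀ n, Subtype.val '' (Subtype.val ⁻¹' A n : Set ↥(⋃ n, A n)) = A n := fun n => by
    rw [Subtype.image_preimage_coe]
    exact Set.inter_eq_right.2 (Set.subset_iUnion A n)
  refine ⟨fun x => (Set.mem_iUnion.1 x.2).imp fun _ h => h, fun n m hnm => ?_, ?_, fun n i j a c hP he => ?_⟩
  · rw [← Strong.image_iff hval, himg, himg]
    exact hstrong n m hnm
  · rw [← Strong.image_iff hval, himg, Set.image_empty]
    exact hstart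
  · have he' := he.map (hval.mono (Set.subset_univ _))
    rw [himg] at he'
    obtain ⟨m, b, hnm, hα, hs⟩ := hops n i j _ _ hP he'
    obtain ⟨g, hg, hgv, -⟩ := hval.exists_inv
    rw [Set.image_univ, Subtype.range_val] at hg
    have hgA : ∀ k, g '' A k = Subtype.val ⁻¹' A k := fun k => by
      rw [← himg k, Set.image_image]
      refine (Set.image_congr fun x _ => hgv x trivial).trans ?_
      rw [Set.image_id', himg]
    have hD : A n ∪ b '' Set.Icc i j ⊆ ⋃ n, A n := hs.subset.trans (Set.subset_iUnion A m)
    have hα' := hα.map (hg.mono hD)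
    have hgo : ∀ o : Option ↥(⋃ n, A n), (o.map Subtype.val).map g = o := by
      rintro (_ | x)
      · rfl
      · exact congrArg some (hgv x trivial)
    rw [hgo, hgo, hgA] at hα'
    have hs' := hs.map (hg.mono (Set.subset_iUnion A m))
    rw [hgA, hα'.eq_union] at hs'
    rw [hα'.eq_union] at hα'
    exact ⟨m, _, hnm, hα', hs'⟩

end Restrict

/-- The vertices of the limits: the vertex of level `m` of the path with the levels `i, …, j` that
is added at stage `n` between `a` and `c`. The vertex `im` stands for the imaginary vertices. -/
inductive FreeVertex (N : ℕ) : Type u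
  | im : FreeVertex N
  | new (n i j m : ℕ) (a c : FreeVertex N) : FreeVertex N

namespace FreeVertex

variable {N : ℕ}

/-- The level of a vertex. -/
def height : FreeVertex.{u} N → ℕ
  | im => 0
  | new _ _ _ m _ _ => m

/-- The stage at which a vertex is added. -/
def stage : FreeVertex.{u} N → ℕ
  | im => 0
  | new n _ _ _ _ _ => n

/-- The ascending edges. -/
inductive Up : FreeVertex.{u} N → FreeVertex.{u} N → Prop
  | path (n i j m : ℕ) (a c : FreeVertex N) : Up (new n i j m a c) (new n i j (m + 1) a c)
  | lo (n i j : ℕ) (a c : FreeVertex N) : Up a (new n i j i a c)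
  | up (n i j : ℕ) (a c : FreeVertex N) : Up (new n i j j a c) c

/-- The ascending edges between vertices of consecutive levels that are at most `N`. -/
def UpLev (x y : FreeVertex.{u} N) : Prop :=
  Up x y ∧ min x.height N + 1 = min y.height N

/-- The minimum with N turns the levels of arbitrary terms into admissible ones; it has no effect on
the vertices in the stages, whose heights are at most N. -/
instance coloredSpace : ColoredSpace N (FreeVertex.{u} N) where
  level x := ⟨min x.height N, Nat.lt_succ_of_le (min_le_right _ _)⟩
  graph :=
    { Adj := fun x y => UpLev x y ∨ UpLev y x
      symm := ⟨fun _ _ h => h.symm⟩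
      loopless := ⟨fun x h => by
        rcases h with h | h <;> exact absurd h.2 (Nat.succ_ne_self _)⟩ }
  adj_level h := h.imp And.right And.right

/-- Real vertices. -/
def toOption : FreeVertex.{u} N → Option (FreeVertex.{u} N)
  | im => none
  | x => some x

theorem toOption_eq_some {x y : FreeVertex.{u} N} : x.toOption = some y ↔ x = y ∧ y ≠ im := by
  cases x with
  | im =>
    simp only [toOption, reduceCtorEq, false_iff, not_and, not_not]
    exact fun h => h.symm
  | new n i j m a c =>
    simp only [toOption, Option.some.injEq]
    exact ⟨fun h => ⟨h, fun h' => by rw [h'] at h; cases h⟩, And.left⟩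

/-! ### Carrying out all possible operations stage by stage -/

section Stages

/-- The vertices of the paths with the data in `G` that are added to `C` at stage `n`. -/
def addPaths (n : ℕ) (C : Set (FreeVertex.{u} N)) (G : Set (ℕ × ℕ × FreeVertex.{u} N × FreeVertex.{u} N)) :
    Set (FreeVertex.{u} N) :=
  C ∪ {x | ∃ i j m a c, (i, j, a, c) ∈ G ∧ i ≤ m ∧ m ≤ j ∧ x = new n i j m a c}

variable (P : ℕ → ℕ → Prop)

/-- The data of the possible operations for intervals with `P`. -/
def data (C : Set (FreeVertex.{u} N)) : Set (ℕ × ℕ × FreeVertex.{u} N × FreeVertex.{u} N) :=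
  {d | P d.1 d.2.1 ∧ Ends N d.1 d.2.1 d.2.2.1.toOption d.2.2.2.toOption C}

/-- The stages of the construction. -/
def space : ℕ → Set (FreeVertex.{u} N)
  | 0 => {x | ∃ m ≤ N, x = new 0 0 N m im im}
  | n + 1 => addPaths (n + 1) (space n) (data P (space n))

variable {P}

theorem stage_le {n : ℕ} {x : FreeVertex.{u} N} (hx : x ∈ space P n) : x.stage ≤ n := by
  induction n with
  | zero =>
    obtain ⟨m, -, rfl⟩ := hx
    exact le_rfl
  | succ n ih =>
    rcases hx with hx | ⟨i, j, m, a, c, -, -, -, rfl⟩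
    · exact (ih hx).trans n.le_succ
    · exact le_rfl

theorem ne_im {n : ℕ} {x : FreeVertex.{u} N} (hx : x ∈ space P n) : x ≠ im := by
  induction n with
  | zero =>
    obtain ⟨m, -, rfl⟩ := hx
    exact fun h => by cases h
  | succ n ih =>
    rcases hx with hx | ⟨i, j, m, a, c, -, -, -, rfl⟩
    · exact ih hx
    · exact fun h => by cases h

/-- The end points of the path to which a vertex belongs have been added before. -/
theorem stage_ends {n : ℕ} {k i j m : ℕ} {a c : FreeVertex.{u} N}
    (hx : new k i j m a c ∈ space P n) : i ≤ m ∧ m ≤ j ∧ (a = im ∨ a.stage < k) ∧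
      (c = im ∨ c.stage < k) := by
  induction n with
  | zero =>
    obtain ⟨m, hm, h⟩ := hx
    cases h
    exact ⟨Nat.zero_le _, hm, .inl rfl, .inl rfl⟩
  | succ n ih =>
    rcases hx with hx | ⟨i, j, m, a, c, hd, hi, hj, h⟩
    · exact ih hx
    · cases h
      have hend : ∀ x : FreeVertex.{u} N, (∀ y, x.toOption = some y → y ∈ space P n) →
          x = im ∨ x.stage < n + 1 := by
        intro x hx
        by_cases hxi : x = im
        · exact .inl hxi
        · exact .inr (Nat.lt_succ_of_le (stage_le (hx x (toOption_eq_some.2 ⟨rfl, hxi⟩))))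
      exact ⟨hi, hj, hend a fun y hy => (hd.2.lo_some y hy).1,
        hend c fun y hy => (hd.2.up_some y hy).1⟩

theorem height_le {n : ℕ} {x : FreeVertex.{u} N} (hx : x ∈ space P n) : x.height ≤ N := by
  induction n with
  | zero =>
    obtain ⟨m, hm, rfl⟩ := hx
    exact hm
  | succ n ih =>
    rcases hx with hx | ⟨i, j, m, a, c, hd, hi, hj, rfl⟩
    · exact ih hx
    · exact hj.trans hd.2.le_top

theorem lev_eq_height {n : ℕ} {x : FreeVertex.{u} N} (hx : x ∈ space P n) : lev x = x.height :=
  min_eq_left (height_le hx)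

theorem lk_iff_of_height {x y : FreeVertex.{u} N} (hx : x.height ≤ N) (hy : y.height ≤ N) :
    Lk x y ↔ (Up x y ∧ x.height + 1 = y.height) ∨ (Up y x ∧ y.height + 1 = x.height) := by
  change UpLev x y ∨ UpLev y x ↔ _
  rw [UpLev, UpLev, min_eq_left hx, min_eq_left hy]

/-- A vertex is linked only along its own path and to ends of paths, and ends belong to strictly
earlier stages than their paths. So different paths of the same stage are not linked, and they can
be added in any order. -/
theorem alpha_addPaths {n : ℕ} {G : Set (ℕ × ℕ × FreeVertex.{u} N × FreeVertex.{u} N)}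
    (hG : G ⊆ data P (space P n)) {i j : ℕ} {a c : FreeVertex.{u} N}
    (hd : (i, j, a, c) ∈ data P (space P n)) (hdG : (i, j, a, c) ∉ G) :
    Alpha N i j a.toOption c.toOption (fun m => new (n + 1) i j m a c)
      (addPaths (n + 1) (space P n) G)
      (addPaths (n + 1) (space P n) (insert (i, j, a, c) G)) := by
  have he : Ends N i j a.toOption c.toOption (space P n) := hd.2
  have htop := he.le_top
  have hsub : addPaths (n + 1) (space P n) (insert (i, j, a, c) G) ⊆ space P (n + 1) := by
    rintro x (hx | ⟨i', j', m, a', c', hd', h⟩)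
    · exact .inl hx
    · refine .inr ⟨i', j', m, a', c', ?_, h⟩
      rcases hd' with hd' | hd'
      · rw [hd']
        exact hd
      · exact hG hd'
  refine ⟨he.le, he.le_top, he.lo_none, fun x hx => ⟨.inl (he.lo_some x hx).1, (he.lo_some x hx).2⟩,
    he.up_none, fun x hx => ⟨.inl (he.up_some x hx).1, (he.up_some x hx).2⟩,
    fun x y hx hy => (he.ends x y hx hy).mono Set.subset_union_left, fun m hi hj => ?_,
    fun m hi hj => ?_, fun x => ?_, fun m hi hj x hx => ?_⟩
  · exact min_eq_left (hj.trans htop)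
  · rintro (h | ⟨i', j', m', a', c', h1, -, -, h2⟩)
    · have : n + 1 ≤ n := stage_le h
      omega
    · cases h2
      exact hdG h1
  · constructor
    · rintro (hx | ⟨i', j', m, a', c', hd' | hd', h1, h2, rfl⟩)
      · exact .inl (.inl hx)
      · cases hd'
        exact .inr ⟨m, h1, h2, rfl⟩
      · exact .inl (.inr ⟨i', j', m, a', c', hd', h1, h2, rfl⟩)
    · rintro ((hx | ⟨i', j', m, a', c', hd', h1, h2, rfl⟩) | ⟨m, h1, h2, rfl⟩)
      · exact .inl hx
      · exact .inr ⟨i', j', m, a', c', .inr hd', h1, h2, rfl⟩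
      · exact .inr ⟨i, j, m, a, c, .inl rfl, h1, h2, rfl⟩
  · have hxs := hsub hx
    have hxn := ne_im hxs
    rw [lk_iff_of_height (hj.trans htop) (height_le hxs), toOption_eq_some, toOption_eq_some]
    constructor
    · rintro (⟨h, hl⟩ | ⟨h, hl⟩)
      · cases h with
        | path => 
          exact .inl ⟨m + 1, by omega, (stage_ends hxs).2.1, rfl, .inl rfl⟩
        -- Here a vertex of stage n + 1 would be the lower end of a path of stage at most n + 1.
        | lo k i' j' a' c' =>
          have h1 := (stage_ends hxs).2.2.1
          have h2 := stage_le hxs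
          rcases h1 with h1 | h1
          · cases h1
          · simp only [stage] at h1 h2
            omega
        | up => exact .inr (.inr ⟨rfl, rfl, hxn⟩)
      · generalize hb : new (n + 1) i j m a c = b at h hl
        cases h with
        | path k i' j' m' a' c' =>
          cases hb
          exact .inl ⟨m', (stage_ends hxs).1, by omega, rfl, .inr rfl⟩
        | lo =>
          cases hb
          exact .inr (.inl ⟨rfl, rfl, hxn⟩)
        | up k i' j' a' c' =>
          have h1 := (stage_ends hxs).2.2.2
          have h2 := stage_le hxs
          rcases h1 with h1 | h1
          · rw [← hb] at h1
            cases h1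
          · rw [← hb] at h1
            simp only [stage] at h1 h2
            omega
    · rintro (⟨m', h1, h2, rfl, rfl | rfl⟩ | ⟨rfl, rfl, h1⟩ | ⟨rfl, rfl, h1⟩)
      · exact .inl ⟨.path _ _ _ _ _ _, rfl⟩
      · exact .inr ⟨.path _ _ _ _ _ _, rfl⟩
      · refine .inr ⟨.lo _ _ _ _ _, ?_⟩
        rw [← lev_eq_height hxs]
        exact (he.lo_some _ (toOption_eq_some.2 ⟨rfl, h1⟩)).2
      · refine .inl ⟨.up _ _ _ _ _, ?_⟩
        rw [← lev_eq_height hxs]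
        exact (he.up_some _ (toOption_eq_some.2 ⟨rfl, h1⟩)).2.symm

/-- The case G = ∅ shows that each stage is strong in the next one; the case of a singleton G shows
that a stage remains strong in the next one after any one of the paths has been added. -/
theorem strong_addPaths {n : ℕ} {G H : Set (ℕ × ℕ × FreeVertex.{u} N × FreeVertex.{u} N)}
    (hG : G ⊆ data P (space P n)) (hH : H ⊆ data P (space P n)) (hf : H.Finite) :
    Strong N P (addPaths (n + 1) (space P n) G) (addPaths (n + 1) (space P n) (H ∪ G)) := by
  induction H, hf using Set.Finite.induction_on with
  | empty =>
    rw [Set.empty_union]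
    exact .refl
  | @insert d H _ _ ih =>
    have h1 := ih ((Set.subset_insert d H).trans hH)
    by_cases hd : d ∈ H ∪ G
    · rwa [Set.insert_union, Set.insert_eq_of_mem hd]
    · rw [Set.insert_union]
      have hd' := hH (Set.mem_insert d H)
      exact h1.trans (.single hd'.1 (alpha_addPaths
        (Set.union_subset ((Set.subset_insert d H).trans hH) hG) hd' hd))

theorem finite_data {C : Set (FreeVertex.{u} N)} (hC : C.Finite) : (data P C).Finite := by
  refine ((Set.finite_Iic N).prod ((Set.finite_Iic N).prod
    ((hC.insert im).prod (hC.insert im)))).subset ?_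
  rintro ⟨i, j, a, c⟩ ⟨-, he⟩
  have hend : ∀ x : FreeVertex.{u} N, (∀ y, x.toOption = some y → y ∈ C) → x ∈ insert im C := by
    intro x hx
    by_cases hxi : x = im
    · exact .inl hxi
    · exact .inr (hx x (toOption_eq_some.2 ⟨rfl, hxi⟩))
  exact ⟨he.le.trans he.le_top, he.le_top, hend a fun y hy => (he.lo_some y hy).1,
    hend c fun y hy => (he.up_some y hy).1⟩

theorem addPaths_empty (n : ℕ) (C : Set (FreeVertex.{u} N)) : addPaths n C ∅ = C := by
  simp [addPaths]

theorem alpha_space_zero :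
    Alpha N 0 N none none (fun m => new 0 0 N m im im) ∅ (space.{u} (N := N) P 0) := by
  have hmem : ∀ m ≤ N, new 0 0 N m im im ∈ space.{u} (N := N) P 0 := fun m hm => ⟨m, hm, rfl⟩
  refine ⟨Nat.zero_le _, le_rfl, fun _ => rfl, fun _ h => (by cases h), fun _ => rfl,
    fun _ h => (by cases h), fun _ _ h => (by cases h), fun m _ hm => min_eq_left hm,
    fun m _ _ h => h, fun x => ?_, fun m _ hm x hx => ?_⟩
  · constructor
    · rintro ⟨m, hm, rfl⟩
      exact .inr ⟨m, Nat.zero_le m, hm, rfl⟩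
    · rintro (h | ⟨m, -, hm, rfl⟩)
      · exact absurd h (Set.notMem_empty _)
      · exact hmem m hm
  · have hxn := ne_im hx
    obtain ⟨l, hl, rfl⟩ := hx
    rw [lk_iff_of_height hm hl]
    constructor
    · rintro (⟨-, h⟩ | ⟨-, h⟩)
      · exact .inl ⟨l, Nat.zero_le l, hl, rfl, .inl h⟩
      · exact .inl ⟨l, Nat.zero_le l, hl, rfl, .inr h⟩
    · rintro (⟨l', -, -, h1, h2⟩ | ⟨-, h⟩ | ⟨-, h⟩)
      · cases h1
        rcases h2 with rfl | rfl
        · exact .inl ⟨.path _ _ _ _ _ _, rfl⟩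
        · exact .inr ⟨.path _ _ _ _ _ _, rfl⟩
      · cases h
      · cases h

theorem finite_space (n : ℕ) : (space.{u} (N := N) P n).Finite := by
  induction n with
  | zero => exact (Strong.single (P := allI) trivial alpha_space_zero).finite Set.finite_empty
  | succ n ih =>
    have := strong_addPaths (Set.empty_subset _) subset_rfl (finite_data (N := N) (P := P) ih)
    rw [Set.union_empty, addPaths_empty] at this
    exact this.finite ih

theorem strong_space {n m : ℕ} (hnm : n ≤ m) : Strong N P (space.{u} (N := N) P n) (space P m) := by
  induction m, hnm using Nat.le_induction with
  | base => exact .refl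
  | succ m _ ih =>
    have := strong_addPaths (Set.empty_subset _) subset_rfl
      (finite_data (N := N) (P := P) (finite_space m))
    rw [Set.union_empty, addPaths_empty] at this
    exact ih.trans this

variable (N P)

/-- Every operation that is possible at stage n is carried out in passing to stage n + 1. -/
theorem chain_space :
    Chain N P fun n => (Subtype.val ⁻¹' space P n : Set ↥(⋃ n, space.{u} (N := N) P n)) := by
  refine chain_iUnion (fun n m hnm => strong_space hnm) (.single trivial alpha_space_zero)
    ⟨_, 0, Nat.zero_le N, rfl⟩ fun n i j a c hPij he => ?_
  have hopt : ∀ o : Option (FreeVertex.{u} N), (∀ x, o = some x → x ∈ space P n) →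
      ∃ x : FreeVertex.{u} N, x.toOption = o := by
    rintro (_ | x) hx
    · exact ⟨im, rfl⟩
    · exact ⟨x, toOption_eq_some.2 ⟨rfl, ne_im (hx x rfl)⟩⟩
  obtain ⟨a, rfl⟩ := hopt a fun x hx => (he.lo_some x hx).1
  obtain ⟨c, rfl⟩ := hopt c fun x hx => (he.up_some x hx).1
  have hd : (i, j, a, c) ∈ data P (space P n) := ⟨hPij, he⟩
  have hα := alpha_addPaths (Set.empty_subset _) hd (Set.notMem_empty _)
  have hs := strong_addPaths (Set.singleton_subset_iff.2 hd) subset_rfl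
    (finite_data (finite_space n))
  rw [Set.union_singleton, Set.insert_eq_of_mem hd] at hs
  rw [insert_empty_eq, addPaths_empty] at hα
  have himg := hα.eq_union
  rw [himg] at hα hs
  exact ⟨n + 1, _, n.le_succ, hα, hs⟩

end Stages

end FreeVertex

/-! ### The limits of the two classes -/

section Main

variable {N : ℕ}

theorem exists_isMZero (N : ℕ) : ∃ (M : Type u) (_ : ColoredSpace N M), IsMZero N M := by
  have hα : Alpha N 0 N none none (fun m => FreeVertex.new 0 0 N m .im .im) ∅
      (FreeVertex.space.{u} (N := N) singI 0) := FreeVertex.alpha_space_zero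
  have hsub := Set.subset_iUnion (fun n => FreeVertex.space.{u} (N := N) singI n) 0
  have : Nonempty ↥(⋃ n, FreeVertex.space.{u} (N := N) singI n) :=
    ⟨⟨_, hsub (hα.mem_b le_rfl (Nat.zero_le N))⟩⟩
  refine ⟨↥(⋃ n, FreeVertex.space.{u} (N := N) singI n), inferInstance, ?_⟩
  have hgen : Generated N True singI (FreeVertex.space.{u} (N := N) singI 0) :=
    ⟨FreeVertex.finite_space 0, _, .inr ⟨trivial, _, hα⟩, .refl⟩
  rw [← Set.inter_eq_right.2 hsub, ← Subtype.image_preimage_coe,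
    Generated.image_iff (pIso_val _ _)] at hgen
  obtain ⟨-, F, hF, hs⟩ := hgen
  exact (FreeVertex.chain_space N singI).isFraisseLimit singletons_iff (fun _ _ => kZero_iff) hF hs

theorem exists_isMInfty (N : ℕ) : ∃ (M : Type u) (_ : ColoredSpace N M), IsMInfty N M := by
  have hα : Alpha N 0 N none none (fun m => FreeVertex.new 0 0 N m .im .im) ∅
      (FreeVertex.space.{u} (N := N) allI 0) := FreeVertex.alpha_space_zero
  have hsub := Set.subset_iUnion (fun n => FreeVertex.space.{u} (N := N) allI n) 0
  have : Nonempty ↥(⋃ n, FreeVertex.space.{u} (N := N) allI n) :=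
    ⟨⟨_, hsub (hα.mem_b le_rfl (Nat.zero_le N))⟩⟩
  refine ⟨↥(⋃ n, FreeVertex.space.{u} (N := N) allI n), inferInstance, ?_⟩
  have h := FreeVertex.chain_space.{u} N allI
  -- The flag at stage 0 is obtained from the empty space by one operation, so the empty set serves
  -- as starting point.
  exact h.isFraisseLimit allIntervals_iff (fun _ _ => kInfty_iff) (.inl ⟨not_false, rfl⟩) h.start

variable {M : Type u} [ColoredSpace N M]

theorem IsMZero.isPrimeModel (h : IsMZero N M) : IsPrimeModel.{u, v} (PS N) M := by
  obtain ⟨A, hA, F, hF, hs⟩ := exists_chain_of_isFraisseLimit singletons_iff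
    (fun _ _ => kZero_iff) h
  rcases hF with ⟨hF, -⟩ | ⟨-, b, hF⟩
  · exact absurd trivial hF
  have : Nonempty M := ⟨b 0⟩
  have hM := model_PS hA.scon hA.extProp
  refine ⟨hM, fun M' S _ hM' => ?_⟩
  obtain ⟨C, rfl⟩ := exists_coloredSpace (hM'.mono fun φ hφ => .inl (.inl hφ))
  exact hA.exists_elementaryEmbedding hF hs hM hM'

theorem IsMInfty.exists_chain (h : IsMInfty N M) : ∃ A : ℕ → Set M, Chain N allI A := by
  obtain ⟨A, hA, -⟩ := exists_chain_of_isFraisseLimit allIntervals_iff (fun _ _ => kInfty_iff) h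
  exact ⟨A, hA⟩

theorem IsMInfty.model (h : IsMInfty N M) : M ⊨ PS N := by
  obtain ⟨A, hA⟩ := h.exists_chain
  exact model_PS hA.scon hA.rich.extProp

theorem IsMInfty.isOmegaSaturated (h : IsMInfty N M) : IsOmegaSaturated (psLang N) M := by
  obtain ⟨A, hA⟩ := h.exists_chain
  exact hA.isOmegaSaturated

end Main

end FreePseudospace

theorem corollary4p32 (N : ℕ) (hN : 1 ≤ N) :
    ((∃ (M : Type u) (_ : FreePseudospace.ColoredSpace N M), FreePseudospace.IsMZero N M) ∧
      ∀ (M : Type u) [FreePseudospace.ColoredSpace N M], FreePseudospace.IsMZero N M →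
        FreePseudospace.IsPrimeModel.{u, v} (FreePseudospace.PS N) M) ∧
    ((∃ (M : Type u) (_ : FreePseudospace.ColoredSpace N M), FreePseudospace.IsMInfty N M) ∧
      ∀ (M : Type u) [FreePseudospace.ColoredSpace N M], FreePseudospace.IsMInfty N M →
        FirstOrder.Language.Theory.Model M (FreePseudospace.PS N) ∧
        FreePseudospace.IsOmegaSaturated (FreePseudospace.psLang N) M) :=
  ⟨⟨FreePseudospace.exists_isMZero N, fun _ _ h => h.isPrimeModel⟩,
    ⟨FreePseudospace.exists_isMInfty N, fun _ _ h => ⟨h.model, h.isOmegaSaturated⟩⟩⟩
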